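/- Let $\nu>0$ and let $U_{\rm in}:[-1,1]\to\mathbb R$ satisfy $U_{\rm in}-y\in H^4(-1,1)$, $U_{\rm in}(\pm1)=\pm1$, $\partial_y^2U_{\rm in}(\pm1)=0$. Put $U(t,y)=y+e^{\nu t\partial_y^2}(U_{\rm in}-y)$, where $e^{s\partial_y^2}$ is the heat semigroup on $(-1,1)$ with homogeneous Dirichlet boundary conditions. For $k\in\mathbb Z\setminus\{0\}$ write $\nabla_k=(ik,\partial_y)$, $\Delta_k=\partial_y^2-k^2$, and let $\Delta_k^{-1}$ be the inverse of $\Delta_k$ with Dirichlet conditions at $y=\pm1$. Define $$\|w\|_{\mathcal Z}^2=\nu^{1/3}|k|^{2/3}\|\rho_k^{1/2}w\|_{L^2_y}^2+|k|^2\|\nabla_k\Delta_k^{-1}w\|_{L^2_y}^2+\nu^{1/2}|k|\,\|w\|_{L^2_y}^2,\qquad \rho_k(y)=\min\{\nu^{-1/3}|k|^{1/3}(1-|y|),1\}.$$ Let $f_1,f_2\in L^2_{\rm loc}([0,\infty);L^2(-1,1))$ and $\omega_{\rm in}\in L^2(-1,1)$ be complex-valued with $\int_{-1}^1e^{\pm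 ky}\omega_{\rm in}\,dy=0$, and let $\omega_k\in L^2_{\rm loc}([0,\infty);L^2(-1,1))$, with stream function $\psi_k$, be a weak solution (the evolution equation, with its initial condition, being tested against functions in $H^2_0(-1,1)$) of $$\partial_t\omega_k+ikU\omega_k-ikU''\psi_k-\nu\Delta_k\omega_k=ikf_1+\partial_yf_2,\quad \Delta_k\psi_k=\omega_k,\quad \psi_k|_{y=\pm1}=\partial_y\psi_k|_{y=\pm1}=0,\quad \omega_k|_{t=0}=\omega_{\rm in},$$ so that $\int_{-1}^1e^{\pm ky}\omega_k(t,y)\,dy=0$ for almost every $t\ge0$. There is a universal constant $\zeta>0$, and for every $K>0$ there is a constant $C=C(K)>0$, such that for all such $\nu,k,U_{\rm in},f_1,f_2,\omega_{\rm in},\omega_k$ with $\|U_{\rm in}-y\|_{H^4(-1,1)}\le K$ and $$\nu|k|^2\ge\tfrac12\|\partial_yU\|_{L^\infty_{t,y}}$$ one has $$\|e^{\zeta\nu^{1/3}t}(1-|y|)^{1/2}\omega_k\|_{L^\infty_tL^2_y}^2+\|e^{\zeta\nu^{1/3}t}\omega_k\|_{L^2_t\mathcal Z}^2\le C\Big(\nu^{-1}\big(\|e^{\zeta\nu^{1/3}t}f_1\|_{L^2_tL^2_y}^2+\|e^{\zeta\nu^{1/3}t}f_2\|_{L^2_tL^2_y}^2\big)+\|\omega_{\rm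 in}\|_{L^2_y}^2\Big),$$ where $t$ ranges over $(0,\infty)$, $y$ over $(-1,1)$, and the right-hand side may be $+\infty$. -/

import Mathlib

open MeasureTheory Set

noncomputable section

namespace NearCouette

/-- Lebesgue measure on the cross-section `(-1, 1)` of the channel (variable `y`). -/
def muY : Measure ℝ := volume.restrict (Ioo (-1) 1)

/-- Lebesgue measure on the time half-line `(0, ∞)`. -/
def muT : Measure ℝ := volume.restrict (Ioi 0)

/-- `G 0` belongs to the Sobolev space `H^m(-1, 1)` and `G 0, G 1, …, G m` are its successive weak
derivatives: each `G j` with `j < m` is (the continuous representative of) a primitive of `G (j + 1)`,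
and `G m` is square integrable. -/
structure SobolevOn {E : Type*} [NormedAddCommGroup E] [NormedSpace ℝ E] (m : ℕ) (G : ℕ → ℝ → E) :
    Prop where
  primitive : ∀ j < m, ∀ y ∈ Icc (-1 : ℝ) 1, G j y = G j (-1) + ∫ s in (-1 : ℝ)..y, G (j + 1) s
  memLp : MemLp (G m) 2 muY

/-- `Φ 0` belongs to `H^2_0(-1, 1)`, with derivatives `Φ 1` and `Φ 2`. -/
structure SobolevTwoZero (Φ : ℕ → ℝ → ℂ) : Prop where
  sobolev : SobolevOn 2 Φ
  left_zero : Φ 0 (-1) = 0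
  right_zero : Φ 0 1 = 0
  left_deriv_zero : Φ 1 (-1) = 0
  right_deriv_zero : Φ 1 1 = 0

/-! ### The background shear flow -/

/-- The heat semigroup `e^{s ∂_y^2}` on `(-1, 1)` with homogeneous Dirichlet conditions, through the
orthonormal basis of eigenfunctions `sin (n π (y + 1) / 2)`, `n ≥ 1`, of `∂_y^2`. -/
def dirichletHeat (s : ℝ) (v : ℝ → ℝ) (y : ℝ) : ℝ :=
  ∑' n : ℕ, Real.exp (-(s * (((n : ℝ) + 1) * Real.pi / 2) ^ 2)) *
    (∫ z in (-1 : ℝ)..1, v z * Real.sin (((n : ℝ) + 1) * Real.pi / 2 * (z + 1))) *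
      Real.sin (((n : ℝ) + 1) * Real.pi / 2 * (y + 1))

/-- The heat extension `U(t, y) = y + e^{ν t ∂_y^2} (U_in - y)`. -/
def heatShear (ν : ℝ) (Uin : ℝ → ℝ) (t y : ℝ) : ℝ :=
  y + dirichletHeat (ν * t) (fun z => Uin z - z) y

/-- The assumptions on the initial shear: `‖U_in - y‖_{H^4(-1,1)} ≤ K`, `U_in(±1) = ±1` and
`∂_y^2 U_in(±1) = 0`. -/
def AdmissibleShear (K : ℝ) (Uin : ℝ → ℝ) : Prop :=
  ∃ V : ℕ → ℝ → ℝ, (∀ y ∈ Icc (-1 : ℝ) 1, V 0 y = Uin y - y) ∧ SobolevOn 4 V ∧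
    ∑ j ∈ Finset.range 5, ∫ y, V j y ^ 2 ∂muY ≤ K ^ 2 ∧
    V 0 (-1) = 0 ∧ V 0 1 = 0 ∧ V 2 (-1) = 0 ∧ V 2 1 = 0

/-- The high-frequency regime `ν |k|^2 ≥ (1/2) ‖∂_y U‖_{L^∞_{t,y}}`. -/
def HighFrequency (ν : ℝ) (k : ℤ) (U : ℝ → ℝ → ℝ) : Prop :=
  2⁻¹ * eLpNorm (fun p : ℝ × ℝ => deriv (U p.1) p.2) ⊤ (muT.prod muY) ≤
    ENNReal.ofReal (ν * |(k : ℝ)| ^ 2)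

/-! ### The linearized problem -/

/-- The consistency condition `∫_{-1}^1 e^{± k y} w(y) dy = 0`. -/
def Consistent (k : ℤ) (w : ℝ → ℂ) : Prop :=
  ∫ y, (Real.exp (k * y) : ℂ) * w y ∂muY = 0 ∧ ∫ y, (Real.exp (-(k * y)) : ℂ) * w y ∂muY = 0

/-- `(ω, ψ)` is a weak solution, global in time, of the `k`-th mode of the linearized problem
`∂_t ω + i k U ω - i k U'' ψ - ν Δ_k ω = i k f₁ + ∂_y f₂`, `Δ_k ψ = ω`,
`ψ = ∂_y ψ = 0` at `y = ±1`, `ω(0) = ω_in`, where `Δ_k = ∂_y^2 - k^2`. The evolution equation is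
tested against functions in `H^2_0(-1, 1)` and integrated over `(0, t)`. -/
structure IsSolution (ν : ℝ) (k : ℤ) (U : ℝ → ℝ → ℝ) (f₁ f₂ : ℝ → ℝ → ℂ) (ωin : ℝ → ℂ)
    (ω ψ : ℝ → ℝ → ℂ) : Prop where
  /-- `ω ∈ L^2_loc([0, ∞); L^2(-1, 1))`. -/
  vorticity_memLp : ∀ T : ℝ, MemLp (fun p : ℝ × ℝ => ω p.1 p.2) 2
    ((volume.restrict (Ioo 0 T)).prod muY)
  stream_measurable : AEStronglyMeasurable (fun p : ℝ × ℝ => ψ p.1 p.2) (muT.prod muY)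
  /-- `ψ(t) ∈ H^2_0(-1, 1)` (which contains both boundary conditions) and `Δ_k ψ(t) = ω(t)`. -/
  stream : ∀ᵐ t ∂muT, ∃ Ψ : ℕ → ℝ → ℂ, Ψ 0 = ψ t ∧ SobolevTwoZero Ψ ∧
    ∀ᵐ y ∂muY, Ψ 2 y - (k : ℂ) ^ 2 * Ψ 0 y = ω t y
  consistent : ∀ᵐ t ∂muT, Consistent k (ω t)
  consistent_init : Consistent k ωin
  equation : ∀ Φ : ℕ → ℝ → ℂ, SobolevTwoZero Φ → ∀ᵐ t ∂muT,
    ∫ y, ω t y * Φ 0 y ∂muY = (∫ y, ωin y * Φ 0 y ∂muY) +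
      ∫ s in (0 : ℝ)..t, ∫ y,
        ((-(Complex.I * k * (U s y : ℂ) * ω s y)
            + Complex.I * k * ((deriv (deriv (U s)) y : ℝ) : ℂ) * ψ s y) * Φ 0 y
          + (ν : ℂ) * ω s y * (Φ 2 y - (k : ℂ) ^ 2 * Φ 0 y)
          + Complex.I * k * f₁ s y * Φ 0 y - f₂ s y * Φ 1 y) ∂muY

/-! ### Norms (all squared, with values in `[0, ∞]`) -/

/-- `‖g‖_{L^2_y}^2`. -/
def normSqY (g : ℝ → ℂ) : ENNReal := ∫⁻ y, ‖g y‖ₑ ^ 2 ∂muY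

/-- `‖F‖_{L^2_t L^2_y}^2`. -/
def normSqTY (F : ℝ → ℝ → ℂ) : ENNReal := ∫⁻ t, normSqY (F t) ∂muT

/-- `‖F‖_{L^∞_t L^2_y}^2`. -/
def normSqSupTY (F : ℝ → ℝ → ℂ) : ENNReal := essSup (fun t => normSqY (F t)) muT

/-- `φ` is the solution in `H^2(-1, 1)` of `(∂_y^2 - k^2) φ = w`, `φ(±1) = 0`. -/
def IsDirichletSolution (k : ℤ) (w φ : ℝ → ℂ) : Prop :=
  ∃ Φ : ℕ → ℝ → ℂ, Φ 0 = φ ∧ SobolevOn 2 Φ ∧ Φ 0 (-1) = 0 ∧ Φ 0 1 = 0 ∧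
    ∀ᵐ y ∂muY, Φ 2 y - (k : ℂ) ^ 2 * Φ 0 y = w y

open Classical in
/-- The inverse `Δ_k^{-1}` of the Dirichlet Laplacian `Δ_k = ∂_y^2 - k^2` on `L^2(-1, 1)`; the value
is unique on `[-1, 1]`. -/
def dirichletInv (k : ℤ) (w : ℝ → ℂ) : ℝ → ℂ :=
  if h : ∃ φ, IsDirichletSolution k w φ then h.choose else 0

/-- The boundary weight `ρ_k(y) = min {L (1 - |y|), 1}` with `L = ν^{-1/3} |k|^{1/3}`. -/
def rho (ν : ℝ) (k : ℤ) (y : ℝ) : ℝ :=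
  min (ν ^ (-(1 / 3 : ℝ)) * |(k : ℝ)| ^ (1 / 3 : ℝ) * (1 - |y|)) 1

/-- `‖w‖_𝒵^2 = ν^{1/3} |k|^{2/3} ‖ρ_k^{1/2} w‖^2 + |k|^2 ‖∇_k Δ_k^{-1} w‖^2 + ν^{1/2} |k| ‖w‖^2`,
where `∇_k = (i k, ∂_y)` and all norms on the right are in `L^2_y`. -/
def normSqZ (ν : ℝ) (k : ℤ) (w : ℝ → ℂ) : ENNReal :=
  ENNReal.ofReal (ν ^ (1 / 3 : ℝ) * |(k : ℝ)| ^ (2 / 3 : ℝ)) *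
      normSqY (fun y => (Real.sqrt (rho ν k y) : ℂ) * w y)
    + ENNReal.ofReal (|(k : ℝ)| ^ 2) *
      (normSqY (fun y => Complex.I * k * dirichletInv k w y) + normSqY (deriv (dirichletInv k w)))
    + ENNReal.ofReal (ν ^ (1 / 2 : ℝ) * |(k : ℝ)|) * normSqY w

/-- `‖F‖_{L^2_t 𝒵}^2`. -/
def normSqTZ (ν : ℝ) (k : ℤ) (F : ℝ → ℝ → ℂ) : ENNReal := ∫⁻ t, normSqZ ν k (F t) ∂muT

/-- The time weight `e^{ζ ν^{1/3} t}`. -/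
def timeWeight (ζ ν t : ℝ) : ℂ := (Real.exp (ζ * ν ^ (1 / 3 : ℝ) * t) : ℂ)

end NearCouette

end

/-! The estimate is proved for the vorticity as a trajectory in the Hilbert space of consistent
functions, the image of `H^2_0(-1, 1)` under `Δ_k = ∂_y^2 - k^2`.

*Weak formulation.* Let `M w = (∂_y ψ, k ψ)` be the velocity of the vorticity `w = Δ_k ψ`. For `φ` in
`H^2_0`, `∫ w φ̄` is minus the inner product of the velocities of `w` and of `Δ_k φ`. Hence the
equation, tested with stream functions, reads `(M† M ω)' = -ν ω + M† (N ω + F)`, where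
`F = (f₂, -i f₁)` and `N ω` is the transport term in divergence form
(`IsSolution.dissipativeEvolution`). All energy estimates below are made for this abstract evolution,
`DissipativeEvolution`. Because only `M† M ω` is known to be absolutely continuous in time, the
equation is first smoothed by `M† M (M† M + ε)⁻¹`, which commutes with `M† M`; the commutators with
transport disappear as `ε → 0` by dominated convergence.

*Dissipation.* The background flow enters the energy balance of the velocity only through the term
`Re ⟪M w, N w⟫ = Re (i k ∫ U' ψ ∂_y ψ̄)`. Together with the elliptic estimate
`2 k² ‖∂_y ψ‖² + k⁴ ‖ψ‖² ≤ ‖w‖²` the bound `|U'| ≤ 2 ν k²` makes it at most `3/4 ν ‖w‖²`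
(`transport_le`), so a quarter of the viscous dissipation survives. This controls
`ν k² ∫ e^{2 σ t} ‖ω‖² dt` for every rate `σ ≤ ν k² / 16` (`DissipativeEvolution.integral_le`).
Since `U(±1) = ±1` forces `ν k² ≥ 1/2`, the rate `ν^{1/3} / 32` is admissible, and the norm of `𝒵` is
bounded by `6 ν k²` times the one of `L^2` (`normSqZ_le`).

*Pointwise bound.* To bound `‖ω(t)‖` itself, the equation is tested with the material derivative
`η = ω' + X ω`, where `X ω = Δ_k (i k U ψ)`. The transport term `N ω` is `-M X ω` up to a term of order
zero (`transport_error_le`), and `X` is skew-adjoint up to terms bounded by `ν k² ‖ω‖²`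
(`drift_skew_le`), so `‖M η‖²` absorbs the force and what remains is controlled by the dissipation
(`material_energy_le`, `DissipativeEvolution.norm_sq_le`). This is the only place where a bound for
`∂_y^2 U`, hence the constant `K`, is used; it comes from the decay of the sine coefficients of
`U_in - y` (`exists_isHeatProfile`). The boundary weight `(1 - |y|)^{1/2}` is simply bounded by `1`. -/

noncomputable section

namespace NearCouette

/-! ### Product rule for primitives of integrable functions -/

section Primitive

variable {E F G : Type*} [NormedAddCommGroup E] [NormedSpace ℝ E] [NormedAddCommGroup F]
  [NormedSpace ℝ F] [NormedAddCommGroup G] [NormedSpace ℝ G]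

/-- `f` is absolutely continuous on `[a, b]` in the sense that it is a primitive of the integrable
function `f'`. -/
structure IsPrimitiveOn (a b : ℝ) (f f' : ℝ → E) : Prop where
  integrable : IntervalIntegrable f' volume a b
  eq_add : ∀ t ∈ Icc a b, f t = f a + ∫ s in a..t, f' s

theorem IsPrimitiveOn.mono {a b c : ℝ} {f f' : ℝ → E} (h : IsPrimitiveOn a b f f')
    (hc : c ∈ Icc a b) : IsPrimitiveOn a c f f' := by
  refine ⟨h.integrable.mono_set ?_, fun t ht => h.eq_add t ⟨ht.1, ht.2.trans hc.2⟩⟩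
  rw [uIcc_of_le hc.1, uIcc_of_le (hc.1.trans hc.2)]
  exact Icc_subset_Icc_right hc.2

theorem IsPrimitiveOn.clm_comp [CompleteSpace E] [CompleteSpace F] {a b : ℝ} {f f' : ℝ → E}
    (h : IsPrimitiveOn a b f f') (L : E →L[ℝ] F) :
    IsPrimitiveOn a b (fun t => L (f t)) (fun t => L (f' t)) := by
  refine ⟨⟨L.integrable_comp h.integrable.1, L.integrable_comp h.integrable.2⟩, fun t ht => ?_⟩
  rw [h.eq_add t ht, map_add, L.intervalIntegral_comp_comm (h.mono ht).integrable]

theorem IsPrimitiveOn.add {a b : ℝ} {f f' g g' : ℝ → E}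
    (hf : IsPrimitiveOn a b f f') (hg : IsPrimitiveOn a b g g') :
    IsPrimitiveOn a b (fun t => f t + g t) (fun t => f' t + g' t) := by
  refine ⟨hf.integrable.add hg.integrable, fun t ht => ?_⟩
  rw [hf.eq_add t ht, hg.eq_add t ht,
    intervalIntegral.integral_add (hf.mono ht).integrable (hg.mono ht).integrable]
  abel

theorem IsPrimitiveOn.of_hasDerivAt [CompleteSpace E] {a b : ℝ} {f f' : ℝ → E}
    (h : ∀ t, HasDerivAt f (f' t) t) (h' : Continuous f') : IsPrimitiveOn a b f f' := by
  refine ⟨h'.intervalIntegrable _ _, fun t _ => ?_⟩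
  rw [intervalIntegral.integral_eq_sub_of_hasDerivAt (fun x _ => h x) (h'.intervalIntegrable _ _)]
  abel

theorem IsPrimitiveOn.congr {a b : ℝ} (hab : a ≤ b) {f f' g g' : ℝ → E}
    (h : IsPrimitiveOn a b f f')
    (hfg : ∀ t ∈ Icc a b, g t = f t) (hfg' : ∀ t ∈ Icc a b, g' t = f' t) :
    IsPrimitiveOn a b g g' := by
  refine ⟨h.integrable.congr ?_, fun t ht => ?_⟩
  · intro t ht
    rw [uIoc_of_le hab] at ht
    exact (hfg' t ⟨ht.1.le, ht.2⟩).symm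
  · rw [hfg t ht, hfg a ⟨le_rfl, hab⟩, h.eq_add t ht]
    congr 1
    refine intervalIntegral.integral_congr fun s hs => ?_
    rw [uIcc_of_le ht.1] at hs
    exact (hfg' s ⟨hs.1, hs.2.trans ht.2⟩).symm

theorem setIntegral_Ioc_indicator_Iic {a b t : ℝ} (u : ℝ → E) (ht : t ∈ Ioc a b) :
    ∫ s in Ioc a b, (Iic t).indicator u s = ∫ s in a..t, u s := by
  rw [integral_indicator measurableSet_Iic, Measure.restrict_restrict measurableSet_Iic,
    intervalIntegral.integral_of_le ht.1.le]
  congr 2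
  ext s; simp only [mem_inter_iff, mem_Iic, mem_Ioc]
  constructor
  · rintro ⟨h1, h2, h3⟩; exact ⟨h2, h1⟩
  · rintro ⟨h1, h2⟩; exact ⟨h2, h1, h2.trans ht.2⟩

theorem setIntegral_Ioc_indicator_Iio {a b t : ℝ} (u : ℝ → E) (ht : t ∈ Ioc a b) :
    ∫ s in Ioc a b, (Iio t).indicator u s = ∫ s in a..t, u s := by
  rw [← setIntegral_Ioc_indicator_Iic u ht, integral_indicator measurableSet_Iic,
    integral_indicator measurableSet_Iio]
  exact setIntegral_congr_set Iio_ae_eq_Iic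

theorem continuousOn_primitive_Icc {a b : ℝ} (hab : a ≤ b) {u : ℝ → E}
    (hu : IntervalIntegrable u volume a b) :
    ContinuousOn (fun t => ∫ s in a..t, u s) (Icc a b) := by
  have := intervalIntegral.continuousOn_primitive_interval (a := a) (b := b) (f := u)
    (μ := volume) (by
      rw [uIcc_of_le hab]
      exact (intervalIntegrable_iff_integrableOn_Icc_of_le hab).1 hu)
  rwa [uIcc_of_le hab] at this

theorem IsPrimitiveOn.continuousOn {a b : ℝ} {f f' : ℝ → E} (h : IsPrimitiveOn a b f f') :
    ContinuousOn f (Icc a b) := by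
  rcases le_or_gt a b with hab | hab
  · exact (continuousOn_const.add (continuousOn_primitive_Icc hab h.integrable)).congr h.eq_add
  · rw [Icc_eq_empty (not_le.2 hab)]; exact continuousOn_empty _

/-- The product rule for two primitives that vanish at `a`: Fubini on the square `(a, b] × (a, b]`,
split along the diagonal. -/
theorem integral_bilin_integral [CompleteSpace E] [CompleteSpace F] [CompleteSpace G]
    (B : E →L[ℝ] F →L[ℝ] G) {a b : ℝ} (hab : a ≤ b) {f' : ℝ → E} {g' : ℝ → F}
    (hf : IntervalIntegrable f' volume a b) (hg : IntervalIntegrable g' volume a b) :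
    B (∫ s in a..b, f' s) (∫ s in a..b, g' s) =
      ∫ t in a..b, (B (f' t) (∫ s in a..t, g' s) + B (∫ s in a..t, f' s) (g' t)) := by
  set μ : Measure ℝ := volume.restrict (Ioc a b) with hμ
  have hf1 : Integrable f' μ := (intervalIntegrable_iff_integrableOn_Ioc_of_le hab).1 hf
  have hg1 : Integrable g' μ := (intervalIntegrable_iff_integrableOn_Ioc_of_le hab).1 hg
  set h : ℝ × ℝ → G := fun p => B (f' p.1) (g' p.2) with hh
  have hint : Integrable h (μ.prod μ) := by
    refine Integrable.op_fst_snd (op := fun x y => B x y) ?_ ?_ hf1 hg1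
    · exact B.continuous₂
    · exact ⟨‖B‖, fun x y => B.le_opNorm₂ x y⟩
  have hA : MeasurableSet {p : ℝ × ℝ | p.2 ≤ p.1} := measurableSet_le measurable_snd measurable_fst
  have hA' : MeasurableSet {p : ℝ × ℝ | p.2 ≤ p.1}ᶜ := hA.compl
  -- the part below the diagonal is integrated in the second variable first, the part above it in the
  -- first variable first
  have h1 : ∫ p, {p : ℝ × ℝ | p.2 ≤ p.1}.indicator h p ∂(μ.prod μ)
      = ∫ t, B (f' t) (∫ s in a..t, g' s) ∂μ := by
    rw [integral_prod _ (hint.indicator hA)]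
    refine setIntegral_congr_fun measurableSet_Ioc fun t ht => ?_
    have : ∀ s, {p : ℝ × ℝ | p.2 ≤ p.1}.indicator h (t, s)
        = B (f' t) ((Iic t).indicator g' s) := by
      intro s
      by_cases hs : s ≤ t
      · rw [indicator_of_mem (by exact hs), indicator_of_mem (by exact hs)]
      · rw [indicator_of_notMem (by exact hs), indicator_of_notMem (by exact hs), map_zero]
    simp only [this]
    rw [ContinuousLinearMap.integral_comp_comm _ (hg1.indicator measurableSet_Iic), setIntegral_Ioc_indicator_Iic g' ht]
  have h2 : ∫ p, ({p : ℝ × ℝ | p.2 ≤ p.1}ᶜ).indicator h p ∂(μ.prod μ)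
      = ∫ t, B (∫ s in a..t, f' s) (g' t) ∂μ := by
    rw [integral_prod_symm _ (hint.indicator hA')]
    refine setIntegral_congr_fun measurableSet_Ioc fun t ht => ?_
    have : ∀ s, ({p : ℝ × ℝ | p.2 ≤ p.1}ᶜ).indicator h (s, t)
        = (B.flip (g' t)) ((Iio t).indicator f' s) := by
      intro s
      by_cases hs : s < t
      · rw [indicator_of_mem (by simpa using hs), indicator_of_mem (by exact hs)]
        rfl
      · rw [indicator_of_notMem (by simpa using hs), indicator_of_notMem (by exact hs), map_zero]
    simp only [this]
    rw [ContinuousLinearMap.integral_comp_comm _ (hf1.indicator measurableSet_Iio), setIntegral_Ioc_indicator_Iio f' ht]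
    rfl
  have h3 : ∫ p, h p ∂(μ.prod μ) = B (∫ s, f' s ∂μ) (∫ s, g' s ∂μ) := by
    rw [integral_prod _ hint]
    have : ∀ t, ∫ s, h (t, s) ∂μ = (B.flip (∫ s, g' s ∂μ)) (f' t) := by
      intro t
      simp only [hh]
      rw [ContinuousLinearMap.integral_comp_comm _ hg1]; rfl
    simp only [this]
    rw [ContinuousLinearMap.integral_comp_comm _ hf1]; rfl
  have hsum : (fun p => {p : ℝ × ℝ | p.2 ≤ p.1}.indicator h p
      + ({p : ℝ × ℝ | p.2 ≤ p.1}ᶜ).indicator h p) = h := by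
    funext p; exact congrFun (indicator_self_add_compl _ h) p
  rw [intervalIntegral.integral_of_le hab, intervalIntegral.integral_of_le hab,
    intervalIntegral.integral_of_le hab, ← h3]
  rw [← hsum, integral_add (hint.indicator hA) (hint.indicator hA'), h1, h2, integral_add]
  · have hc := continuousOn_primitive_Icc hab hg
    obtain ⟨C, hC⟩ := isCompact_Icc.exists_bound_of_continuousOn hc
    have hm : AEStronglyMeasurable (fun t => B (f' t) (∫ s in a..t, g' s)) μ :=
      (B.continuous₂.comp_aestronglyMeasurable
        (hf1.aestronglyMeasurable.prodMk
          ((hc.mono Ioc_subset_Icc_self).aestronglyMeasurable measurableSet_Ioc)))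
    refine Integrable.mono' ((hf1.norm.const_mul ‖B‖).mul_const C) hm ?_
    refine (ae_restrict_iff' measurableSet_Ioc).2 (Filter.Eventually.of_forall fun t ht => ?_)
    refine (B.le_opNorm₂ _ _).trans ?_
    gcongr
    exact hC t ⟨ht.1.le, ht.2⟩
  · have hc := continuousOn_primitive_Icc hab hf
    obtain ⟨C, hC⟩ := isCompact_Icc.exists_bound_of_continuousOn hc
    have hm : AEStronglyMeasurable (fun t => B (∫ s in a..t, f' s) (g' t)) μ :=
      (B.continuous₂.comp_aestronglyMeasurable
        (((hc.mono Ioc_subset_Icc_self).aestronglyMeasurable measurableSet_Ioc).prodMk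
          hg1.aestronglyMeasurable))
    refine Integrable.mono' (hg1.norm.const_mul (‖B‖ * C)) hm ?_
    refine (ae_restrict_iff' measurableSet_Ioc).2 (Filter.Eventually.of_forall fun t ht => ?_)
    refine (B.le_opNorm₂ _ _).trans ?_
    gcongr
    exact hC t ⟨ht.1.le, ht.2⟩

/-- The product rule: a bounded bilinear expression in two primitives is a primitive. -/
theorem IsPrimitiveOn.bilin [CompleteSpace E] [CompleteSpace F] [CompleteSpace G]
    (B : E →L[ℝ] F →L[ℝ] G) {a b : ℝ} (hab : a ≤ b) {f f' : ℝ → E} {g g' : ℝ → F}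
    (hf : IsPrimitiveOn a b f f') (hg : IsPrimitiveOn a b g g') :
    IsPrimitiveOn a b (fun t => B (f t) (g t)) (fun t => B (f' t) (g t) + B (f t) (g' t)) := by
  have i1 : IntervalIntegrable (fun t => B (f' t) (g t)) volume a b := by
    obtain ⟨C, hC⟩ := isCompact_Icc.exists_bound_of_continuousOn hg.continuousOn
    have hf1 := (intervalIntegrable_iff_integrableOn_Icc_of_le hab).1 hf.integrable
    rw [intervalIntegrable_iff_integrableOn_Icc_of_le hab]
    refine Integrable.mono' ((hf1.norm.const_mul ‖B‖).mul_const C)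
      (B.continuous₂.comp_aestronglyMeasurable
        (hf1.aestronglyMeasurable.prodMk (hg.continuousOn.aestronglyMeasurable measurableSet_Icc)))
      ((ae_restrict_iff' measurableSet_Icc).2 (Filter.Eventually.of_forall fun t ht => ?_))
    refine (B.le_opNorm₂ _ _).trans ?_
    gcongr
    exact hC t ht
  have i2 : IntervalIntegrable (fun t => B (f t) (g' t)) volume a b := by
    obtain ⟨C, hC⟩ := isCompact_Icc.exists_bound_of_continuousOn hf.continuousOn
    have hg1 := (intervalIntegrable_iff_integrableOn_Icc_of_le hab).1 hg.integrable
    rw [intervalIntegrable_iff_integrableOn_Icc_of_le hab]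
    refine Integrable.mono' (hg1.norm.const_mul (‖B‖ * C))
      (B.continuous₂.comp_aestronglyMeasurable
        ((hf.continuousOn.aestronglyMeasurable measurableSet_Icc).prodMk hg1.aestronglyMeasurable))
      ((ae_restrict_iff' measurableSet_Icc).2 (Filter.Eventually.of_forall fun t ht => ?_))
    refine (B.le_opNorm₂ _ _).trans ?_
    gcongr
    exact hC t ht
  refine ⟨i1.add i2, fun t ht => ?_⟩
  have hft := hf.mono ht
  have hgt := hg.mono ht
  have hsub : uIcc a t ⊆ uIcc a b := by
    rw [uIcc_of_le ht.1, uIcc_of_le hab]; exact Icc_subset_Icc_right ht.2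
  have e0 := integral_bilin_integral B ht.1 hft.integrable hgt.integrable
  -- subtract the terms that involve the initial values
  have e1 : ∫ s in a..t, (B (f' s) (∫ r in a..s, g' r) + B (∫ r in a..s, f' r) (g' s))
      = ∫ s in a..t, ((B (f' s) (g s) + B (f s) (g' s)) - (B.flip (g a) (f' s) + B (f a) (g' s))) := by
    refine intervalIntegral.integral_congr fun s hs => ?_
    rw [uIcc_of_le ht.1] at hs
    have h1 : ∫ r in a..s, g' r = g s - g a := by rw [hgt.eq_add s hs]; abel
    have h2 : ∫ r in a..s, f' r = f s - f a := by rw [hft.eq_add s hs]; abel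
    simp only [h1, h2, map_sub, ContinuousLinearMap.flip_apply, _root_.sub_apply]
    abel
  have j1 : IntervalIntegrable (fun s => B.flip (g a) (f' s)) volume a t :=
    ⟨(B.flip (g a)).integrable_comp hft.integrable.1, (B.flip (g a)).integrable_comp hft.integrable.2⟩
  have j2 : IntervalIntegrable (fun s => B (f a) (g' s)) volume a t :=
    ⟨(B (f a)).integrable_comp hgt.integrable.1, (B (f a)).integrable_comp hgt.integrable.2⟩
  rw [e1, intervalIntegral.integral_sub ((i1.add i2).mono_set hsub) (j1.add j2),
    intervalIntegral.integral_add j1 j2,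
    (B.flip (g a)).intervalIntegral_comp_comm hft.integrable,
    (B (f a)).intervalIntegral_comp_comm hgt.integrable] at e0
  rw [hft.eq_add t ⟨ht.1, le_rfl⟩, hgt.eq_add t ⟨ht.1, le_rfl⟩]
  simp only [map_add, _root_.add_apply, ContinuousLinearMap.flip_apply] at e0 ⊢
  rw [e0]; abel

end Primitive

/-! ### Resolvent smoothing -/

section Smoothing

variable {V W : Type*} [NormedAddCommGroup V] [InnerProductSpace ℂ V] [CompleteSpace V]
  [NormedAddCommGroup W] [InnerProductSpace ℂ W] [CompleteSpace W]

open ContinuousLinearMap in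
/-- The positive operator `M† M`. -/
def gram (M : V →L[ℂ] W) : V →L[ℂ] V := adjoint M ∘L M

/-- The resolvent `(M† M + ε)⁻¹`. -/
def resolvent (M : V →L[ℂ] W) (ε : ℝ) : V →L[ℂ] V :=
  Ring.inverse (gram M + (ε : ℂ) • (1 : V →L[ℂ] V))

/-- The smoothing operator `M† M (M† M + ε)⁻¹`, a contraction that commutes with `M† M` and
approximates the identity as `ε → 0`. -/
def smoother (M : V →L[ℂ] W) (ε : ℝ) : V →L[ℂ] V := gram M ∘L resolvent M ε

variable (M : V →L[ℂ] W) {ε : ℝ}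

theorem inner_gram_left (x y : V) : inner ℂ (gram M x) y = inner ℂ (M x) (M y) := by
  simp [gram, ContinuousLinearMap.adjoint_inner_left]

theorem inner_gram_right (x y : V) : inner ℂ x (gram M y) = inner ℂ (M x) (M y) := by
  simp [gram, ContinuousLinearMap.adjoint_inner_right]

/-- Lax-Milgram: `M† M + ε` is coercive. -/
theorem isUnit_gram_add (hε : 0 < ε) : IsUnit (gram M + (ε : ℂ) • (1 : V →L[ℂ] V)) := by
  refine ContinuousLinearMap.isUnit_of_forall_le_norm_inner_map _ (c := ⟨ε, hε.le⟩) hε fun x => ?_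
  refine le_trans ?_ (RCLike.re_le_norm _)
  have : inner ℂ ((gram M + (ε : ℂ) • (1 : V →L[ℂ] V)) x) x
      = inner ℂ (M x) (M x) + (ε : ℂ) * inner ℂ x x := by
    simp [inner_gram_left]
  rw [this, inner_self_eq_norm_sq_to_K, inner_self_eq_norm_sq_to_K]
  norm_cast
  simp only [Complex.coe_algebraMap, ← Complex.ofReal_mul,
    ← Complex.ofReal_add, RCLike.re_eq_complex_re, Complex.ofReal_re]
  change ‖x‖ ^ 2 * ε ≤ _
  nlinarith [sq_nonneg ‖M x‖]

theorem gram_resolvent_add (hε : 0 < ε) (x : V) :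
    gram M (resolvent M ε x) + (ε : ℂ) • resolvent M ε x = x := by
  have := Ring.mul_inverse_cancel _ (isUnit_gram_add M hε)
  simpa [resolvent] using congrArg (fun A : V →L[ℂ] V => A x) this

theorem resolvent_gram_add (hε : 0 < ε) (x : V) :
    resolvent M ε (gram M x) + (ε : ℂ) • resolvent M ε x = x := by
  have := Ring.inverse_mul_cancel _ (isUnit_gram_add M hε)
  simpa [resolvent] using congrArg (fun A : V →L[ℂ] V => A x) this

theorem smoother_apply (x : V) : smoother M ε x = gram M (resolvent M ε x) := rfl

theorem resolvent_gram (hε : 0 < ε) (x : V) : resolvent M ε (gram M x) = smoother M ε x := by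
  rw [smoother_apply]
  exact add_right_cancel ((resolvent_gram_add M hε x).trans (gram_resolvent_add M hε x).symm)

theorem smoother_gram (hε : 0 < ε) (x : V) :
    smoother M ε (gram M x) = gram M (smoother M ε x) := by
  rw [smoother_apply, resolvent_gram M hε]

theorem smoother_add (hε : 0 < ε) (x : V) :
    smoother M ε x + (ε : ℂ) • resolvent M ε x = x := gram_resolvent_add M hε x

theorem inner_smoother_left (hε : 0 < ε) (x y : V) :
    inner ℂ (smoother M ε x) y = inner ℂ x (smoother M ε y) := by
  conv_lhs => rw [← smoother_add M hε y]
  conv_rhs => rw [← smoother_add M hε x]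
  simp only [smoother_apply, inner_add_left, inner_add_right, inner_smul_left, inner_smul_right,
    Complex.conj_ofReal]
  simp only [inner_gram_left, inner_gram_right]

/-- The smoothing operator `S` is a contraction, since `Re ⟪S x, x⟫ = ‖S x‖² + ε ‖M R x‖²`, `R` being
the resolvent. -/
theorem norm_smoother_le (hε : 0 < ε) (x : V) : ‖smoother M ε x‖ ≤ ‖x‖ := by
  set z := resolvent M ε x with hz
  have h1 : (inner ℂ (smoother M ε x) x).re = ‖smoother M ε x‖ ^ 2 + ε * ‖M z‖ ^ 2 := by
    have h0 : inner ℂ (smoother M ε x) x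
        = inner ℂ (smoother M ε x) (smoother M ε x + (ε : ℂ) • z) := by rw [hz, smoother_add M hε]
    rw [h0, inner_add_right, inner_smul_right, inner_self_eq_norm_sq_to_K, smoother_apply, ← hz,
      inner_gram_left, inner_self_eq_norm_sq_to_K]
    norm_cast
    simp only [← Complex.ofReal_mul, ← Complex.ofReal_add, Complex.coe_algebraMap, Complex.ofReal_re]
  have h2 : (inner ℂ (smoother M ε x) x).re ≤ ‖smoother M ε x‖ * ‖x‖ :=
    re_inner_le_norm (𝕜 := ℂ) _ _
  rw [h1] at h2
  have h3 : 0 ≤ ε * ‖M z‖ ^ 2 := by positivity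
  by_contra h
  push Not at h
  nlinarith [norm_nonneg x, norm_nonneg (smoother M ε x)]

/-- The smoothing operator is a contraction also for the seminorm `‖M ·‖`. -/
theorem norm_map_smoother_le (hε : 0 < ε) (x : V) : ‖M (smoother M ε x)‖ ≤ ‖M x‖ := by
  set z := resolvent M ε x with hz
  have h1 : (inner ℂ (M (smoother M ε x)) (M x)).re
      = ‖M (smoother M ε x)‖ ^ 2 + ε * ‖smoother M ε x‖ ^ 2 := by
    have h0 : inner ℂ (M (smoother M ε x)) (M x)
        = inner ℂ (M (smoother M ε x)) (M (smoother M ε x + (ε : ℂ) • z)) := by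
      rw [hz, smoother_add M hε]
    rw [h0, map_add, map_smul, inner_add_right, inner_smul_right, inner_self_eq_norm_sq_to_K,
      ← inner_gram_right, hz, ← smoother_apply, inner_self_eq_norm_sq_to_K]
    norm_cast
    simp only [← Complex.ofReal_mul, ← Complex.ofReal_add, Complex.coe_algebraMap, Complex.ofReal_re]
  have h2 : (inner ℂ (M (smoother M ε x)) (M x)).re ≤ ‖M (smoother M ε x)‖ * ‖M x‖ :=
    re_inner_le_norm (𝕜 := ℂ) _ _
  rw [h1] at h2
  have h3 : 0 ≤ ε * ‖smoother M ε x‖ ^ 2 := by positivity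
  by_contra h
  push Not at h
  nlinarith [norm_nonneg (M x), norm_nonneg (M (smoother M ε x))]

/-- The smoothing operators converge strongly to the identity: on the range of `M† M` the error is
`O(ε)`, this range is dense because `M` is injective, and the operators are contractions. -/
theorem tendsto_smoother (hM : ∀ x, M x = 0 → x = 0) {e : ℕ → ℝ} (he : ∀ n, 0 < e n)
    (he0 : Filter.Tendsto e Filter.atTop (nhds 0)) (x : V) :
    Filter.Tendsto (fun n => smoother M (e n) x) Filter.atTop (nhds x) := by
  have hdense : DenseRange (gram M) := by
    have : (gram M).range.topologicalClosure = ⊤ := by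
      rw [Submodule.topologicalClosure_eq_top_iff, Submodule.eq_bot_iff]
      intro y hy
      refine hM y ?_
      have := hy (gram M y) ⟨y, rfl⟩
      rw [inner_gram_left] at this
      exact inner_self_eq_zero.1 this
    have h2 := (Submodule.dense_iff_topologicalClosure_eq_top).2 this
    exact h2
  rw [Metric.tendsto_atTop]
  intro δ hδ
  obtain ⟨_, ⟨z, rfl⟩, hz⟩ := Metric.mem_closure_iff.1 (hdense x) (δ / 3) (by positivity)
  have h1 : Filter.Tendsto (fun n => e n * ‖z‖) Filter.atTop (nhds 0) := by
    simpa using he0.mul_const ‖z‖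
  obtain ⟨n0, hn0⟩ := Filter.eventually_atTop.1 (h1.eventually (gt_mem_nhds (show 0 < δ / 3 by positivity)))
  refine ⟨n0, fun n hn => ?_⟩
  have h2 : ‖smoother M (e n) (gram M z) - gram M z‖ ≤ e n * ‖z‖ := by
    have := smoother_add M (he n) (gram M z)
    rw [resolvent_gram M (he n)] at this
    have h3 : smoother M (e n) (gram M z) - gram M z = -((e n : ℂ) • smoother M (e n) z) := by
      rw [sub_eq_iff_eq_add, eq_comm, neg_add_eq_iff_eq_add, add_comm]; exact this.symm
    rw [h3, norm_neg, norm_smul, Complex.norm_real, Real.norm_of_nonneg (he n).le]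
    exact mul_le_mul_of_nonneg_left (norm_smoother_le M (he n) z) (he n).le
  rw [dist_eq_norm] at hz ⊢
  have h4 : smoother M (e n) x - x = smoother M (e n) (x - gram M z)
      + (smoother M (e n) (gram M z) - gram M z) - (x - gram M z) := by
    rw [map_sub]; abel
  have h5 := norm_smoother_le M (he n) (x - gram M z)
  have h6 := hn0 n hn
  rw [h4]
  calc _ ≤ ‖smoother M (e n) (x - gram M z)‖ + ‖smoother M (e n) (gram M z) - gram M z‖
        + ‖x - gram M z‖ := (norm_sub_le _ _).trans (add_le_add_left (norm_add_le _ _) _)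
    _ < δ := by linarith

end Smoothing

/-! ### Energy estimates for an abstract dissipative evolution -/

section Energy

/-- The derivative of the weighted energy `e^{c t} ‖f‖²`. -/
theorem IsPrimitiveOn.weighted_norm_sq {E : Type*} [NormedAddCommGroup E] [InnerProductSpace ℂ E]
    [CompleteSpace E] {T : ℝ} (hT : 0 ≤ T) {f f' : ℝ → E} (h : IsPrimitiveOn 0 T f f') (c : ℝ) :
    IsPrimitiveOn 0 T (fun t => Real.exp (c * t) * ‖f t‖ ^ 2)
      (fun t => Real.exp (c * t) * (c * ‖f t‖ ^ 2 + 2 * (inner ℂ (f t) (f' t)).re)) := by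
  have h1 := (IsPrimitiveOn.bilin
    (isBoundedBilinearMap_inner (𝕜 := ℂ) (E := E)).toContinuousLinearMap hT h h).clm_comp
      Complex.reCLM
  have he : IsPrimitiveOn 0 T (fun t => Real.exp (c * t)) (fun t => Real.exp (c * t) * c) := by
    refine .of_hasDerivAt (fun t => ?_) (by fun_prop)
    simpa using ((hasDerivAt_id t).const_mul c).exp
  have hsq : ∀ x : E, ((‖x‖ : ℂ) ^ 2).re = ‖x‖ ^ 2 := fun x => by norm_cast
  refine (IsPrimitiveOn.bilin (ContinuousLinearMap.mul ℝ ℝ) hT he h1).congr hT ?_ ?_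
  · intro t _
    simp [hsq]
  · intro t _
    have h2 : (inner ℂ (f' t) (f t)).re = (inner ℂ (f t) (f' t)).re :=
      inner_re_symm (𝕜 := ℂ) _ _
    simp [hsq, h2]
    ring

variable {V W : Type*} [NormedAddCommGroup V] [InnerProductSpace ℂ V] [CompleteSpace V]
  [NormedAddCommGroup W] [InnerProductSpace ℂ W] [CompleteSpace W]

open ContinuousLinearMap in
/-- The right-hand side `-ν u + M† (N u + F)` of the evolution equation for `M† M u`. -/
def evolutionRhs (M : V →L[ℂ] W) (N : ℝ → V →L[ℂ] W) (ν : ℝ) (u : ℝ → V) (F : ℝ → W) (s : ℝ) : V :=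
  adjoint M (N s (u s) + F s) - (ν : ℂ) • u s

/-- A solution `u` of `(M† M u)' = -ν u + M† (N u + F)`, `u(0) = u₀`. The operator `M` is of lower
order, the transport operator `N` is dissipated by `ν`, and it is up to an error of lower order
`-M X`, where `X` is nearly skew-adjoint: `∂_t + X` plays the part of a material derivative.

The equation determines only `M† M u` as a primitive in time; `u` itself is merely square integrable.
All rates are measured in units of `ν / κ`, the rate of dissipation of `‖M u‖²`, where `κ` bounds
`‖M‖²`. -/
structure DissipativeEvolution (M : V →L[ℂ] W) (X : ℝ → V →L[ℂ] V) (N : ℝ → V →L[ℂ] W)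
    (ν κ C₁ C₂ : ℝ) (u₀ : V) (u : ℝ → V) (F : ℝ → W) : Prop where
  ν_pos : 0 < ν
  κ_pos : 0 < κ
  injective : ∀ v, M v = 0 → v = 0
  map_le : ∀ v, ‖M v‖ ^ 2 ≤ κ * ‖v‖ ^ 2
  continuous_X : Continuous X
  continuous_N : Continuous N
  transport_le : ∀ᵐ s ∂muT, ∀ v, (inner ℂ (M v) (N s v)).re ≤ 3 / 4 * ν * ‖v‖ ^ 2
  skew_le : ∀ᵐ s ∂muT, ∀ v, -(inner ℂ v (X s v)).re ≤ C₁ * (ν / κ) * ‖v‖ ^ 2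
  error_le : ∀ᵐ s ∂muT, ∀ v, ‖N s v + M (X s v)‖ ^ 2 ≤ C₂ * ν * (ν / κ) * ‖v‖ ^ 2
  u_memLp : ∀ T : ℝ, MemLp u 2 (volume.restrict (Ioo 0 T))
  F_memLp : ∀ T : ℝ, MemLp F 2 (volume.restrict (Ioo 0 T))
  equation : ∀ᵐ t ∂muT, gram M (u t) = gram M u₀ + ∫ s in (0 : ℝ)..t, evolutionRhs M N ν u F s

/-- The smoothed solution `(M† M) (M† M + ε)⁻¹ u`, as a primitive in time. -/
def smoothedSolution (M : V →L[ℂ] W) (N : ℝ → V →L[ℂ] W) (ν : ℝ) (u₀ : V) (u : ℝ → V) (F : ℝ → W)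
    (ε t : ℝ) : V :=
  smoother M ε u₀ + ∫ s in (0 : ℝ)..t, resolvent M ε (evolutionRhs M N ν u F s)

theorem aestronglyMeasurable_clm_apply {E G : Type*} [NormedAddCommGroup E] [NormedSpace ℂ E]
    [NormedAddCommGroup G] [NormedSpace ℂ G] {μ : Measure ℝ} {A : ℝ → E →L[ℂ] G} (hA : Continuous A)
    {v : ℝ → E} (hv : AEStronglyMeasurable v μ) : AEStronglyMeasurable (fun s => A s (v s)) μ :=
  (isBoundedBilinearMap_apply (𝕜 := ℂ)).continuous.comp_aestronglyMeasurable
    (hA.aestronglyMeasurable.prodMk hv)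

theorem memLp_clm_apply {E G : Type*} [NormedAddCommGroup E] [NormedSpace ℂ E]
    [NormedAddCommGroup G] [NormedSpace ℂ G] {T : ℝ} {A : ℝ → E →L[ℂ] G} (hA : Continuous A)
    {v : ℝ → E} (hv : MemLp v 2 (volume.restrict (Ioo 0 T))) :
    MemLp (fun s => A s (v s)) 2 (volume.restrict (Ioo 0 T)) := by
  obtain ⟨C, hC⟩ := (isCompact_Icc (a := (0 : ℝ)) (b := T)).exists_bound_of_continuousOn
    hA.continuousOn
  refine hv.of_le_mul (c := C) (aestronglyMeasurable_clm_apply hA hv.aestronglyMeasurable)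
    ((ae_restrict_iff' measurableSet_Ioo).2 (Filter.Eventually.of_forall fun s hs => ?_))
  exact (A s).le_of_opNorm_le (hC s ⟨hs.1.le, hs.2.le⟩) _

variable {M : V →L[ℂ] W} {X : ℝ → V →L[ℂ] V} {N : ℝ → V →L[ℂ] W} {ν κ C₁ C₂ : ℝ} {u₀ : V}
  {u : ℝ → V} {F : ℝ → W}

theorem intervalIntegrable_evolutionRhs {T : ℝ} (hT : 0 ≤ T) (hN : Continuous N)
    (hu : MemLp u 2 (volume.restrict (Ioo 0 T))) (hF : MemLp F 2 (volume.restrict (Ioo 0 T))) :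
    IntervalIntegrable (evolutionRhs M N ν u F) volume 0 T := by
  rw [intervalIntegrable_iff_integrableOn_Ioo_of_le hT]
  have h1 : MemLp (evolutionRhs M N ν u F) 2 (volume.restrict (Ioo 0 T)) :=
    (ContinuousLinearMap.comp_memLp' _ ((memLp_clm_apply hN hu).add hF)).sub
      (hu.const_smul (ν : ℂ))
  exact h1.integrable (by norm_num)

theorem DissipativeEvolution.rhs_intervalIntegrable
    (h : DissipativeEvolution M X N ν κ C₁ C₂ u₀ u F) (T : ℝ) (hT : 0 ≤ T) :
    IntervalIntegrable (evolutionRhs M N ν u F) volume 0 T :=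
  intervalIntegrable_evolutionRhs hT h.continuous_N (h.u_memLp T) (h.F_memLp T)

theorem DissipativeEvolution.isPrimitiveOn_smoothed
    (h : DissipativeEvolution M X N ν κ C₁ C₂ u₀ u F) {ε T : ℝ} (hT : 0 ≤ T) :
    IsPrimitiveOn 0 T (smoothedSolution M N ν u₀ u F ε)
      (fun s => resolvent M ε (evolutionRhs M N ν u F s)) := by
  have h1 := h.rhs_intervalIntegrable T hT
  refine ⟨⟨(resolvent M ε).integrable_comp h1.1, (resolvent M ε).integrable_comp h1.2⟩,
    fun t _ => ?_⟩
  simp [smoothedSolution]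

/-- Applying the resolvent to the equation shows that the smoothed solution is a primitive in time. -/
theorem DissipativeEvolution.smoothed_eq
    (h : DissipativeEvolution M X N ν κ C₁ C₂ u₀ u F) {ε : ℝ} (hε : 0 < ε) :
    ∀ᵐ t ∂muT, smoothedSolution M N ν u₀ u F ε t = smoother M ε (u t) := by
  filter_upwards [h.equation, ae_restrict_mem measurableSet_Ioi] with t ht h0
  rw [smoothedSolution, ← resolvent_gram M hε, ← resolvent_gram M hε, ht, map_add]
  congr 1
  exact ((resolvent M ε).restrictScalars ℝ).intervalIntegral_comp_comm
    (h.rhs_intervalIntegrable t (le_of_lt h0))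

theorem DissipativeEvolution.map_smoother_le (h : DissipativeEvolution M X N ν κ C₁ C₂ u₀ u F)
    {ε : ℝ} (hε : 0 < ε) (v : V) : ‖M (smoother M ε v)‖ ^ 2 ≤ κ * ‖v‖ ^ 2 :=
  (h.map_le _).trans (mul_le_mul_of_nonneg_left
    (pow_le_pow_left₀ (norm_nonneg _) (norm_smoother_le M hε v) 2) h.κ_pos.le)

/-- The error made when the smoothing operators are moved across the quadratic form of `N`. -/
def commutatorN (M : V →L[ℂ] W) (N : V →L[ℂ] W) (ε : ℝ) (v : V) : ℝ :=
  (inner ℂ (M (smoother M ε (smoother M ε v))) (N v)).re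
    - (inner ℂ (M (smoother M ε v)) (N (smoother M ε v))).re

/-- The commutator of smoothing with `X`, followed by `M`. -/
def commutatorX (M : V →L[ℂ] W) (X : V →L[ℂ] V) (ε : ℝ) (v : V) : W :=
  M (X (smoother M ε v)) - M (smoother M ε (X v))

open ContinuousLinearMap in
/-- The pairing of the smoothed equation with `M† M w`, where `w` is the smoothed solution: the
dissipation appears with the smoothed solution, and transport and force with the solution itself. -/
theorem inner_map_resolvent {M N : V →L[ℂ] W} {ν ε : ℝ} (hε : 0 < ε) (v : V) (f : W) :
    (inner ℂ (M (smoother M ε v))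
      (M (resolvent M ε (adjoint M (N v + f) - (ν : ℂ) • v)))).re =
    -ν * ‖smoother M ε v‖ ^ 2 + (inner ℂ (M (smoother M ε (smoother M ε v))) (N v)).re
      + (inner ℂ (M (smoother M ε (smoother M ε v))) f).re := by
  rw [← inner_gram_right, ← smoother_apply, ← inner_smoother_left M hε, inner_sub_right,
    adjoint_inner_right, inner_smul_right, inner_smoother_left M hε (smoother M ε v) v,
    inner_self_eq_norm_sq_to_K, inner_add_right]
  norm_cast
  simp only [Complex.sub_re, Complex.add_re, ← Complex.ofReal_mul, Complex.coe_algebraMap,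
    Complex.ofReal_re]
  ring

/-- Testing the smoothed equation with the smoothed solution. -/
theorem basic_energy_le {M N : V →L[ℂ] W} {ν κ σ ε : ℝ} (hν : 0 < ν) (hκ : 0 < κ)
    (hσ0 : 0 ≤ σ) (hσ : σ * κ ≤ ν / 16) (hM : ∀ v, ‖M v‖ ^ 2 ≤ κ * ‖v‖ ^ 2)
    (hN : ∀ v, (inner ℂ (M v) (N v)).re ≤ 3 / 4 * ν * ‖v‖ ^ 2) (hε : 0 < ε) (v : V) (f : W) :
    2 * σ * ‖M (smoother M ε v)‖ ^ 2 + 2 * (inner ℂ (M (smoother M ε v))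
      (M (resolvent M ε (ContinuousLinearMap.adjoint M (N v + f) - (ν : ℂ) • v)))).re ≤
    -(ν / 4) * ‖smoother M ε v‖ ^ 2 + 8 * κ / ν * ‖f‖ ^ 2 + 2 * |commutatorN M N ε v| := by
  rw [inner_map_resolvent hε]
  set w := smoother M ε v
  have h1 : (inner ℂ (M (smoother M ε w)) (N v)).re ≤ 3 / 4 * ν * ‖w‖ ^ 2 + |commutatorN M N ε v| := by
    have := le_abs_self (commutatorN M N ε v)
    have h2 : commutatorN M N ε v = (inner ℂ (M (smoother M ε w)) (N v)).re
      - (inner ℂ (M w) (N w)).re := rfl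
    linarith [hN w]
  have h3 : (inner ℂ (M (smoother M ε w)) f).re ≤ ‖M w‖ * ‖f‖ :=
    (re_inner_le_norm (𝕜 := ℂ) _ _).trans
      (mul_le_mul_of_nonneg_right (norm_map_smoother_le M hε w) (norm_nonneg _))
  have h4 : ‖M w‖ * ‖f‖ ≤ ν / (16 * κ) * ‖M w‖ ^ 2 + 4 * κ / ν * ‖f‖ ^ 2 := by
    have : ν / (16 * κ) * ‖M w‖ ^ 2 + 4 * κ / ν * ‖f‖ ^ 2 - ‖M w‖ * ‖f‖
      = (ν * ‖M w‖ - 8 * κ * ‖f‖) ^ 2 / (16 * κ * ν) := by field_simp; ring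
    have h5 : 0 ≤ (ν * ‖M w‖ - 8 * κ * ‖f‖) ^ 2 / (16 * κ * ν) := by positivity
    linarith
  have h5 : ν / (16 * κ) * ‖M w‖ ^ 2 ≤ ν / 16 * ‖w‖ ^ 2 := by
    have := mul_le_mul_of_nonneg_left (hM w) (show 0 ≤ ν / (16 * κ) by positivity)
    refine this.trans_eq ?_
    field_simp
  have h6 : 2 * σ * ‖M w‖ ^ 2 ≤ ν / 8 * ‖w‖ ^ 2 := by
    have := mul_le_mul_of_nonneg_left (hM w) (show 0 ≤ 2 * σ by positivity)
    nlinarith [sq_nonneg ‖w‖, mul_le_mul_of_nonneg_right hσ (sq_nonneg ‖w‖)]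
  have h7 : 8 * κ / ν * ‖f‖ ^ 2 = 2 * (4 * κ / ν * ‖f‖ ^ 2) := by ring
  rw [h7]
  linarith

/-- Testing the smoothed equation with the material derivative `η = w' + X w` of the smoothed
solution `w`: the square of `‖M η‖` absorbs every term that is tested with `η`. -/
theorem material_energy_le {M N : V →L[ℂ] W} {X : V →L[ℂ] V} {ν C ε : ℝ} (hν : 0 < ν)
    (hX : ∀ v, -(inner ℂ v (X v)).re ≤ C * ‖v‖ ^ 2) (hε : 0 < ε) (v : V) (f : W) :
    (inner ℂ (smoother M ε v)
      (resolvent M ε (ContinuousLinearMap.adjoint M (N v + f) - (ν : ℂ) • v))).re ≤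
    C * ‖smoother M ε v‖ ^ 2
      + ν⁻¹ * (‖commutatorX M X ε v‖ ^ 2 + ‖N v + M (X v)‖ ^ 2 + ‖f‖ ^ 2) := by
  set g := ContinuousLinearMap.adjoint M (N v + f) - (ν : ℂ) • v with hg
  set w := smoother M ε v with hw
  set w' := resolvent M ε g with hw'
  set η := w' + X w with hη
  have e1 : inner ℂ (M w') (M η) = inner ℂ (N v + f) (M (smoother M ε η)) - ν * inner ℂ w η := by
    rw [← inner_gram_left, hw', ← smoother_apply, inner_smoother_left M hε, hg, inner_sub_left,
      ContinuousLinearMap.adjoint_inner_left, inner_smul_left, Complex.conj_ofReal,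
      ← inner_smoother_left M hε]
  have e2 : inner ℂ (M (smoother M ε (X v))) (M η) = inner ℂ (M (X v)) (M (smoother M ε η)) := by
    rw [← inner_gram_left, ← smoother_gram M hε, inner_smoother_left M hε, inner_gram_left]
  have e3 : inner ℂ (M η) (M η) = inner ℂ (commutatorX M X ε v) (M η)
      + inner ℂ ((N v + M (X v)) + f) (M (smoother M ε η)) - ν * inner ℂ w η := by
    have : M η = M w' + (commutatorX M X ε v + M (smoother M ε (X v))) := by
      simp only [commutatorX, hη, map_add, hw]; abel
    calc inner ℂ (M η) (M η) = inner ℂ (M w') (M η) + (inner ℂ (commutatorX M X ε v) (M η)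
          + inner ℂ (M (smoother M ε (X v))) (M η)) := by
          conv_lhs => lhs; rw [this]
          rw [inner_add_left, inner_add_left]
      _ = _ := by rw [e1, e2]; simp only [inner_add_left]; ring
  have e4 : ‖M η‖ ^ 2 = (inner ℂ (commutatorX M X ε v) (M η)).re
      + (inner ℂ ((N v + M (X v)) + f) (M (smoother M ε η))).re - ν * (inner ℂ w η).re := by
    have := congrArg Complex.re e3
    have hsq : (inner ℂ (M η) (M η)).re = ‖M η‖ ^ 2 := inner_self_eq_norm_sq (𝕜 := ℂ) _
    rw [hsq] at this
    rw [this]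
    simp
  have e5 : (inner ℂ w η).re = (inner ℂ w w').re + (inner ℂ w (X w)).re := by
    rw [hη, inner_add_right]; rfl
  have i1 : (inner ℂ (commutatorX M X ε v) (M η)).re ≤ ‖commutatorX M X ε v‖ * ‖M η‖ :=
    re_inner_le_norm (𝕜 := ℂ) _ _
  have i2 : (inner ℂ ((N v + M (X v)) + f) (M (smoother M ε η))).re
      ≤ (‖N v + M (X v)‖ + ‖f‖) * ‖M η‖ :=
    (re_inner_le_norm (𝕜 := ℂ) _ _).trans (mul_le_mul (norm_add_le _ _)
      (norm_map_smoother_le M hε η) (norm_nonneg _) (by positivity))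
  have i3 : ν * (inner ℂ w w').re ≤ ν * (C * ‖w‖ ^ 2)
      + (‖commutatorX M X ε v‖ ^ 2 + ‖N v + M (X v)‖ ^ 2 + ‖f‖ ^ 2) := by
    have h1 := mul_le_mul_of_nonneg_left (hX w) hν.le
    rw [e5] at e4
    generalize ‖commutatorX M X ε v‖ = a at *
    generalize ‖N v + M (X v)‖ = b at *
    generalize ‖f‖ = c at *
    generalize ‖M η‖ = d at *
    nlinarith [sq_nonneg (d - (a + b + c) / 2), sq_nonneg (a - b), sq_nonneg (b - c),
      sq_nonneg (a - c), sq_nonneg a, sq_nonneg b, sq_nonneg c]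
  calc (inner ℂ w w').re = ν⁻¹ * (ν * (inner ℂ w w').re) := by field_simp
    _ ≤ ν⁻¹ * (ν * (C * ‖w‖ ^ 2)
      + (‖commutatorX M X ε v‖ ^ 2 + ‖N v + M (X v)‖ ^ 2 + ‖f‖ ^ 2)) := by gcongr
    _ = _ := by field_simp

end Energy

/-! ### Energy estimates in the limit of vanishing smoothing -/

section EnergyLimit

open Filter Topology

variable {V W : Type*} [NormedAddCommGroup V] [InnerProductSpace ℂ V] [CompleteSpace V]
  [NormedAddCommGroup W] [InnerProductSpace ℂ W] [CompleteSpace W]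

/-- A sequence of smoothing parameters that tends to zero. -/
def smoothingScale (n : ℕ) : ℝ := 1 / ((n : ℝ) + 1)

theorem smoothingScale_pos (n : ℕ) : 0 < smoothingScale n := by
  unfold smoothingScale; positivity

theorem tendsto_smoothingScale : Tendsto smoothingScale atTop (𝓝 0) :=
  tendsto_one_div_add_atTop_nhds_zero_nat

theorem tendsto_smoother_scale {M : V →L[ℂ] W} (hM : ∀ x, M x = 0 → x = 0) (v : V) :
    Tendsto (fun n => smoother M (smoothingScale n) v) atTop (𝓝 v) :=
  tendsto_smoother M hM smoothingScale_pos tendsto_smoothingScale v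

theorem tendsto_smoother_smoother {M : V →L[ℂ] W} (hM : ∀ x, M x = 0 → x = 0) (v : V) :
    Tendsto (fun n => smoother M (smoothingScale n) (smoother M (smoothingScale n) v)) atTop
      (𝓝 v) := by
  have h1 := tendsto_smoother_scale hM v
  have h2 : Tendsto (fun n => smoother M (smoothingScale n) (smoother M (smoothingScale n) v - v))
      atTop (𝓝 0) := by
    refine squeeze_zero_norm (fun n => norm_smoother_le M (smoothingScale_pos n) _) ?_
    exact tendsto_iff_norm_sub_tendsto_zero.1 h1
  simpa [map_sub] using h2.add h1

theorem tendsto_commutatorN {M N : V →L[ℂ] W} (hM : ∀ x, M x = 0 → x = 0) (v : V) :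
    Tendsto (fun n => commutatorN M N (smoothingScale n) v) atTop (𝓝 0) := by
  have h1 := tendsto_smoother_scale hM v
  have h2 := tendsto_smoother_smoother hM v
  have h3 := (Complex.continuous_re.tendsto _).comp
    (((M.continuous.tendsto _).comp h2).inner (𝕜 := ℂ) (tendsto_const_nhds (x := N v)))
  have h4 := (Complex.continuous_re.tendsto _).comp
    (((M.continuous.tendsto _).comp h1).inner (𝕜 := ℂ) ((N.continuous.tendsto _).comp h1))
  simpa [commutatorN] using h3.sub h4

theorem tendsto_commutatorX {M : V →L[ℂ] W} {X : V →L[ℂ] V} (hM : ∀ x, M x = 0 → x = 0) (v : V) :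
    Tendsto (fun n => commutatorX M X (smoothingScale n) v) atTop (𝓝 0) := by
  have h1 := ((M.comp X).continuous.tendsto _).comp (tendsto_smoother_scale hM v)
  have h2 := (M.continuous.tendsto _).comp (tendsto_smoother_scale hM (X v))
  simpa [commutatorX] using h1.sub h2

theorem abs_commutatorN_le {M N : V →L[ℂ] W} {ε B : ℝ} (hε : 0 < ε) (hB : ‖N‖ ≤ B) (v : V) :
    |commutatorN M N ε v| ≤ 2 * ‖M‖ * B * ‖v‖ ^ 2 := by
  have hw := norm_smoother_le M hε v
  have hw2 := (norm_smoother_le M hε (smoother M ε v)).trans hw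
  have key : ∀ a b : V, ‖a‖ ≤ ‖v‖ → ‖b‖ ≤ ‖v‖ →
      |(inner ℂ (M a) (N b)).re| ≤ ‖M‖ * B * ‖v‖ ^ 2 := by
    intro a b ha hb
    calc |(inner ℂ (M a) (N b)).re| ≤ ‖inner ℂ (M a) (N b)‖ := Complex.abs_re_le_norm _
      _ ≤ ‖M a‖ * ‖N b‖ := norm_inner_le_norm _ _
      _ ≤ (‖M‖ * ‖v‖) * (B * ‖v‖) := by
          gcongr
          · exact M.le_opNorm_of_le ha
          · exact (N.le_of_opNorm_le hB b).trans
              (mul_le_mul_of_nonneg_left hb ((norm_nonneg _).trans hB))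
      _ = _ := by ring
  have h1 := key _ v hw2 le_rfl
  have h2 := key _ _ hw hw
  refine (abs_sub _ _).trans ?_
  linarith

theorem norm_commutatorX_sq_le {M : V →L[ℂ] W} {X : V →L[ℂ] V} {ε B : ℝ} (hε : 0 < ε)
    (hB : ‖X‖ ≤ B) (v : V) : ‖commutatorX M X ε v‖ ^ 2 ≤ (2 * ‖M‖ * B) ^ 2 * ‖v‖ ^ 2 := by
  have hB0 : 0 ≤ B := (norm_nonneg _).trans hB
  have h1 : ‖M (X (smoother M ε v))‖ ≤ ‖M‖ * (B * ‖v‖) :=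
    M.le_opNorm_of_le ((X.le_of_opNorm_le hB _).trans
      (mul_le_mul_of_nonneg_left (norm_smoother_le M hε v) hB0))
  have h2 : ‖M (smoother M ε (X v))‖ ≤ ‖M‖ * (B * ‖v‖) :=
    M.le_opNorm_of_le ((norm_smoother_le M hε _).trans (X.le_of_opNorm_le hB _))
  rw [← mul_pow]
  refine pow_le_pow_left₀ (norm_nonneg _) ((norm_sub_le _ _).trans ?_) 2
  linarith

theorem integrable_exp_mul {T c : ℝ} {g : ℝ → ℝ} (hg : Integrable g (volume.restrict (Ioo 0 T))) :
    Integrable (fun s => Real.exp (c * s) * g s) (volume.restrict (Ioo 0 T)) := by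
  refine hg.bdd_mul (c := Real.exp (|c| * T)) (by fun_prop : Continuous _).aestronglyMeasurable
    ((ae_restrict_iff' measurableSet_Ioo).2 (Eventually.of_forall fun s hs => ?_))
  rw [Real.norm_of_nonneg (Real.exp_pos _).le]
  refine Real.exp_le_exp.2 ?_
  calc c * s ≤ |c| * s := mul_le_mul_of_nonneg_right (le_abs_self c) hs.1.le
    _ ≤ |c| * T := mul_le_mul_of_nonneg_left hs.2.le (abs_nonneg c)

theorem aestronglyMeasurable_exp_mul {T c : ℝ} {g : ℝ → ℝ}
    (hg : AEStronglyMeasurable g (volume.restrict (Ioo 0 T))) :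
    AEStronglyMeasurable (fun s => Real.exp (c * s) * g s) (volume.restrict (Ioo 0 T)) :=
  (by fun_prop : Continuous fun s : ℝ => Real.exp (c * s)).aestronglyMeasurable.mul hg

variable {M : V →L[ℂ] W} {X : ℝ → V →L[ℂ] V} {N : ℝ → V →L[ℂ] W} {ν κ C₁ C₂ : ℝ} {u₀ : V}
  {u : ℝ → V} {F : ℝ → W}

/-- Dominated convergence for the time integrals of quantities of size `O(‖u‖ ^ 2)`. -/
theorem tendsto_integral_exp_mul {E : Type*} [NormedAddCommGroup E] {u : ℝ → E} {T c B : ℝ}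
    (hu : MemLp u 2 (volume.restrict (Ioo 0 T)))
    {q : ℕ → ℝ → ℝ} {q₀ : ℝ → ℝ}
    (hm : ∀ n, AEStronglyMeasurable (q n) (volume.restrict (Ioo 0 T)))
    (hb : ∀ n, ∀ s ∈ Ioo 0 T, |q n s| ≤ B * ‖u s‖ ^ 2)
    (hq : ∀ s, Tendsto (fun n => q n s) atTop (𝓝 (q₀ s))) :
    (∀ n, Integrable (fun s => Real.exp (c * s) * q n s) (volume.restrict (Ioo 0 T))) ∧
    Tendsto (fun n => ∫ s in Ioo 0 T, Real.exp (c * s) * q n s) atTop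
      (𝓝 (∫ s in Ioo 0 T, Real.exp (c * s) * q₀ s)) := by
  have hi : Integrable (fun s => Real.exp (c * s) * (B * ‖u s‖ ^ 2)) (volume.restrict (Ioo 0 T)) :=
    integrable_exp_mul ((hu.integrable_norm_pow (by norm_num)).const_mul B)
  have hb' : ∀ n, ∀ᵐ s ∂volume.restrict (Ioo 0 T),
      ‖Real.exp (c * s) * q n s‖ ≤ Real.exp (c * s) * (B * ‖u s‖ ^ 2) := fun n =>
    (ae_restrict_iff' measurableSet_Ioo).2 (Eventually.of_forall fun s hs => by
      rw [norm_mul, Real.norm_of_nonneg (Real.exp_pos _).le]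
      exact mul_le_mul_of_nonneg_left (hb n s hs) (Real.exp_pos _).le)
  exact ⟨fun n => hi.mono' (aestronglyMeasurable_exp_mul (hm n)) (hb' n),
    tendsto_integral_of_dominated_convergence _ (fun n => aestronglyMeasurable_exp_mul (hm n)) hi hb'
      (Eventually.of_forall fun s => (hq s).const_mul _)⟩

theorem tendsto_integral_smoother (h : DissipativeEvolution M X N ν κ C₁ C₂ u₀ u F) (T c : ℝ) :
    (∀ n, Integrable (fun s => Real.exp (c * s) * ‖smoother M (smoothingScale n) (u s)‖ ^ 2)
      (volume.restrict (Ioo 0 T))) ∧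
    Tendsto (fun n => ∫ s in Ioo 0 T, Real.exp (c * s) * ‖smoother M (smoothingScale n) (u s)‖ ^ 2)
      atTop (𝓝 (∫ s in Ioo 0 T, Real.exp (c * s) * ‖u s‖ ^ 2)) := by
  refine tendsto_integral_exp_mul (B := 1) (h.u_memLp T) (fun n => ?_) (fun n s _ => ?_) fun s => ?_
  · exact (((smoother M _).continuous.comp_aestronglyMeasurable
      (h.u_memLp T).aestronglyMeasurable).norm.pow 2)
  · rw [abs_of_nonneg (by positivity), one_mul]
    exact pow_le_pow_left₀ (norm_nonneg _) (norm_smoother_le M (smoothingScale_pos n) _) 2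
  · exact (tendsto_smoother_scale h.injective (u s)).norm.pow 2

theorem tendsto_integral_commutatorN (h : DissipativeEvolution M X N ν κ C₁ C₂ u₀ u F) (T c : ℝ) :
    (∀ n, Integrable (fun s => Real.exp (c * s) * |commutatorN M (N s) (smoothingScale n) (u s)|)
      (volume.restrict (Ioo 0 T))) ∧
    Tendsto (fun n => ∫ s in Ioo 0 T,
      Real.exp (c * s) * |commutatorN M (N s) (smoothingScale n) (u s)|) atTop (𝓝 0) := by
  obtain ⟨B, hB⟩ := (isCompact_Icc (a := (0 : ℝ)) (b := T)).exists_bound_of_continuousOn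
    h.continuous_N.continuousOn
  have hu := (h.u_memLp T).aestronglyMeasurable
  have := tendsto_integral_exp_mul (c := c) (B := 2 * ‖M‖ * B) (q₀ := fun _ => 0) (h.u_memLp T)
    (q := fun n s => |commutatorN M (N s) (smoothingScale n) (u s)|)
    (fun n => ?_) (fun n s hs => ?_) fun s => ?_
  · simpa using this
  · have hS : ∀ v : ℝ → V, AEStronglyMeasurable v (volume.restrict (Ioo 0 T)) →
        AEStronglyMeasurable (fun s => smoother M (smoothingScale n) (v s))
          (volume.restrict (Ioo 0 T)) :=
      fun v hv => (smoother M _).continuous.comp_aestronglyMeasurable hv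
    have hMS : ∀ v : ℝ → V, AEStronglyMeasurable v (volume.restrict (Ioo 0 T)) →
        AEStronglyMeasurable (fun s => M (v s)) (volume.restrict (Ioo 0 T)) :=
      fun v hv => M.continuous.comp_aestronglyMeasurable hv
    have h1 := (hMS _ (hS _ (hS _ hu))).inner (𝕜 := ℂ)
      (aestronglyMeasurable_clm_apply h.continuous_N hu)
    have h2 := (hMS _ (hS _ hu)).inner (𝕜 := ℂ)
      (aestronglyMeasurable_clm_apply h.continuous_N (hS _ hu))
    exact ((Complex.continuous_re.comp_aestronglyMeasurable h1).sub
      (Complex.continuous_re.comp_aestronglyMeasurable h2)).norm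
  · rw [abs_abs]
    exact abs_commutatorN_le (smoothingScale_pos n) (hB s ⟨hs.1.le, hs.2.le⟩) _
  · simpa using (tendsto_commutatorN h.injective (u s)).abs

theorem tendsto_integral_commutatorX (h : DissipativeEvolution M X N ν κ C₁ C₂ u₀ u F) (T c : ℝ) :
    (∀ n, Integrable
      (fun s => Real.exp (c * s) * ‖commutatorX M (X s) (smoothingScale n) (u s)‖ ^ 2)
      (volume.restrict (Ioo 0 T))) ∧
    Tendsto (fun n => ∫ s in Ioo 0 T,
      Real.exp (c * s) * ‖commutatorX M (X s) (smoothingScale n) (u s)‖ ^ 2) atTop (𝓝 0) := by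
  obtain ⟨B, hB⟩ := (isCompact_Icc (a := (0 : ℝ)) (b := T)).exists_bound_of_continuousOn
    h.continuous_X.continuousOn
  have hu := (h.u_memLp T).aestronglyMeasurable
  have := tendsto_integral_exp_mul (c := c) (B := (2 * ‖M‖ * B) ^ 2) (q₀ := fun _ => 0)
    (h.u_memLp T) (q := fun n s => ‖commutatorX M (X s) (smoothingScale n) (u s)‖ ^ 2)
    (fun n => ?_) (fun n s hs => ?_) fun s => ?_
  · simpa using this
  · have hS : ∀ v : ℝ → V, AEStronglyMeasurable v (volume.restrict (Ioo 0 T)) →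
        AEStronglyMeasurable (fun s => smoother M (smoothingScale n) (v s))
          (volume.restrict (Ioo 0 T)) :=
      fun v hv => (smoother M _).continuous.comp_aestronglyMeasurable hv
    have h1 := M.continuous.comp_aestronglyMeasurable
      (aestronglyMeasurable_clm_apply h.continuous_X (hS _ hu))
    have h2 := M.continuous.comp_aestronglyMeasurable
      (hS _ (aestronglyMeasurable_clm_apply h.continuous_X hu))
    exact (h1.sub h2).norm.pow 2
  · rw [abs_of_nonneg (by positivity)]
    exact norm_commutatorX_sq_le (smoothingScale_pos n) (hB s ⟨hs.1.le, hs.2.le⟩) _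
  · simpa using (tendsto_commutatorX h.injective (u s)).norm.pow 2

theorem ae_restrict_Ioo_of_ae_muT {T : ℝ} {p : ℝ → Prop} (h : ∀ᵐ s ∂muT, p s) :
    ∀ᵐ s ∂volume.restrict (Ioo 0 T), p s :=
  ae_restrict_of_ae_restrict_of_subset Ioo_subset_Ioi_self h

theorem IsPrimitiveOn.le_add_setIntegral {T : ℝ} (hT : 0 ≤ T) {f f' b : ℝ → ℝ}
    (h : IsPrimitiveOn 0 T f f') (hb : Integrable b (volume.restrict (Ioo 0 T)))
    (hle : ∀ᵐ s ∂volume.restrict (Ioo 0 T), f' s ≤ b s) : f T ≤ f 0 + ∫ s in Ioo 0 T, b s := by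
  rw [h.eq_add T ⟨hT, le_rfl⟩, intervalIntegral.integral_of_le hT, integral_Ioc_eq_integral_Ioo]
  exact add_le_add_right (integral_mono_ae
    ((intervalIntegrable_iff_integrableOn_Ioo_of_le hT).1 h.integrable) hb hle) _

/-- The basic energy estimate, in the limit of `basic_energy_le`: the dissipation controls `u` in
`L²` in time, with an exponential weight of rate at most `ν / (16 κ)`. -/
theorem DissipativeEvolution.integral_le (h : DissipativeEvolution M X N ν κ C₁ C₂ u₀ u F)
    {σ T : ℝ} (hσ0 : 0 ≤ σ) (hσ : σ * κ ≤ ν / 16) (hT : 0 ≤ T) :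
    ν / 4 * ∫ s in Ioo 0 T, Real.exp (2 * σ * s) * ‖u s‖ ^ 2 ≤
      κ * ‖u₀‖ ^ 2 + 8 * κ / ν * ∫ s in Ioo 0 T, Real.exp (2 * σ * s) * ‖F s‖ ^ 2 := by
  obtain ⟨iS, tS⟩ := tendsto_integral_smoother h T (2 * σ)
  obtain ⟨iN, tN⟩ := tendsto_integral_commutatorN h T (2 * σ)
  have iF : Integrable (fun s => Real.exp (2 * σ * s) * ‖F s‖ ^ 2) (volume.restrict (Ioo 0 T)) :=
    integrable_exp_mul ((h.F_memLp T).integrable_norm_pow (by norm_num))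
  have key : ∀ n, ν / 4 * ∫ s in Ioo 0 T,
      Real.exp (2 * σ * s) * ‖smoother M (smoothingScale n) (u s)‖ ^ 2 ≤
      κ * ‖u₀‖ ^ 2 + (8 * κ / ν * (∫ s in Ioo 0 T, Real.exp (2 * σ * s) * ‖F s‖ ^ 2)
        + 2 * ∫ s in Ioo 0 T,
          Real.exp (2 * σ * s) * |commutatorN M (N s) (smoothingScale n) (u s)|) := by
    intro n
    have hε := smoothingScale_pos n
    have hp := ((h.isPrimitiveOn_smoothed (ε := smoothingScale n) hT).clm_comp
      (M.restrictScalars ℝ)).weighted_norm_sq hT (2 * σ)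
    have hle := hp.le_add_setIntegral hT
      (((iS n).const_mul (-(ν / 4))).add ((iF.const_mul (8 * κ / ν)).add ((iN n).const_mul 2))) ?_
    · rw [integral_add' ((iS n).const_mul _) ((iF.const_mul _).add ((iN n).const_mul _)),
        integral_add' (iF.const_mul _) ((iN n).const_mul _), integral_const_mul, integral_const_mul,
        integral_const_mul] at hle
      have h0 : 0 ≤ Real.exp (2 * σ * T) * ‖(M.restrictScalars ℝ)
        (smoothedSolution M N ν u₀ u F (smoothingScale n) T)‖ ^ 2 := by positivity
      have h1 : ‖(M.restrictScalars ℝ) (smoothedSolution M N ν u₀ u F (smoothingScale n) 0)‖ ^ 2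
          ≤ κ * ‖u₀‖ ^ 2 := by
        simpa [smoothedSolution] using h.map_smoother_le hε u₀
      simp only [mul_zero, Real.exp_zero, one_mul] at hle
      linarith
    · filter_upwards [ae_restrict_Ioo_of_ae_muT (h.smoothed_eq hε),
        ae_restrict_Ioo_of_ae_muT h.transport_le] with s hs hNs
      have := basic_energy_le h.ν_pos h.κ_pos hσ0 hσ h.map_le hNs hε (u s) (F s)
      have h2 := mul_le_mul_of_nonneg_left this (Real.exp_pos (2 * σ * s)).le
      simp only [ContinuousLinearMap.coe_restrictScalars', hs]
      refine h2.trans_eq ?_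
      simp only [Pi.add_apply]
      ring
  have := le_of_tendsto_of_tendsto (tS.const_mul (ν / 4))
    (((tN.const_mul 2).const_add _).const_add _) (Eventually.of_forall key)
  simpa using this

/-- The estimate pointwise in time, in the limit of `material_energy_le`. -/
theorem DissipativeEvolution.norm_sq_le (h : DissipativeEvolution M X N ν κ C₁ C₂ u₀ u F)
    {σ : ℝ} (hσ0 : 0 ≤ σ) (hC₁ : 0 ≤ C₁) :
    ∀ᵐ t ∂muT, Real.exp (2 * σ * t) * ‖u t‖ ^ 2 ≤ ‖u₀‖ ^ 2
      + ((2 * σ + 2 * C₁ * (ν / κ) + 2 * C₂ * (ν / κ))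
          * (∫ s in Ioo 0 t, Real.exp (2 * σ * s) * ‖u s‖ ^ 2)
        + 2 / ν * ∫ s in Ioo 0 t, Real.exp (2 * σ * s) * ‖F s‖ ^ 2) := by
  have hall : ∀ᵐ t ∂muT, ∀ n, smoothedSolution M N ν u₀ u F (smoothingScale n) t
      = smoother M (smoothingScale n) (u t) :=
    ae_all_iff.2 fun n => h.smoothed_eq (smoothingScale_pos n)
  filter_upwards [hall, ae_restrict_mem measurableSet_Ioi] with T hwT h0T
  have hT : 0 ≤ T := le_of_lt h0T
  have hνκ : 0 < ν / κ := div_pos h.ν_pos h.κ_pos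
  have hν := h.ν_pos
  obtain ⟨iX, tX⟩ := tendsto_integral_commutatorX h T (2 * σ)
  have iu : Integrable (fun s => Real.exp (2 * σ * s) * ‖u s‖ ^ 2) (volume.restrict (Ioo 0 T)) :=
    integrable_exp_mul ((h.u_memLp T).integrable_norm_pow (by norm_num))
  have iF : Integrable (fun s => Real.exp (2 * σ * s) * ‖F s‖ ^ 2) (volume.restrict (Ioo 0 T)) :=
    integrable_exp_mul ((h.F_memLp T).integrable_norm_pow (by norm_num))
  set A := 2 * σ + 2 * C₁ * (ν / κ) + 2 * C₂ * (ν / κ) with hA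
  have key : ∀ n, Real.exp (2 * σ * T) * ‖smoother M (smoothingScale n) (u T)‖ ^ 2 ≤
      ‖u₀‖ ^ 2 + ((A * (∫ s in Ioo 0 T, Real.exp (2 * σ * s) * ‖u s‖ ^ 2)
        + 2 / ν * ∫ s in Ioo 0 T, Real.exp (2 * σ * s) * ‖F s‖ ^ 2)
        + 2 / ν * ∫ s in Ioo 0 T,
          Real.exp (2 * σ * s) * ‖commutatorX M (X s) (smoothingScale n) (u s)‖ ^ 2) := by
    intro n
    have hε := smoothingScale_pos n
    have hp := (h.isPrimitiveOn_smoothed (ε := smoothingScale n) hT).weighted_norm_sq hT (2 * σ)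
    have hle := hp.le_add_setIntegral hT
      (((iu.const_mul A).add (iF.const_mul (2 / ν))).add ((iX n).const_mul (2 / ν))) ?_
    · rw [integral_add' ((iu.const_mul _).add (iF.const_mul _)) ((iX n).const_mul _),
        integral_add' (iu.const_mul _) (iF.const_mul _), integral_const_mul, integral_const_mul,
        integral_const_mul, hwT n] at hle
      have h1 : ‖smoothedSolution M N ν u₀ u F (smoothingScale n) 0‖ ^ 2 ≤ ‖u₀‖ ^ 2 := by
        refine pow_le_pow_left₀ (norm_nonneg _) ?_ 2
        simpa [smoothedSolution] using norm_smoother_le M hε u₀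
      simp only [mul_zero, Real.exp_zero, one_mul] at hle
      linarith
    · filter_upwards [ae_restrict_Ioo_of_ae_muT (h.smoothed_eq hε),
        ae_restrict_Ioo_of_ae_muT h.skew_le, ae_restrict_Ioo_of_ae_muT h.error_le] with s hs hXs hEs
      have h1 := material_energy_le (M := M) (N := N s) h.ν_pos hXs hε (u s) (F s)
      have h2 : ‖smoother M (smoothingScale n) (u s)‖ ^ 2 ≤ ‖u s‖ ^ 2 :=
        pow_le_pow_left₀ (norm_nonneg _) (norm_smoother_le M hε _) 2
      simp only [hs, Pi.add_apply]
      have h3 : 2 * σ * ‖smoother M (smoothingScale n) (u s)‖ ^ 2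
          + 2 * (inner ℂ (smoother M (smoothingScale n) (u s))
            (resolvent M (smoothingScale n) (evolutionRhs M N ν u F s))).re ≤
          A * ‖u s‖ ^ 2 + 2 / ν * ‖F s‖ ^ 2
            + 2 / ν * ‖commutatorX M (X s) (smoothingScale n) (u s)‖ ^ 2 := by
        have h4 := mul_le_mul_of_nonneg_left h2 (show 0 ≤ 2 * σ by positivity)
        have h5 := mul_le_mul_of_nonneg_left h2 (show 0 ≤ C₁ * (ν / κ) by positivity)
        have h6 := mul_le_mul_of_nonneg_left (hEs (u s)) (show 0 ≤ ν⁻¹ by positivity)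
        have h7 : ν⁻¹ * (C₂ * ν * (ν / κ) * ‖u s‖ ^ 2) = C₂ * (ν / κ) * ‖u s‖ ^ 2 := by
          field_simp
        rw [h7] at h6
        have h8 : evolutionRhs M N ν u F s
          = ContinuousLinearMap.adjoint M (N s (u s) + F s) - (ν : ℂ) • u s := rfl
        rw [h8, hA, div_eq_mul_inv 2 ν]
        linarith
      refine (mul_le_mul_of_nonneg_left h3 (Real.exp_pos (2 * σ * s)).le).trans_eq ?_
      ring
  have := le_of_tendsto_of_tendsto
    (((tendsto_smoother_scale h.injective (u T)).norm.pow 2).const_mul (Real.exp (2 * σ * T)))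
    (((tX.const_mul (2 / ν)).const_add _).const_add _) (Eventually.of_forall key)
  simpa using this

end EnergyLimit

/-! ### Sobolev functions on the cross-section -/

section Sobolev

instance : IsFiniteMeasure muY := by unfold muY; infer_instance

theorem intervalIntegrable_iff_muY {E : Type*} [NormedAddCommGroup E] {f : ℝ → E} :
    IntervalIntegrable f volume (-1) 1 ↔ Integrable f muY :=
  intervalIntegrable_iff_integrableOn_Ioo_of_le (by norm_num)

theorem integral_muY {E : Type*} [NormedAddCommGroup E] [NormedSpace ℝ E] (f : ℝ → E) :
    ∫ y, f y ∂muY = ∫ y in (-1 : ℝ)..1, f y := by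
  rw [intervalIntegral.integral_of_le (by norm_num), integral_Ioc_eq_integral_Ioo, muY]

variable {E : Type*} [NormedAddCommGroup E] [NormedSpace ℝ E]

theorem SobolevOn.isPrimitiveOn {m : ℕ} {G : ℕ → ℝ → E} (h : SobolevOn m G) {j : ℕ} (hj : j < m) :
    IsPrimitiveOn (-1) 1 (G j) (G (j + 1)) := by
  have key : ∀ i ≤ m, IntervalIntegrable (G (m - i)) volume (-1) 1 := by
    intro i
    induction i with
    | zero => exact fun _ => intervalIntegrable_iff_muY.2 (h.memLp.integrable (by norm_num))
    | succ i ih =>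
      intro hi
      have hp : IsPrimitiveOn (-1) 1 (G (m - (i + 1))) (G (m - i)) :=
        ⟨ih (by omega), by
          have := h.primitive (m - (i + 1)) (by omega)
          rwa [show m - (i + 1) + 1 = m - i by omega] at this⟩
      exact (hp.continuousOn.mono (by rw [uIcc_of_le (by norm_num)])).intervalIntegrable
  have := key (m - (j + 1)) (by omega)
  rw [show m - (m - (j + 1)) = j + 1 by omega] at this
  exact ⟨this, h.primitive j hj⟩

/-- Integration by parts. -/
theorem IsPrimitiveOn.integral_mul_deriv_eq {A : Type*} [NormedRing A] [NormedAlgebra ℝ A]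
    [CompleteSpace A] {a b : ℝ} (hab : a ≤ b) {f f' g g' : ℝ → A}
    (hf : IsPrimitiveOn a b f f') (hg : IsPrimitiveOn a b g g') :
    ∫ y in a..b, f y * g' y = f b * g b - f a * g a - ∫ y in a..b, f' y * g y := by
  have h := (hf.bilin (ContinuousLinearMap.mul ℝ A) hab hg).eq_add b ⟨hab, le_rfl⟩
  simp only [ContinuousLinearMap.mul_apply'] at h
  have hfc : ContinuousOn f (uIcc a b) := by rw [uIcc_of_le hab]; exact hf.continuousOn
  have hgc : ContinuousOn g (uIcc a b) := by rw [uIcc_of_le hab]; exact hg.continuousOn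
  rw [intervalIntegral.integral_add (hf.integrable.mul_continuousOn hgc)
    (hg.integrable.continuousOn_mul hfc)] at h
  rw [h]
  abel

end Sobolev

/-! ### Regularity of the heat extension -/

section Heat

open BoundedContinuousFunction

/-- The frequencies of the Dirichlet eigenfunctions. -/
def freq (n : ℕ) : ℝ := ((n : ℝ) + 1) * Real.pi / 2

theorem le_freq (n : ℕ) : (n : ℝ) + 1 ≤ freq n := by
  have := Real.pi_gt_three
  unfold freq
  nlinarith [(Nat.cast_nonneg n : (0 : ℝ) ≤ n)]

theorem one_le_freq (n : ℕ) : 1 ≤ freq n :=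
  le_trans (by have := (Nat.cast_nonneg n : (0 : ℝ) ≤ n); linarith) (le_freq n)

theorem sin_freq_right (n : ℕ) : Real.sin (freq n * (1 + 1)) = 0 := by
  rw [show freq n * (1 + 1) = ((n + 1 : ℕ) : ℝ) * Real.pi by unfold freq; push_cast; ring]
  exact Real.sin_nat_mul_pi _

theorem sin_freq_left (n : ℕ) : Real.sin (freq n * (-1 + 1)) = 0 := by simp

theorem hasDerivAt_sin_freq (n : ℕ) (y : ℝ) :
    HasDerivAt (fun y => Real.sin (freq n * (y + 1))) (Real.cos (freq n * (y + 1)) * freq n) y := by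
  have := (((hasDerivAt_id y).add_const 1).const_mul (freq n)).sin
  simpa using this

theorem hasDerivAt_cos_freq (n : ℕ) (y : ℝ) :
    HasDerivAt (fun y => Real.cos (freq n * (y + 1))) (-Real.sin (freq n * (y + 1)) * freq n) y := by
  have := (((hasDerivAt_id y).add_const 1).const_mul (freq n)).cos
  simpa using this

/-- Two integrations by parts against a Dirichlet eigenfunction. -/
theorem integral_mul_sin_freq {f f' f'' : ℝ → ℝ} (h : IsPrimitiveOn (-1) 1 f f')
    (h' : IsPrimitiveOn (-1) 1 f' f'') (hl : f (-1) = 0) (hr : f 1 = 0) (n : ℕ) :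
    freq n ^ 2 * ∫ y in (-1 : ℝ)..1, f y * Real.sin (freq n * (y + 1)) =
      -∫ y in (-1 : ℝ)..1, f'' y * Real.sin (freq n * (y + 1)) := by
  have hs : IsPrimitiveOn (-1) 1 (fun y => Real.sin (freq n * (y + 1)))
      (fun y => Real.cos (freq n * (y + 1)) * freq n) :=
    .of_hasDerivAt (hasDerivAt_sin_freq n) (by fun_prop)
  have hc : IsPrimitiveOn (-1) 1 (fun y => Real.cos (freq n * (y + 1)))
      (fun y => -Real.sin (freq n * (y + 1)) * freq n) :=
    .of_hasDerivAt (hasDerivAt_cos_freq n) (by fun_prop)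
  have e1 := h.integral_mul_deriv_eq (by norm_num) hc
  have e2 := h'.integral_mul_deriv_eq (by norm_num) hs
  rw [hl, hr] at e1
  rw [sin_freq_left, sin_freq_right] at e2
  have r1 : ∀ y, f y * (-Real.sin (freq n * (y + 1)) * freq n)
      = -freq n * (f y * Real.sin (freq n * (y + 1))) := fun y => by ring
  have r2 : ∀ y, f' y * (Real.cos (freq n * (y + 1)) * freq n)
      = freq n * (f' y * Real.cos (freq n * (y + 1))) := fun y => by ring
  simp only [r1, r2, intervalIntegral.integral_const_mul] at e1 e2
  linear_combination -freq n * e1 + e2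

/-- The sine coefficients of `v`. -/
def sineCoeff (v : ℝ → ℝ) (n : ℕ) : ℝ :=
  ∫ z in (-1 : ℝ)..1, v z * Real.sin (((n : ℝ) + 1) * Real.pi / 2 * (z + 1))

/-- Decay of the sine coefficients of a function in `H^4` that vanishes at the boundary together
with its second derivative. -/
theorem AdmissibleShear.sineCoeff_le {K : ℝ} {Uin : ℝ → ℝ} (h : AdmissibleShear K Uin) (n : ℕ) :
    freq n ^ 4 * |sineCoeff (fun z => Uin z - z) n| ≤ (K ^ 2 + 2) / 2 := by
  obtain ⟨V, hV0, hV, hK, hl0, hr0, hl2, hr2⟩ := h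
  have e0 : sineCoeff (fun z => Uin z - z) n
      = ∫ y in (-1 : ℝ)..1, V 0 y * Real.sin (freq n * (y + 1)) := by
    refine intervalIntegral.integral_congr fun z hz => ?_
    rw [uIcc_of_le (by norm_num)] at hz
    simp only [hV0 z hz, freq]
  have e1 := integral_mul_sin_freq (hV.isPrimitiveOn (j := 0) (by norm_num))
    (hV.isPrimitiveOn (j := 1) (by norm_num)) hl0 hr0 n
  have e2 := integral_mul_sin_freq (hV.isPrimitiveOn (j := 2) (by norm_num))
    (hV.isPrimitiveOn (j := 3) (by norm_num)) hl2 hr2 n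
  norm_num at e1 e2
  have e3 : freq n ^ 4 * sineCoeff (fun z => Uin z - z) n
      = ∫ y in (-1 : ℝ)..1, V 4 y * Real.sin (freq n * (y + 1)) := by
    rw [e0]; linear_combination freq n ^ 2 * e1 - e2
  rw [show freq n ^ 4 * |sineCoeff (fun z => Uin z - z) n|
    = |freq n ^ 4 * sineCoeff (fun z => Uin z - z) n| by
      rw [abs_mul, abs_of_nonneg (by positivity : (0 : ℝ) ≤ freq n ^ 4)], e3, ← integral_muY]
  have hi : Integrable (fun y => V 4 y ^ 2) muY := hV.memLp.integrable_sq
  have hsum : ∫ y, V 4 y ^ 2 ∂muY ≤ K ^ 2 := by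
    refine le_trans ?_ hK
    exact Finset.single_le_sum (f := fun j => ∫ y, V j y ^ 2 ∂muY)
      (fun j _ => integral_nonneg fun y => sq_nonneg _) (by simp)
  calc |∫ y, V 4 y * Real.sin (freq n * (y + 1)) ∂muY|
      ≤ ∫ y, |V 4 y * Real.sin (freq n * (y + 1))| ∂muY := abs_integral_le_integral_abs
    _ ≤ ∫ y, (2⁻¹ * V 4 y ^ 2 + 2⁻¹) ∂muY := by
        refine integral_mono_of_nonneg (Filter.Eventually.of_forall fun y => abs_nonneg _)
          ((hi.const_mul _).add (integrable_const _)) (Filter.Eventually.of_forall fun y => ?_)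
        simp only [abs_mul]
        have h1 := Real.abs_sin_le_one (freq n * (y + 1))
        have h2 := abs_nonneg (V 4 y)
        have h3 := sq_abs (V 4 y)
        nlinarith [sq_nonneg (|V 4 y| - 1), abs_nonneg (Real.sin (freq n * (y + 1)))]
    _ = 2⁻¹ * (∫ y, V 4 y ^ 2 ∂muY) + 1 := by
        rw [integral_add (hi.const_mul _) (integrable_const _), integral_const_mul, integral_const]
        simp [muY, Measure.real]
        norm_num
    _ ≤ (K ^ 2 + 2) / 2 := by linarith

/-- The heat extension is smooth in space, uniformly and continuously in time: `S j t` is the `j`-th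
derivative of `e^{ν t ∂_y^2} (U_in - y)` for `t ≥ 0`. -/
structure IsHeatProfile (B ν : ℝ) (Uin : ℝ → ℝ) (S₀ S₁ S₂ : ℝ → ℝ →ᵇ ℝ) : Prop where
  continuous_zero : Continuous S₀
  continuous_one : Continuous S₁
  continuous_two : Continuous S₂
  eq : ∀ t, 0 ≤ t → ∀ y, heatShear ν Uin t y = y + S₀ t y
  hasDerivAt_zero : ∀ t y, HasDerivAt (S₀ t) (S₁ t y) y
  hasDerivAt_one : ∀ t y, HasDerivAt (S₁ t) (S₂ t y) y
  left_zero : ∀ t, S₀ t (-1) = 0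
  right_zero : ∀ t, S₀ t 1 = 0
  norm_two_le : ∀ t, ‖S₂ t‖ ≤ B

/-- The `n`-th coefficient of the heat extension; the time is cut off at `0`. -/
def heatCoeff (ν : ℝ) (v : ℝ → ℝ) (t : ℝ) (n : ℕ) : ℝ :=
  Real.exp (-(ν * max t 0 * freq n ^ 2)) * sineCoeff v n

/-- `sin (λ (y + 1))` as a bounded continuous function. -/
def sinB (l : ℝ) : ℝ →ᵇ ℝ :=
  .ofNormedAddCommGroup (fun y => Real.sin (l * (y + 1))) (by fun_prop) 1
    fun y => Real.abs_sin_le_one _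

/-- `cos (λ (y + 1))` as a bounded continuous function. -/
def cosB (l : ℝ) : ℝ →ᵇ ℝ :=
  .ofNormedAddCommGroup (fun y => Real.cos (l * (y + 1))) (by fun_prop) 1
    fun y => Real.abs_cos_le_one _

theorem norm_sinB_le (l : ℝ) : ‖sinB l‖ ≤ 1 :=
  BoundedContinuousFunction.norm_ofNormedAddCommGroup_le _ zero_le_one _

theorem norm_cosB_le (l : ℝ) : ‖cosB l‖ ≤ 1 :=
  BoundedContinuousFunction.norm_ofNormedAddCommGroup_le _ zero_le_one _

theorem tsum_apply_bcf {f : ℕ → ℝ →ᵇ ℝ} (hf : Summable f) (y : ℝ) :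
    (∑' n, f n) y = ∑' n, f n y :=
  (BoundedContinuousFunction.evalCLM ℝ y : (ℝ →ᵇ ℝ) →L[ℝ] ℝ).map_tsum hf

theorem summable_inv_succ_sq : Summable fun n : ℕ => 1 / ((n : ℝ) + 1) ^ 2 := by
  have := (summable_nat_add_iff 1).2 (Real.summable_one_div_nat_pow.2 (one_lt_two))
  simpa using this

/-- The heat extension of an admissible shear is a sine series that may be differentiated twice term by
term, since its coefficients decay like `n⁻⁴`; the bound depends on `K` only. -/
theorem exists_isHeatProfile (K : ℝ) : ∃ B : ℝ, 0 ≤ B ∧ ∀ (ν : ℝ) (Uin : ℝ → ℝ), 0 < ν →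
    AdmissibleShear K Uin → ∃ S₀ S₁ S₂ : ℝ → ℝ →ᵇ ℝ, IsHeatProfile B ν Uin S₀ S₁ S₂ := by
  set b : ℕ → ℝ := fun n => (K ^ 2 + 2) / 2 * (1 / ((n : ℝ) + 1) ^ 2) with hb
  have hbs : Summable b := summable_inv_succ_sq.mul_left _
  have hb0 : ∀ n, 0 ≤ b n := fun n => by positivity
  refine ⟨∑' n, b n, tsum_nonneg hb0, fun ν Uin hν hU => ?_⟩
  set v : ℝ → ℝ := fun z => Uin z - z with hv
  have hc2 : ∀ t n, |heatCoeff ν v t n| * freq n ^ 2 ≤ b n := by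
    intro t n
    have h1 := hU.sineCoeff_le n
    have hf := le_freq n
    have hf0 : 0 < freq n := lt_of_lt_of_le one_pos (one_le_freq n)
    have h2 : |heatCoeff ν v t n| ≤ |sineCoeff v n| := by
      rw [heatCoeff, abs_mul, abs_of_pos (Real.exp_pos _)]
      refine mul_le_of_le_one_left (abs_nonneg _) (Real.exp_le_one_iff.2 ?_)
      have : 0 ≤ ν * max t 0 * freq n ^ 2 := by positivity
      linarith
    have h3 : |sineCoeff v n| * freq n ^ 2 ≤ (K ^ 2 + 2) / 2 * (1 / freq n ^ 2) := by
      rw [mul_one_div, le_div_iff₀ (by positivity)]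
      calc _ = freq n ^ 4 * |sineCoeff v n| := by ring
        _ ≤ _ := h1
    calc _ ≤ |sineCoeff v n| * freq n ^ 2 := by gcongr
      _ ≤ _ := h3
      _ ≤ (K ^ 2 + 2) / 2 * (1 / ((n : ℝ) + 1) ^ 2) := by gcongr
  have hc1 : ∀ t n, |heatCoeff ν v t n * freq n| ≤ b n := by
    intro t n
    refine le_trans ?_ (hc2 t n)
    have := one_le_freq n
    rw [abs_mul, abs_of_pos (by linarith : 0 < freq n)]
    gcongr
    nlinarith
  have hc0 : ∀ t n, |heatCoeff ν v t n| ≤ b n := by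
    intro t n
    refine le_trans ?_ (hc2 t n)
    exact le_mul_of_one_le_right (abs_nonneg _) (one_le_pow₀ (one_le_freq n))
  have hc2' : ∀ t n, |-(heatCoeff ν v t n * freq n ^ 2)| ≤ b n := by
    intro t n
    rw [abs_neg, abs_mul, abs_of_nonneg (sq_nonneg (freq n))]
    exact hc2 t n
  have hcont : ∀ n, Continuous fun t => heatCoeff ν v t n := by
    intro n; unfold heatCoeff; fun_prop
  have hbound : ∀ (a : ℝ) (φ : ℝ →ᵇ ℝ) (c : ℝ), |a| ≤ c → ‖φ‖ ≤ 1 → ‖a • φ‖ ≤ c := by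
    intro a φ c ha hφ
    rw [norm_smul, Real.norm_eq_abs]
    exact (mul_le_of_le_one_right (abs_nonneg _) hφ).trans ha
  have n0 : ∀ n t, ‖heatCoeff ν v t n • sinB (freq n)‖ ≤ b n := fun n t =>
    hbound _ _ _ (hc0 t n) (norm_sinB_le _)
  have n1 : ∀ n t, ‖(heatCoeff ν v t n * freq n) • cosB (freq n)‖ ≤ b n := fun n t =>
    hbound _ _ _ (hc1 t n) (norm_cosB_le _)
  have n2 : ∀ n t, ‖(-(heatCoeff ν v t n * freq n ^ 2)) • sinB (freq n)‖ ≤ b n := fun n t =>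
    hbound _ _ _ (hc2' t n) (norm_sinB_le _)
  have s0 : ∀ t, Summable fun n => heatCoeff ν v t n • sinB (freq n) := fun t =>
    .of_norm_bounded hbs fun n => n0 n t
  have s1 : ∀ t, Summable fun n => (heatCoeff ν v t n * freq n) • cosB (freq n) := fun t =>
    .of_norm_bounded hbs fun n => n1 n t
  have s2 : ∀ t, Summable fun n => (-(heatCoeff ν v t n * freq n ^ 2)) • sinB (freq n) := fun t =>
    .of_norm_bounded hbs fun n => n2 n t
  have abs_apply_le : ∀ (φ : ℝ →ᵇ ℝ) (c y : ℝ), ‖φ‖ ≤ c → ‖φ y‖ ≤ c := fun φ c y h =>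
    (φ.norm_coe_le_norm y).trans h
  refine ⟨fun t => ∑' n, heatCoeff ν v t n • sinB (freq n),
    fun t => ∑' n, (heatCoeff ν v t n * freq n) • cosB (freq n),
    fun t => ∑' n, (-(heatCoeff ν v t n * freq n ^ 2)) • sinB (freq n), ?_, ?_, ?_, ?_, ?_, ?_, ?_,
    ?_, ?_⟩
  · exact continuous_tsum (fun n => (hcont n).smul continuous_const) hbs n0
  · exact continuous_tsum (fun n => ((hcont n).mul_const _).smul continuous_const) hbs n1
  · exact continuous_tsum (fun n => ((hcont n).mul_const _).neg.smul continuous_const) hbs n2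
  · intro t ht y
    rw [tsum_apply_bcf (s0 t), heatShear, dirichletHeat]
    congr 1
    refine tsum_congr fun n => ?_
    simp [heatCoeff, sinB, sineCoeff, freq, max_eq_left ht, hv]
  · intro t y
    have := hasDerivAt_tsum (g := fun n y => (heatCoeff ν v t n • sinB (freq n)) y)
      (g' := fun n y => ((heatCoeff ν v t n * freq n) • cosB (freq n)) y) (y₀ := 0) hbs
      (fun n y => ?_) (fun n y => abs_apply_le _ _ y (n1 n t)) ?_ y
    · refine this.congr_deriv (tsum_apply_bcf (s1 t) y).symm |>.congr_of_eventuallyEq ?_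
      exact Filter.Eventually.of_forall fun z => tsum_apply_bcf (s0 t) z
    · refine ((hasDerivAt_sin_freq n y).const_mul (heatCoeff ν v t n)).congr_deriv ?_
      simp only [BoundedContinuousFunction.coe_smul, smul_eq_mul, cosB,
        BoundedContinuousFunction.coe_ofNormedAddCommGroup]
      ring
    · exact Summable.of_norm_bounded hbs fun n => abs_apply_le _ _ 0 (n0 n t)
  · intro t y
    have := hasDerivAt_tsum (g := fun n y => ((heatCoeff ν v t n * freq n) • cosB (freq n)) y)
      (g' := fun n y => ((-(heatCoeff ν v t n * freq n ^ 2)) • sinB (freq n)) y) (y₀ := 0) hbs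
      (fun n y => ?_) (fun n y => abs_apply_le _ _ y (n2 n t)) ?_ y
    · refine this.congr_deriv (tsum_apply_bcf (s2 t) y).symm |>.congr_of_eventuallyEq ?_
      exact Filter.Eventually.of_forall fun z => tsum_apply_bcf (s1 t) z
    · refine ((hasDerivAt_cos_freq n y).const_mul (heatCoeff ν v t n * freq n)).congr_deriv ?_
      simp only [BoundedContinuousFunction.coe_smul, smul_eq_mul, sinB,
        BoundedContinuousFunction.coe_ofNormedAddCommGroup]
      ring
    · exact Summable.of_norm_bounded hbs fun n => abs_apply_le _ _ 0 (n1 n t)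
  · intro t
    rw [tsum_apply_bcf (s0 t)]
    simp [sinB]
  · intro t
    rw [tsum_apply_bcf (s0 t)]
    simp [sinB, sin_freq_right]
  · intro t
    exact tsum_of_norm_bounded hbs.hasSum fun n => n2 n t

end Heat

/-! ### The stream function -/

section Stream

theorem ae_muY_mem : ∀ᵐ y ∂muY, y ∈ Icc (-1 : ℝ) 1 := by
  filter_upwards [ae_restrict_mem measurableSet_Ioo] with y hy using Ioo_subset_Icc_self hy

theorem intervalIntegral_congr_muY {E : Type*} [NormedAddCommGroup E] [NormedSpace ℝ E]
    {f g : ℝ → E} (h : f =ᵐ[muY] g) {y : ℝ} (hy : y ∈ Icc (-1 : ℝ) 1) :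
    ∫ s in (-1 : ℝ)..y, f s = ∫ s in (-1 : ℝ)..y, g s := by
  rw [intervalIntegral.integral_of_le hy.1, intervalIntegral.integral_of_le hy.1,
    integral_Ioc_eq_integral_Ioo, integral_Ioc_eq_integral_Ioo]
  exact integral_congr_ae (ae_restrict_of_ae_restrict_of_subset (Ioo_subset_Ioo_right hy.2) h)

/-- The real exponential `e^{κ y}`, as a complex number. -/
def expC (κ y : ℝ) : ℂ := (Real.exp (κ * y) : ℂ)

theorem continuous_expC (κ : ℝ) : Continuous (expC κ) := by unfold expC; fun_prop

theorem hasDerivAt_expC (κ y : ℝ) : HasDerivAt (expC κ) (κ * expC κ y) y := by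
  have h : HasDerivAt (fun y : ℝ => Real.exp (κ * y)) (Real.exp (κ * y) * κ) y := by
    simpa using ((hasDerivAt_id y).const_mul κ).exp
  refine h.ofReal_comp.congr_deriv ?_
  rw [expC]; push_cast; ring

theorem isPrimitiveOn_expC (κ a b : ℝ) : IsPrimitiveOn a b (expC κ) (fun y => κ * expC κ y) :=
  .of_hasDerivAt (hasDerivAt_expC κ) ((continuous_expC κ).const_mul _)

theorem expC_mul_neg (κ y : ℝ) : expC κ y * expC (-κ) y = 1 := by
  rw [expC, expC, ← Complex.ofReal_mul, ← Real.exp_add]; simp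

theorem expC_ne_zero (κ y : ℝ) : expC κ y ≠ 0 := left_ne_zero_of_mul_eq_one (expC_mul_neg κ y)

/-- The solution `A` of `A' = κ A + w` with `A(-1) = 0`. -/
def expPrimitive (κ : ℝ) (w : ℝ → ℂ) (y : ℝ) : ℂ :=
  expC κ y * ∫ s in (-1 : ℝ)..y, expC (-κ) s * w s

theorem integrable_expC_mul {w : ℝ → ℂ} (hw : Integrable w muY) (κ : ℝ) :
    IntervalIntegrable (fun s => expC κ s * w s) volume (-1) 1 :=
  (intervalIntegrable_iff_muY.2 hw).continuousOn_mul (continuous_expC κ).continuousOn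

theorem isPrimitiveOn_expPrimitive {w : ℝ → ℂ} (hw : Integrable w muY) (κ : ℝ) :
    IsPrimitiveOn (-1) 1 (expPrimitive κ w) (fun y => κ * expPrimitive κ w y + w y) := by
  have h1 : IsPrimitiveOn (-1) 1 (fun y => ∫ s in (-1 : ℝ)..y, expC (-κ) s * w s)
      (fun s => expC (-κ) s * w s) :=
    ⟨integrable_expC_mul hw _, fun t _ => by simp⟩
  refine ((isPrimitiveOn_expC κ (-1) 1).bilin (ContinuousLinearMap.mul ℝ ℂ) (by norm_num) h1).congr
    (by norm_num) (fun y _ => rfl) fun y _ => ?_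
  simp only [ContinuousLinearMap.mul_apply', expPrimitive]
  rw [← mul_assoc (expC κ y) (expC (-κ) y), expC_mul_neg]
  ring

theorem expPrimitive_left (κ : ℝ) (w : ℝ → ℂ) : expPrimitive κ w (-1) = 0 := by
  simp [expPrimitive]

/-- Uniqueness for `g' = κ g + w`, `g(-1) = 0`, by the integrating factor `e^{-κ y}`. -/
theorem eq_expPrimitive {κ : ℝ} {w g g' : ℝ → ℂ} (hg : IsPrimitiveOn (-1) 1 g g')
    (hg' : ∀ᵐ y ∂muY, g' y = κ * g y + w y) (h0 : g (-1) = 0) {y : ℝ} (hy : y ∈ Icc (-1 : ℝ) 1) :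
    g y = expPrimitive κ w y := by
  have h1 := (((isPrimitiveOn_expC (-κ) (-1) 1).bilin (ContinuousLinearMap.mul ℝ ℂ) (by norm_num)
    hg).eq_add y hy)
  simp only [ContinuousLinearMap.mul_apply', h0, mul_zero, zero_add] at h1
  have h2 : ∫ s in (-1 : ℝ)..y, (((-κ : ℝ) : ℂ) * expC (-κ) s * g s + expC (-κ) s * g' s)
      = ∫ s in (-1 : ℝ)..y, expC (-κ) s * w s := by
    refine intervalIntegral_congr_muY ?_ hy
    filter_upwards [hg'] with s hs
    rw [hs]; push_cast; ring
  rw [h2] at h1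
  rw [expPrimitive, ← h1, ← mul_assoc, expC_mul_neg, one_mul]

theorem expPrimitive_congr {κ : ℝ} {w w' : ℝ → ℂ} (h : w =ᵐ[muY] w') {y : ℝ}
    (hy : y ∈ Icc (-1 : ℝ) 1) : expPrimitive κ w y = expPrimitive κ w' y := by
  rw [expPrimitive, expPrimitive]
  congr 1
  refine intervalIntegral_congr_muY ?_ hy
  filter_upwards [h] with s hs
  rw [hs]

theorem expPrimitive_add {κ : ℝ} {w w' : ℝ → ℂ} (hw : Integrable w muY) (hw' : Integrable w' muY)
    {y : ℝ} (hy : y ∈ Icc (-1 : ℝ) 1) :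
    expPrimitive κ (fun s => w s + w' s) y = expPrimitive κ w y + expPrimitive κ w' y := by
  have hsub : uIcc (-1) y ⊆ uIcc (-1 : ℝ) 1 := by
    rw [uIcc_of_le hy.1, uIcc_of_le (by norm_num)]; exact Icc_subset_Icc_right hy.2
  simp only [expPrimitive, mul_add]
  rw [intervalIntegral.integral_add ((integrable_expC_mul hw _).mono_set hsub)
    ((integrable_expC_mul hw' _).mono_set hsub), mul_add]

theorem expPrimitive_smul {κ : ℝ} (c : ℂ) (w : ℝ → ℂ) (y : ℝ) :
    expPrimitive κ (fun s => c * w s) y = c * expPrimitive κ w y := by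
  simp only [expPrimitive]
  have : (fun s => expC (-κ) s * (c * w s)) = fun s => c * (expC (-κ) s * w s) := by
    funext s; ring
  rw [this, intervalIntegral.integral_const_mul]
  ring

/-- The stream function `ψ` of `w`, the solution of `ψ'' - k² ψ = w` with `ψ(-1) = ψ'(-1) = 0`. -/
def stream (k : ℤ) (w : ℝ → ℂ) (y : ℝ) : ℂ :=
  (expPrimitive k w y - expPrimitive (-k) w y) / (2 * k)

/-- The derivative of the stream function. -/
def streamDeriv (k : ℤ) (w : ℝ → ℂ) (y : ℝ) : ℂ :=
  (expPrimitive k w y + expPrimitive (-k) w y) / 2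

/-- The stream function with its first two derivatives. -/
def streamFamily (k : ℤ) (w : ℝ → ℂ) : ℕ → ℝ → ℂ
  | 0 => stream k w
  | 1 => streamDeriv k w
  | _ => fun y => (k : ℂ) ^ 2 * stream k w y + w y

theorem SobolevTwoZero.isPrimitiveOn_zero {Φ : ℕ → ℝ → ℂ} (h : SobolevTwoZero Φ) :
    IsPrimitiveOn (-1) 1 (Φ 0) (Φ 1) := h.sobolev.isPrimitiveOn (by norm_num)

theorem SobolevTwoZero.isPrimitiveOn_one {Φ : ℕ → ℝ → ℂ} (h : SobolevTwoZero Φ) :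
    IsPrimitiveOn (-1) 1 (Φ 1) (Φ 2) := h.sobolev.isPrimitiveOn (by norm_num)

theorem IsPrimitiveOn.const_mul {a b : ℝ} {f f' : ℝ → ℂ} (h : IsPrimitiveOn a b f f') (c : ℂ) :
    IsPrimitiveOn a b (fun y => c * f y) (fun y => c * f' y) :=
  h.clm_comp (ContinuousLinearMap.mul ℝ ℂ c)

theorem memLp_of_continuousOn {f : ℝ → ℂ} (hf : ContinuousOn f (Icc (-1) 1)) : MemLp f 2 muY := by
  obtain ⟨C, hC⟩ := isCompact_Icc.exists_bound_of_continuousOn hf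
  refine MemLp.of_bound ((hf.mono Ioo_subset_Icc_self).aestronglyMeasurable measurableSet_Ioo) C ?_
  filter_upwards [ae_muY_mem] with y hy using hC y hy

/-- An element of `H^2_0` is determined by `w = (∂_y^2 - k^2) Φ`. -/
theorem SobolevTwoZero.eq_expPrimitive {Φ : ℕ → ℝ → ℂ} (h : SobolevTwoZero Φ) {κ : ℝ} {w : ℝ → ℂ}
    (hw : ∀ᵐ y ∂muY, Φ 2 y - (κ : ℂ) ^ 2 * Φ 0 y = w y) {y : ℝ} (hy : y ∈ Icc (-1 : ℝ) 1) :
    Φ 1 y + κ * Φ 0 y = expPrimitive κ w y := by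
  refine NearCouette.eq_expPrimitive
    (h.isPrimitiveOn_one.add (h.isPrimitiveOn_zero.const_mul (κ : ℂ))) ?_ ?_ hy
  · filter_upwards [hw] with y hy
    rw [← hy]; ring
  · rw [h.left_zero, h.left_deriv_zero]; simp

theorem SobolevTwoZero.eq_expPrimitive_neg {Φ : ℕ → ℝ → ℂ} (h : SobolevTwoZero Φ) {κ : ℝ}
    {w : ℝ → ℂ} (hw : ∀ᵐ y ∂muY, Φ 2 y - (κ : ℂ) ^ 2 * Φ 0 y = w y) {y : ℝ}
    (hy : y ∈ Icc (-1 : ℝ) 1) : Φ 1 y - κ * Φ 0 y = expPrimitive (-κ) w y := by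
  have := h.eq_expPrimitive (κ := -κ) (w := w) (by simpa using hw) hy
  rw [← this]; push_cast; ring

theorem SobolevTwoZero.eq_stream {Φ : ℕ → ℝ → ℂ} (h : SobolevTwoZero Φ) {k : ℤ} (hk : k ≠ 0)
    {w : ℝ → ℂ} (hw : ∀ᵐ y ∂muY, Φ 2 y - (k : ℂ) ^ 2 * Φ 0 y = w y) {y : ℝ}
    (hy : y ∈ Icc (-1 : ℝ) 1) : Φ 0 y = stream k w y ∧ Φ 1 y = streamDeriv k w y := by
  have hk' : (k : ℂ) ≠ 0 := by exact_mod_cast hk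
  have h1 := h.eq_expPrimitive (κ := (k : ℝ)) (w := w) (by simpa using hw) hy
  have h2 := h.eq_expPrimitive_neg (κ := (k : ℝ)) (w := w) (by simpa using hw) hy
  rw [stream, streamDeriv, ← h1, ← h2]
  push_cast
  constructor
  · field_simp; ring
  · ring

theorem expPrimitive_right (κ : ℝ) (w : ℝ → ℂ) :
    expPrimitive κ w 1 = expC κ 1 * ∫ s, (Real.exp (-(κ * s)) : ℂ) * w s ∂muY := by
  rw [expPrimitive, integral_muY]
  simp [expC]

/-- The consistency condition says that the stream function, which has vanishing Cauchy data at `-1`,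
has vanishing Cauchy data at `1` as well. -/
theorem consistent_iff_expPrimitive {k : ℤ} {w : ℝ → ℂ} :
    Consistent k w ↔ expPrimitive k w 1 = 0 ∧ expPrimitive (-k) w 1 = 0 := by
  rw [expPrimitive_right, expPrimitive_right, Consistent, mul_eq_zero, mul_eq_zero,
    or_iff_right (expC_ne_zero _ _), or_iff_right (expC_ne_zero _ _), and_comm]
  simp

theorem SobolevTwoZero.consistent {Φ : ℕ → ℝ → ℂ} (h : SobolevTwoZero Φ) {k : ℤ} {w : ℝ → ℂ}
    (hw : ∀ᵐ y ∂muY, Φ 2 y - (k : ℂ) ^ 2 * Φ 0 y = w y) : Consistent k w := by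
  rw [consistent_iff_expPrimitive,
    ← h.eq_expPrimitive (κ := (k : ℝ)) (w := w) (by simpa using hw) ⟨by norm_num, le_rfl⟩,
    ← h.eq_expPrimitive_neg (κ := (k : ℝ)) (w := w) (by simpa using hw) ⟨by norm_num, le_rfl⟩,
    h.right_zero, h.right_deriv_zero]
  simp

theorem isPrimitiveOn_stream {k : ℤ} (hk : k ≠ 0) {w : ℝ → ℂ} (hw : Integrable w muY) :
    IsPrimitiveOn (-1) 1 (stream k w) (streamDeriv k w) := by
  have hk' : (k : ℂ) ≠ 0 := by exact_mod_cast hk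
  have h1 := (isPrimitiveOn_expPrimitive hw k).const_mul (1 / (2 * k))
  have h2 := (isPrimitiveOn_expPrimitive hw (-k)).const_mul (-1 / (2 * k))
  refine (h1.add h2).congr (by norm_num) (fun y _ => ?_) fun y _ => ?_
  · rw [stream]; ring
  · rw [streamDeriv]; push_cast; field_simp; ring

theorem isPrimitiveOn_streamDeriv {k : ℤ} (hk : k ≠ 0) {w : ℝ → ℂ} (hw : Integrable w muY) :
    IsPrimitiveOn (-1) 1 (streamDeriv k w) (fun y => (k : ℂ) ^ 2 * stream k w y + w y) := by
  have hk' : (k : ℂ) ≠ 0 := by exact_mod_cast hk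
  have h1 := (isPrimitiveOn_expPrimitive hw k).const_mul (1 / 2)
  have h2 := (isPrimitiveOn_expPrimitive hw (-k)).const_mul (1 / 2)
  refine (h1.add h2).congr (by norm_num) (fun y _ => ?_) fun y _ => ?_
  · rw [streamDeriv]; ring
  · rw [stream]; push_cast; field_simp; ring

theorem memLp_stream {k : ℤ} (hk : k ≠ 0) {w : ℝ → ℂ} (hw : MemLp w 2 muY) :
    MemLp (stream k w) 2 muY :=
  memLp_of_continuousOn (isPrimitiveOn_stream hk (hw.integrable (by norm_num))).continuousOn

theorem memLp_streamDeriv {k : ℤ} (hk : k ≠ 0) {w : ℝ → ℂ} (hw : MemLp w 2 muY) :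
    MemLp (streamDeriv k w) 2 muY :=
  memLp_of_continuousOn (isPrimitiveOn_streamDeriv hk (hw.integrable (by norm_num))).continuousOn

theorem sobolevTwoZero_streamFamily {k : ℤ} (hk : k ≠ 0) {w : ℝ → ℂ} (hw : MemLp w 2 muY)
    (hc : Consistent k w) : SobolevTwoZero (streamFamily k w) := by
  have hi := hw.integrable (by norm_num : (1 : ENNReal) ≤ 2)
  have hc' := consistent_iff_expPrimitive.1 hc
  refine ⟨⟨fun j hj y hy => ?_, ?_⟩, ?_, ?_, ?_, ?_⟩
  · interval_cases j
    · exact (isPrimitiveOn_stream hk hi).eq_add y hy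
    · exact (isPrimitiveOn_streamDeriv hk hi).eq_add y hy
  · exact ((memLp_stream hk hw).const_mul _).add hw
  · simp [streamFamily, stream, expPrimitive_left]
  · simp [streamFamily, stream, hc'.1, hc'.2]
  · simp [streamFamily, streamDeriv, expPrimitive_left]
  · simp [streamFamily, streamDeriv, hc'.1, hc'.2]

/-- Integration by parts for a function that vanishes at the boundary. -/
theorem integral_mul_conj_eq {f f' g g' : ℝ → ℂ} (hf : IsPrimitiveOn (-1) 1 f f')
    (hg : IsPrimitiveOn (-1) 1 g g') (hl : g (-1) = 0) (hr : g 1 = 0) :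
    ∫ y, (starRingEnd ℂ) (g y) * f' y ∂muY = -∫ y, (starRingEnd ℂ) (g' y) * f y ∂muY := by
  have h1 := (hg.clm_comp (Complex.conjCLE : ℂ →L[ℝ] ℂ)).integral_mul_deriv_eq (by norm_num) hf
  rw [integral_muY, integral_muY]
  simpa [hl, hr] using h1

theorem IsPrimitiveOn.integrable_norm_sq {f f' : ℝ → ℂ} (hf : IsPrimitiveOn (-1) 1 f f') :
    Integrable (fun y => ‖f y‖ ^ 2) muY :=
  (memLp_of_continuousOn hf.continuousOn).integrable_norm_pow (by norm_num)

/-- The energy identity of the Dirichlet problem. -/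
theorem integral_norm_sq_dirichlet {Φ : ℕ → ℝ → ℂ} (h : SobolevOn 2 Φ) (hl : Φ 0 (-1) = 0)
    (hr : Φ 0 1 = 0) {κ : ℝ} {w : ℝ → ℂ} (hw : ∀ᵐ y ∂muY, Φ 2 y - (κ : ℂ) ^ 2 * Φ 0 y = w y) :
    ∫ y, ‖w y‖ ^ 2 ∂muY = (∫ y, ‖Φ 2 y‖ ^ 2 ∂muY) + 2 * κ ^ 2 * (∫ y, ‖Φ 1 y‖ ^ 2 ∂muY)
      + κ ^ 4 * ∫ y, ‖Φ 0 y‖ ^ 2 ∂muY := by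
  have h0 := h.isPrimitiveOn (j := 0) (by norm_num)
  have h1 := h.isPrimitiveOn (j := 1) (by norm_num)
  norm_num at h0 h1
  have hm0 := memLp_of_continuousOn h0.continuousOn
  have e1 := congrArg Complex.re (integral_mul_conj_eq h1 h0 hl hr)
  have hi : Integrable (fun y => (starRingEnd ℂ) (Φ 0 y) * Φ 2 y) muY :=
    MemLp.integrable_mul (p := 2) (q := 2) hm0.star h.memLp
  have hi1 : Integrable (fun y => (starRingEnd ℂ) (Φ 1 y) * Φ 1 y) muY :=
    MemLp.integrable_mul (p := 2) (q := 2) (memLp_of_continuousOn h1.continuousOn).star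
      (memLp_of_continuousOn h1.continuousOn)
  rw [Complex.neg_re] at e1
  have r1 : ∫ y, ((starRingEnd ℂ) (Φ 0 y) * Φ 2 y).re ∂muY
      = (∫ y, (starRingEnd ℂ) (Φ 0 y) * Φ 2 y ∂muY).re := integral_re hi
  have r2 : ∫ y, ((starRingEnd ℂ) (Φ 1 y) * Φ 1 y).re ∂muY
      = (∫ y, (starRingEnd ℂ) (Φ 1 y) * Φ 1 y ∂muY).re := integral_re hi1
  have r3 : ∀ y, ((starRingEnd ℂ) (Φ 1 y) * Φ 1 y).re = ‖Φ 1 y‖ ^ 2 := fun y => by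
    rw [← Complex.normSq_eq_conj_mul_self, Complex.ofReal_re, Complex.normSq_eq_norm_sq]
  simp only [r3] at r2
  have hpt : ∀ᵐ y ∂muY, ‖w y‖ ^ 2 = ‖Φ 2 y‖ ^ 2
      + (-(2 * κ ^ 2) * ((starRingEnd ℂ) (Φ 0 y) * Φ 2 y).re + κ ^ 4 * ‖Φ 0 y‖ ^ 2) := by
    filter_upwards [hw] with y hy
    rw [← hy, ← Complex.normSq_eq_norm_sq, ← Complex.normSq_eq_norm_sq, ← Complex.normSq_eq_norm_sq,
      ← Complex.ofReal_pow]
    simp only [Complex.normSq_apply, Complex.sub_re, Complex.sub_im, Complex.mul_re, Complex.mul_im,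
      Complex.ofReal_re, Complex.ofReal_im, Complex.conj_re, Complex.conj_im]
    ring
  have j2 : Integrable (fun y => -(2 * κ ^ 2) * ((starRingEnd ℂ) (Φ 0 y) * Φ 2 y).re) muY :=
    hi.re.const_mul _
  have j0 : Integrable (fun y => κ ^ 4 * ‖Φ 0 y‖ ^ 2) muY := h0.integrable_norm_sq.const_mul _
  have j20 : Integrable (fun y => -(2 * κ ^ 2) * ((starRingEnd ℂ) (Φ 0 y) * Φ 2 y).re
    + κ ^ 4 * ‖Φ 0 y‖ ^ 2) muY := j2.add j0
  rw [integral_congr_ae hpt, integral_add (h.memLp.integrable_norm_pow (by norm_num)) j20,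
    integral_add j2 j0, integral_const_mul, integral_const_mul, r1, e1, ← r2]
  ring

end Stream

/-! ### The linearized problem in operator form -/

section Operators

open BoundedContinuousFunction

/-- `L^2(-1, 1)` with complex values. -/
abbrev L2Y : Type := Lp ℂ 2 muY

theorem norm_sq_L2Y (f : L2Y) : ‖f‖ ^ 2 = ∫ y, ‖f y‖ ^ 2 ∂muY := by
  have h1 : RCLike.re (inner ℂ f f) = ‖f‖ ^ 2 := inner_self_eq_norm_sq (𝕜 := ℂ) f
  have h2 : ∀ z : ℂ, inner ℂ z z = ((‖z‖ ^ 2 : ℝ) : ℂ) := fun z => by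
    rw [inner_self_eq_norm_sq_to_K]; norm_cast
  rw [← h1, L2.inner_def]
  simp only [h2]
  rw [integral_complex_ofReal]
  rfl

theorem norm_sq_toLp {f : ℝ → ℂ} (hf : MemLp f 2 muY) : ‖hf.toLp f‖ ^ 2 = ∫ y, ‖f y‖ ^ 2 ∂muY := by
  rw [norm_sq_L2Y]
  refine integral_congr_ae ?_
  filter_upwards [hf.coeFn_toLp] with y hy
  rw [hy]

theorem inner_toLp {f g : ℝ → ℂ} (hf : MemLp f 2 muY) (hg : MemLp g 2 muY) :
    inner ℂ (hf.toLp f) (hg.toLp g) = ∫ y, (starRingEnd ℂ) (f y) * g y ∂muY := by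
  rw [L2.inner_def]
  refine integral_congr_ae ?_
  filter_upwards [hf.coeFn_toLp, hg.coeFn_toLp] with y hy hy'
  rw [hy, hy', RCLike.inner_apply, mul_comm]

theorem memLp_expC (κ : ℝ) : MemLp (expC κ) 2 muY :=
  memLp_of_continuousOn (continuous_expC κ).continuousOn

/-- The functions that satisfy the consistency condition: the orthogonal complement of the solutions
`e^{± k y}` of `(∂_y^2 - k^2) φ = 0`, which is the image of `H^2_0` under `∂_y^2 - k^2`. -/
def consistentSpace (k : ℤ) : Submodule ℂ L2Y :=
  (Submodule.span ℂ {(memLp_expC k).toLp (expC k), (memLp_expC (-k)).toLp (expC (-k))})ᗮ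

theorem conj_expC (κ y : ℝ) : (starRingEnd ℂ) (expC κ y) = expC κ y := Complex.conj_ofReal _

theorem inner_expC (κ : ℝ) (w : L2Y) :
    inner ℂ ((memLp_expC κ).toLp (expC κ)) w = ∫ y, expC κ y * w y ∂muY := by
  conv_lhs => rw [← Lp.toLp_coeFn w (Lp.memLp w)]
  rw [inner_toLp]
  simp only [conj_expC]

theorem mem_consistentSpace {k : ℤ} {w : L2Y} : w ∈ consistentSpace k ↔ Consistent k w := by
  rw [consistentSpace, Submodule.mem_orthogonal]
  constructor
  · intro h
    have h1 := h _ (Submodule.subset_span (mem_insert _ _))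
    have h2 := h _ (Submodule.subset_span (mem_insert_of_mem _ rfl))
    rw [inner_expC] at h1 h2
    exact ⟨h1, by simpa [expC] using h2⟩
  · rintro ⟨h1, h2⟩ u hu
    induction hu using Submodule.span_induction with
    | mem x hx =>
      rcases hx with rfl | hx
      · rw [inner_expC]; exact h1
      · rw [hx, inner_expC]; simpa [expC] using h2
    | zero => simp
    | add x y _ _ hx hy => rw [inner_add_left, hx, hy, add_zero]
    | smul c x _ hx => rw [inner_smul_left, hx, mul_zero]

instance (k : ℤ) : CompleteSpace (consistentSpace k) := by
  unfold consistentSpace; infer_instance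

theorem Consistent.congr {k : ℤ} {w w' : ℝ → ℂ} (h : Consistent k w) (hw : w =ᵐ[muY] w') :
    Consistent k w' := by
  refine ⟨?_, ?_⟩
  · rw [← h.1]; refine integral_congr_ae ?_; filter_upwards [hw] with y hy; rw [hy]
  · rw [← h.2]; refine integral_congr_ae ?_; filter_upwards [hw] with y hy; rw [hy]

variable {k : ℤ}

theorem sobolevTwoZero_of_mem (hk : k ≠ 0) (v : consistentSpace k) :
    SobolevTwoZero (streamFamily k (v : L2Y)) :=
  sobolevTwoZero_streamFamily hk (Lp.memLp _) (mem_consistentSpace.1 v.2)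

theorem streamFamily_laplace (w : ℝ → ℂ) (y : ℝ) :
    streamFamily k w 2 y - (k : ℂ) ^ 2 * streamFamily k w 0 y = w y := by
  simp [streamFamily]

/-- The energy estimate for the stream function. -/
theorem stream_energy_le {w : ℝ → ℂ} {Φ : ℕ → ℝ → ℂ} (h : SobolevOn 2 Φ) (hl : Φ 0 (-1) = 0)
    (hr : Φ 0 1 = 0) (hw : ∀ᵐ y ∂muY, Φ 2 y - (k : ℂ) ^ 2 * Φ 0 y = w y) :
    2 * (k : ℝ) ^ 2 * (∫ y, ‖Φ 1 y‖ ^ 2 ∂muY) + (k : ℝ) ^ 4 * (∫ y, ‖Φ 0 y‖ ^ 2 ∂muY)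
      ≤ ∫ y, ‖w y‖ ^ 2 ∂muY := by
  rw [integral_norm_sq_dirichlet h hl hr (κ := k) (w := w) (by simpa using hw)]
  have : 0 ≤ ∫ y, ‖Φ 2 y‖ ^ 2 ∂muY := integral_nonneg fun y => by positivity
  linarith

theorem one_le_sq_of_ne_zero (hk : k ≠ 0) : (1 : ℝ) ≤ (k : ℝ) ^ 2 := by
  have : 1 ≤ k ^ 2 := by have := sq_pos_of_ne_zero hk; omega
  exact_mod_cast this

theorem stream_congr {w w' : ℝ → ℂ} (h : w =ᵐ[muY] w') {y : ℝ} (hy : y ∈ Icc (-1 : ℝ) 1) :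
    stream k w y = stream k w' y ∧ streamDeriv k w y = streamDeriv k w' y := by
  simp only [stream, streamDeriv, expPrimitive_congr h hy, and_self]

theorem stream_add {w w' : ℝ → ℂ} (hw : Integrable w muY) (hw' : Integrable w' muY) {y : ℝ}
    (hy : y ∈ Icc (-1 : ℝ) 1) : stream k (w + w') y = stream k w y + stream k w' y ∧
      streamDeriv k (w + w') y = streamDeriv k w y + streamDeriv k w' y := by
  have h : ∀ κ : ℝ, expPrimitive κ (w + w') y = expPrimitive κ w y + expPrimitive κ w' y :=
    fun κ => expPrimitive_add hw hw' hy
  simp only [stream, streamDeriv, h]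
  constructor <;> ring

theorem stream_smul (c : ℂ) (w : ℝ → ℂ) (y : ℝ) : stream k (c • w) y = c * stream k w y ∧
    streamDeriv k (c • w) y = c * streamDeriv k w y := by
  have h : ∀ κ : ℝ, expPrimitive κ (c • w) y = c * expPrimitive κ w y :=
    fun κ => expPrimitive_smul c w y
  simp only [stream, streamDeriv, h]
  constructor <;> ring

theorem integrable_coe (w : L2Y) : Integrable w muY := (Lp.memLp w).integrable (by norm_num)

theorem norm_stream_le (hk : k ≠ 0) (v : consistentSpace k) :
    2 * (k : ℝ) ^ 2 * ‖(memLp_streamDeriv hk (Lp.memLp (v : L2Y))).toLp _‖ ^ 2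
      + (k : ℝ) ^ 4 * ‖(memLp_stream hk (Lp.memLp (v : L2Y))).toLp _‖ ^ 2 ≤ ‖v‖ ^ 2 := by
  have h := sobolevTwoZero_of_mem hk v
  have h1 := stream_energy_le h.sobolev h.left_zero h.right_zero
    (Filter.Eventually.of_forall (streamFamily_laplace (v : L2Y)))
  rw [norm_sq_toLp, norm_sq_toLp]
  change _ ≤ ‖(v : L2Y)‖ ^ 2
  rw [norm_sq_L2Y]
  exact h1

/-- The stream function, as a bounded operator on the space of consistent vorticities. -/
def streamL (hk : k ≠ 0) : consistentSpace k →L[ℂ] L2Y :=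
  LinearMap.mkContinuous
    { toFun := fun v => (memLp_stream hk (Lp.memLp (v : L2Y))).toLp _
      map_add' := fun v w => by
        rw [← MemLp.toLp_add, MemLp.toLp_eq_toLp_iff]
        filter_upwards [ae_muY_mem] with y hy
        rw [Submodule.coe_add, (stream_congr (Lp.coeFn_add (v : L2Y) (w : L2Y)) hy).1,
          (stream_add (integrable_coe _) (integrable_coe _) hy).1, Pi.add_apply]
      map_smul' := fun c v => by
        rw [RingHom.id_apply, ← MemLp.toLp_const_smul, MemLp.toLp_eq_toLp_iff]
        filter_upwards [ae_muY_mem] with y hy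
        rw [Submodule.coe_smul, (stream_congr (Lp.coeFn_smul c (v : L2Y)) hy).1, (stream_smul _ _ _).1, Pi.smul_apply,
          smul_eq_mul] } 1
    fun v => by
      have h := norm_stream_le hk v
      have hk2 := one_le_sq_of_ne_zero hk
      rw [one_mul]
      refine le_of_sq_le_sq ?_ (norm_nonneg _)
      change ‖(memLp_stream hk (Lp.memLp (v : L2Y))).toLp _‖ ^ 2 ≤ _
      nlinarith [sq_nonneg ‖(memLp_streamDeriv hk (Lp.memLp (v : L2Y))).toLp _‖,
        sq_nonneg ‖(memLp_stream hk (Lp.memLp (v : L2Y))).toLp _‖,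
        mul_nonneg (sq_nonneg (k : ℝ))
          (sq_nonneg ‖(memLp_streamDeriv hk (Lp.memLp (v : L2Y))).toLp _‖),
        mul_le_mul_of_nonneg_right (one_le_pow₀ hk2 : 1 ≤ ((k : ℝ) ^ 2) ^ 2)
          (sq_nonneg ‖(memLp_stream hk (Lp.memLp (v : L2Y))).toLp _‖)]

/-- The derivative of the stream function, as a bounded operator. -/
def streamDerivL (hk : k ≠ 0) : consistentSpace k →L[ℂ] L2Y :=
  LinearMap.mkContinuous
    { toFun := fun v => (memLp_streamDeriv hk (Lp.memLp (v : L2Y))).toLp _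
      map_add' := fun v w => by
        rw [← MemLp.toLp_add, MemLp.toLp_eq_toLp_iff]
        filter_upwards [ae_muY_mem] with y hy
        rw [Submodule.coe_add, (stream_congr (Lp.coeFn_add (v : L2Y) (w : L2Y)) hy).2,
          (stream_add (integrable_coe _) (integrable_coe _) hy).2, Pi.add_apply]
      map_smul' := fun c v => by
        rw [RingHom.id_apply, ← MemLp.toLp_const_smul, MemLp.toLp_eq_toLp_iff]
        filter_upwards [ae_muY_mem] with y hy
        rw [Submodule.coe_smul, (stream_congr (Lp.coeFn_smul c (v : L2Y)) hy).2, (stream_smul _ _ _).2, Pi.smul_apply,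
          smul_eq_mul] } 1
    fun v => by
      have h := norm_stream_le hk v
      have hk2 := one_le_sq_of_ne_zero hk
      rw [one_mul]
      refine le_of_sq_le_sq ?_ (norm_nonneg _)
      change ‖(memLp_streamDeriv hk (Lp.memLp (v : L2Y))).toLp _‖ ^ 2 ≤ _
      nlinarith [sq_nonneg ‖(memLp_streamDeriv hk (Lp.memLp (v : L2Y))).toLp _‖,
        mul_nonneg (pow_nonneg (sq_nonneg (k : ℝ)) 2)
          (sq_nonneg ‖(memLp_stream hk (Lp.memLp (v : L2Y))).toLp _‖),
        mul_le_mul_of_nonneg_right hk2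
          (sq_nonneg ‖(memLp_streamDeriv hk (Lp.memLp (v : L2Y))).toLp _‖)]

theorem coeFn_streamL (hk : k ≠ 0) (v : consistentSpace k) :
    streamL hk v =ᵐ[muY] stream k (v : L2Y) :=
  (memLp_stream hk (Lp.memLp (v : L2Y))).coeFn_toLp

theorem coeFn_streamDerivL (hk : k ≠ 0) (v : consistentSpace k) :
    streamDerivL hk v =ᵐ[muY] streamDeriv k (v : L2Y) :=
  (memLp_streamDeriv hk (Lp.memLp (v : L2Y))).coeFn_toLp

theorem streamL_energy_le (hk : k ≠ 0) (v : consistentSpace k) :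
    2 * (k : ℝ) ^ 2 * ‖streamDerivL hk v‖ ^ 2 + (k : ℝ) ^ 4 * ‖streamL hk v‖ ^ 2 ≤ ‖v‖ ^ 2 :=
  norm_stream_le hk v

theorem memLp_bcf_mul (f : ℝ →ᵇ ℝ) {w : ℝ → ℂ} (hw : MemLp w 2 muY) :
    MemLp (fun y => (f y : ℂ) * w y) 2 muY := by
  refine hw.of_le_mul (c := ‖f‖) ?_ (Filter.Eventually.of_forall fun y => ?_)
  · exact (Complex.continuous_ofReal.comp f.continuous).aestronglyMeasurable.mul
      hw.aestronglyMeasurable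
  · rw [norm_mul, Complex.norm_real]
    exact mul_le_mul_of_nonneg_right (f.norm_coe_le_norm y) (norm_nonneg _)

/-- Multiplication by a bounded continuous function. -/
def mulOp (f : ℝ →ᵇ ℝ) : L2Y →L[ℂ] L2Y :=
  LinearMap.mkContinuous
    { toFun := fun w => (memLp_bcf_mul f (Lp.memLp w)).toLp _
      map_add' := fun v w => by
        rw [← MemLp.toLp_add, MemLp.toLp_eq_toLp_iff]
        filter_upwards [Lp.coeFn_add v w] with y hy
        rw [hy, Pi.add_apply, Pi.add_apply, mul_add]
      map_smul' := fun c v => by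
        rw [RingHom.id_apply, ← MemLp.toLp_const_smul, MemLp.toLp_eq_toLp_iff]
        filter_upwards [Lp.coeFn_smul c v] with y hy
        rw [hy, Pi.smul_apply, Pi.smul_apply, smul_eq_mul, smul_eq_mul, mul_left_comm] } ‖f‖
    fun w => by
      refine Lp.norm_le_mul_norm_of_ae_le_mul ?_
      filter_upwards [(memLp_bcf_mul f (Lp.memLp w)).coeFn_toLp] with y hy
      refine (congrArg norm hy).trans_le ?_
      rw [norm_mul, Complex.norm_real]
      exact mul_le_mul_of_nonneg_right (f.norm_coe_le_norm y) (norm_nonneg _)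

theorem coeFn_mulOp (f : ℝ →ᵇ ℝ) (w : L2Y) : mulOp f w =ᵐ[muY] fun y => (f y : ℂ) * w y :=
  (memLp_bcf_mul f (Lp.memLp w)).coeFn_toLp

theorem norm_mulOp_apply_le {f : ℝ →ᵇ ℝ} {c : ℝ} (h : ∀ᵐ y ∂muY, |f y| ≤ c) (w : L2Y) :
    ‖mulOp f w‖ ≤ c * ‖w‖ := by
  refine Lp.norm_le_mul_norm_of_ae_le_mul ?_
  filter_upwards [coeFn_mulOp f w, h] with y hy hc
  rw [hy, norm_mul, Complex.norm_real]
  exact mul_le_mul_of_nonneg_right hc (norm_nonneg _)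

theorem norm_mulOp_le (f : ℝ →ᵇ ℝ) : ‖mulOp f‖ ≤ ‖f‖ :=
  ContinuousLinearMap.opNorm_le_bound _ (norm_nonneg _) fun w =>
    norm_mulOp_apply_le (Filter.Eventually.of_forall fun y => f.norm_coe_le_norm y) w

theorem mulOp_sub (f g : ℝ →ᵇ ℝ) : mulOp f - mulOp g = mulOp (f - g) := by
  ext1 w
  refine Lp.ext ?_
  rw [_root_.sub_apply]
  filter_upwards [Lp.coeFn_sub (mulOp f w) (mulOp g w), coeFn_mulOp f w, coeFn_mulOp g w,
    coeFn_mulOp (f - g) w] with y h1 h2 h3 h4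
  rw [h1, h4, Pi.sub_apply, h2, h3, BoundedContinuousFunction.sub_apply]
  push_cast; ring

theorem continuous_mulOp : Continuous mulOp := by
  refine (LipschitzWith.of_dist_le_mul (K := 1) fun f g => ?_).continuous
  rw [dist_eq_norm, dist_eq_norm, mulOp_sub, NNReal.coe_one, one_mul]
  exact norm_mulOp_le _

/-- Multiplication by a real function is symmetric. -/
theorem im_inner_mulOp (f : ℝ →ᵇ ℝ) (w : L2Y) : (inner ℂ w (mulOp f w)).im = 0 := by
  have h : inner ℂ w (mulOp f w) = ∫ y, ((f y * ‖w y‖ ^ 2 : ℝ) : ℂ) ∂muY := by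
    rw [L2.inner_def]
    refine integral_congr_ae ?_
    filter_upwards [coeFn_mulOp f w] with y hy
    rw [hy, RCLike.inner_apply, mul_assoc, Complex.mul_conj, Complex.normSq_eq_norm_sq]
    push_cast; ring
  rw [h, integral_complex_ofReal]
  exact Complex.ofReal_im _

/-- Pairs of square integrable functions, such as the velocity `(∂_y ψ, k ψ)`. -/
abbrev VelocityY : Type := WithLp 2 (L2Y × L2Y)

/-- A pair of operators, as an operator into the space of pairs. -/
def pairL {E : Type*} [NormedAddCommGroup E] [NormedSpace ℂ E] (A B : E →L[ℂ] L2Y) :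
    E →L[ℂ] VelocityY :=
  ((WithLp.prodContinuousLinearEquiv 2 ℂ L2Y L2Y).symm : (L2Y × L2Y) →L[ℂ] VelocityY) ∘L (A.prod B)

theorem pairL_apply {E : Type*} [NormedAddCommGroup E] [NormedSpace ℂ E] (A B : E →L[ℂ] L2Y)
    (x : E) : pairL A B x = WithLp.toLp 2 (A x, B x) := rfl

theorem inner_toLp_pair (a b c d : L2Y) :
    inner ℂ (WithLp.toLp 2 (a, b) : VelocityY) (WithLp.toLp 2 (c, d)) = inner ℂ a c + inner ℂ b d :=
  rfl

theorem norm_sq_toLp_pair (a b : L2Y) :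
    ‖(WithLp.toLp 2 (a, b) : VelocityY)‖ ^ 2 = ‖a‖ ^ 2 + ‖b‖ ^ 2 :=
  WithLp.prod_norm_sq_eq_of_L2 _

theorem continuous_pairL {E : Type*} [NormedAddCommGroup E] [NormedSpace ℂ E]
    {A B : ℝ → E →L[ℂ] L2Y} (hA : Continuous A) (hB : Continuous B) :
    Continuous fun t => pairL (A t) (B t) := by
  have h1 : Continuous fun t => (A t).prod (B t) :=
    (ContinuousLinearMap.prodₗᵢ ℂ).continuous.comp (hA.prodMk hB)
  exact continuous_const.clm_comp h1

/-- The velocity operator `w ↦ (∂_y ψ, k ψ)`. -/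
def velocityL (hk : k ≠ 0) : consistentSpace k →L[ℂ] VelocityY :=
  pairL (streamDerivL hk) ((k : ℂ) • streamL hk)

end Operators

/-! ### Transport by the background flow -/

section Transport

open BoundedContinuousFunction

variable {k : ℤ}

/-- The vorticity `(∂_y^2 - k^2) (i k U ψ)` of the transported stream function. -/
def dragL (hk : k ≠ 0) (U U₁ U₂ : ℝ →ᵇ ℝ) : consistentSpace k →L[ℂ] L2Y :=
  (Complex.I * k) • (mulOp U ∘L (consistentSpace k).subtypeL
    + (2 : ℂ) • (mulOp U₁ ∘L streamDerivL hk) + mulOp U₂ ∘L streamL hk)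

/-- The operator `X` of multiplication of the stream function by `i k U`, acting on vorticities. -/
def driftL (hk : k ≠ 0) (U U₁ U₂ : ℝ →ᵇ ℝ) : consistentSpace k →L[ℂ] consistentSpace k :=
  (consistentSpace k).orthogonalProjectionOnto ∘L dragL hk U U₁ U₂

/-- The transport term `-i k U ω + i k U'' ψ` in divergence form: its pairing with `(φ', k φ)`
is the pairing of the transport term with `-φ`. -/
def transportL (hk : k ≠ 0) (U U₁ : ℝ →ᵇ ℝ) : consistentSpace k →L[ℂ] VelocityY :=
  pairL ((Complex.I * k) • (mulOp U₁ ∘L streamL hk - mulOp U ∘L streamDerivL hk))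
    (-(Complex.I * k * k) • (mulOp U ∘L streamL hk))

theorem continuous_driftL (hk : k ≠ 0) {U U₁ U₂ : ℝ → ℝ →ᵇ ℝ} (hU : Continuous U)
    (hU₁ : Continuous U₁) (hU₂ : Continuous U₂) :
    Continuous fun t => driftL hk (U t) (U₁ t) (U₂ t) := by
  have h0 := (continuous_mulOp.comp hU).clm_comp
    (continuous_const (y := (consistentSpace k).subtypeL))
  have h1 := (continuous_mulOp.comp hU₁).clm_comp (continuous_const (y := streamDerivL hk))
  have h2 := (continuous_mulOp.comp hU₂).clm_comp (continuous_const (y := streamL hk))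
  exact continuous_const.clm_comp (((h0.add (h1.const_smul (2 : ℂ))).add h2).const_smul
    (Complex.I * k))

theorem continuous_transportL (hk : k ≠ 0) {U U₁ : ℝ → ℝ →ᵇ ℝ} (hU : Continuous U)
    (hU₁ : Continuous U₁) : Continuous fun t => transportL hk (U t) (U₁ t) := by
  have h0 := (continuous_mulOp.comp hU).clm_comp (continuous_const (y := streamDerivL hk))
  have h1 := (continuous_mulOp.comp hU₁).clm_comp (continuous_const (y := streamL hk))
  have h2 := (continuous_mulOp.comp hU).clm_comp (continuous_const (y := streamL hk))
  exact continuous_pairL ((h1.sub h0).const_smul (Complex.I * k))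
    (h2.const_smul (-(Complex.I * k * k)))

theorem IsPrimitiveOn.real_mul {U U' : ℝ → ℝ} {f f' : ℝ → ℂ} (hU : IsPrimitiveOn (-1) 1 U U')
    (hf : IsPrimitiveOn (-1) 1 f f') :
    IsPrimitiveOn (-1) 1 (fun y => (U y : ℂ) * f y) (fun y => (U' y : ℂ) * f y + (U y : ℂ) * f' y) :=
  (hU.clm_comp Complex.ofRealCLM).bilin (ContinuousLinearMap.mul ℝ ℂ) (by norm_num) hf

/-- The derivatives of `i k U ψ`. -/
def dragFamily (k : ℤ) (U U₁ U₂ : ℝ → ℝ) (w : ℝ → ℂ) : ℕ → ℝ → ℂ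
  | 0 => fun y => Complex.I * k * (U y * stream k w y)
  | 1 => fun y => Complex.I * k * (U₁ y * stream k w y + U y * streamDeriv k w y)
  | _ => fun y => Complex.I * k * (U₂ y * stream k w y + U₁ y * streamDeriv k w y
      + (U₁ y * streamDeriv k w y + U y * ((k : ℂ) ^ 2 * stream k w y + w y)))

variable {U U₁ U₂ : ℝ →ᵇ ℝ}

theorem sobolevTwoZero_dragFamily (hk : k ≠ 0) (hU : IsPrimitiveOn (-1) 1 U U₁)
    (hU₁ : IsPrimitiveOn (-1) 1 U₁ U₂) (v : consistentSpace k) :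
    SobolevTwoZero (dragFamily k U U₁ U₂ (v : L2Y)) := by
  have hv := sobolevTwoZero_of_mem hk v
  have h0 := isPrimitiveOn_stream hk (integrable_coe (v : L2Y))
  have h1 := isPrimitiveOn_streamDeriv hk (integrable_coe (v : L2Y))
  have m0 := memLp_stream hk (Lp.memLp (v : L2Y))
  have m1 := memLp_streamDeriv hk (Lp.memLp (v : L2Y))
  have l0 : stream k (v : L2Y) (-1) = 0 := hv.left_zero
  have l1 : streamDeriv k (v : L2Y) (-1) = 0 := hv.left_deriv_zero
  have r0 : stream k (v : L2Y) 1 = 0 := hv.right_zero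
  have r1 : streamDeriv k (v : L2Y) 1 = 0 := hv.right_deriv_zero
  refine ⟨⟨fun j hj y hy => ?_, ?_⟩, ?_, ?_, ?_, ?_⟩
  · interval_cases j
    · exact ((hU.real_mul h0).const_mul (Complex.I * k)).eq_add y hy
    · exact (((hU₁.real_mul h0).add (hU.real_mul h1)).const_mul (Complex.I * k)).eq_add y hy
  · exact (((memLp_bcf_mul U₂ m0).add (memLp_bcf_mul U₁ m1)).add ((memLp_bcf_mul U₁ m1).add
      (memLp_bcf_mul U ((m0.const_mul _).add (Lp.memLp (v : L2Y)))))).const_mul _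
  all_goals simp [dragFamily, l0, l1, r0, r1]

theorem dragFamily_laplace (hk : k ≠ 0) (v : consistentSpace k) :
    ∀ᵐ y ∂muY, dragFamily k U U₁ U₂ (v : L2Y) 2 y
      - (k : ℂ) ^ 2 * dragFamily k U U₁ U₂ (v : L2Y) 0 y = dragL hk U U₁ U₂ v y := by
  have e : dragL hk U U₁ U₂ v = (Complex.I * k) • (mulOp U (v : L2Y)
    + (2 : ℂ) • mulOp U₁ (streamDerivL hk v) + mulOp U₂ (streamL hk v)) := rfl
  rw [e]
  filter_upwards [Lp.coeFn_smul (Complex.I * (k : ℂ)) (mulOp U (v : L2Y)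
      + (2 : ℂ) • mulOp U₁ (streamDerivL hk v) + mulOp U₂ (streamL hk v)),
    Lp.coeFn_add (mulOp U (v : L2Y) + (2 : ℂ) • mulOp U₁ (streamDerivL hk v))
      (mulOp U₂ (streamL hk v)),
    Lp.coeFn_add (mulOp U (v : L2Y)) ((2 : ℂ) • mulOp U₁ (streamDerivL hk v)),
    Lp.coeFn_smul (2 : ℂ) (mulOp U₁ (streamDerivL hk v)),
    coeFn_mulOp U (v : L2Y), coeFn_mulOp U₁ (streamDerivL hk v), coeFn_mulOp U₂ (streamL hk v),
    coeFn_streamL hk v, coeFn_streamDerivL hk v] with y h1 h2 h3 h4 h5 h6 h7 h8 h9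
  rw [h1, Pi.smul_apply, h2, Pi.add_apply, h3, Pi.add_apply, h4, Pi.smul_apply, h5, h6, h7, h8, h9]
  simp only [dragFamily, smul_eq_mul]
  ring

/-- `U ψ` lies in `H^2_0`, hence its vorticity is consistent: the projection in the definition of
`driftL` does nothing. -/
theorem dragL_mem (hk : k ≠ 0) (hU : IsPrimitiveOn (-1) 1 U U₁)
    (hU₁ : IsPrimitiveOn (-1) 1 U₁ U₂) (v : consistentSpace k) :
    dragL hk U U₁ U₂ v ∈ consistentSpace k :=
  mem_consistentSpace.2 ((sobolevTwoZero_dragFamily hk hU hU₁ v).consistent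
    (dragFamily_laplace hk v))

theorem coe_driftL (hk : k ≠ 0) (hU : IsPrimitiveOn (-1) 1 U U₁)
    (hU₁ : IsPrimitiveOn (-1) 1 U₁ U₂) (v : consistentSpace k) :
    (driftL hk U U₁ U₂ v : L2Y) = dragL hk U U₁ U₂ v :=
  (consistentSpace k).starProjection_eq_self_iff.2 (dragL_mem hk hU hU₁ v)

theorem streamL_driftL (hk : k ≠ 0) (hU : IsPrimitiveOn (-1) 1 U U₁)
    (hU₁ : IsPrimitiveOn (-1) 1 U₁ U₂) (v : consistentSpace k) :
    streamL hk (driftL hk U U₁ U₂ v) = (Complex.I * k) • mulOp U (streamL hk v) := by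
  refine Lp.ext ?_
  filter_upwards [coeFn_streamL hk (driftL hk U U₁ U₂ v), coeFn_streamL hk v,
    coeFn_mulOp U (streamL hk v), Lp.coeFn_smul (Complex.I * (k : ℂ)) (mulOp U (streamL hk v)),
    ae_muY_mem] with y h1 h2 h3 h4 hy
  rw [h1, h4, Pi.smul_apply, h3, h2, coe_driftL hk hU hU₁ v,
    ← ((sobolevTwoZero_dragFamily hk hU hU₁ v).eq_stream hk (dragFamily_laplace hk v) hy).1]
  rfl

theorem streamDerivL_driftL (hk : k ≠ 0) (hU : IsPrimitiveOn (-1) 1 U U₁)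
    (hU₁ : IsPrimitiveOn (-1) 1 U₁ U₂) (v : consistentSpace k) :
    streamDerivL hk (driftL hk U U₁ U₂ v)
      = (Complex.I * k) • (mulOp U₁ (streamL hk v) + mulOp U (streamDerivL hk v)) := by
  refine Lp.ext ?_
  filter_upwards [coeFn_streamDerivL hk (driftL hk U U₁ U₂ v), coeFn_streamL hk v,
    coeFn_streamDerivL hk v, coeFn_mulOp U₁ (streamL hk v), coeFn_mulOp U (streamDerivL hk v),
    Lp.coeFn_add (mulOp U₁ (streamL hk v)) (mulOp U (streamDerivL hk v)),
    Lp.coeFn_smul (Complex.I * (k : ℂ)) (mulOp U₁ (streamL hk v) + mulOp U (streamDerivL hk v)),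
    ae_muY_mem] with y h1 h2 h3 h4 h5 h6 h7 hy
  rw [h1, h7, Pi.smul_apply, h6, Pi.add_apply, h4, h5, h2, h3, coe_driftL hk hU hU₁ v,
    ← ((sobolevTwoZero_dragFamily hk hU hU₁ v).eq_stream hk (dragFamily_laplace hk v) hy).2]
  rfl

theorem velocityL_apply (hk : k ≠ 0) (v : consistentSpace k) :
    velocityL hk v = WithLp.toLp 2 (streamDerivL hk v, (k : ℂ) • streamL hk v) := rfl

theorem transportL_apply (hk : k ≠ 0) (v : consistentSpace k) :
    transportL hk U U₁ v = WithLp.toLp 2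
      ((Complex.I * k) • (mulOp U₁ (streamL hk v) - mulOp U (streamDerivL hk v)),
        (-(Complex.I * k * k)) • mulOp U (streamL hk v)) := rfl

theorem norm_sq_velocityL (hk : k ≠ 0) (v : consistentSpace k) :
    ‖velocityL hk v‖ ^ 2 = ‖streamDerivL hk v‖ ^ 2 + (k : ℝ) ^ 2 * ‖streamL hk v‖ ^ 2 := by
  rw [velocityL_apply, norm_sq_toLp_pair, norm_smul, Complex.norm_intCast, mul_pow, sq_abs]

theorem norm_sq_velocityL_le (hk : k ≠ 0) (v : consistentSpace k) :
    ‖velocityL hk v‖ ^ 2 ≤ ((k : ℝ) ^ 2)⁻¹ * ‖v‖ ^ 2 := by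
  have h := streamL_energy_le hk v
  have hk2 := one_le_sq_of_ne_zero hk
  have hk0 : (0 : ℝ) < (k : ℝ) ^ 2 := by linarith
  rw [inv_mul_eq_div, le_div_iff₀ hk0, norm_sq_velocityL]
  nlinarith [mul_nonneg hk0.le (sq_nonneg ‖streamDerivL hk v‖)]

theorem velocityL_injective (hk : k ≠ 0) (v : consistentSpace k) (h : velocityL hk v = 0) :
    v = 0 := by
  have h1 := norm_sq_velocityL hk v
  have hk2 := one_le_sq_of_ne_zero hk
  rw [h, norm_zero] at h1
  have hP1 : ‖streamDerivL hk v‖ ^ 2 = 0 := by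
    nlinarith [sq_nonneg ‖streamDerivL hk v‖, mul_nonneg (sq_nonneg (k : ℝ)) (sq_nonneg ‖streamL hk v‖)]
  have hP0 : ‖streamL hk v‖ ^ 2 = 0 := by
    nlinarith [sq_nonneg ‖streamL hk v‖, mul_nonneg (sq_nonneg (k : ℝ)) (sq_nonneg ‖streamL hk v‖)]
  have z1 : streamDerivL hk v = 0 := norm_eq_zero.1 (pow_eq_zero_iff (two_ne_zero) |>.1 hP1)
  have z0 : streamL hk v = 0 := norm_eq_zero.1 (pow_eq_zero_iff (two_ne_zero) |>.1 hP0)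
  -- `ψ` and `ψ'` vanish almost everywhere, so the primitive `ψ' + k ψ` of `e^{-k y} w` vanishes
  have hcont := (isPrimitiveOn_expPrimitive (integrable_coe (v : L2Y)) k).continuousOn
  have hae : ∀ᵐ y ∂muY, expPrimitive k (v : L2Y) y = 0 := by
    filter_upwards [coeFn_streamL hk v, coeFn_streamDerivL hk v, Lp.coeFn_zero ℂ 2 muY] with y a b c
    rw [z0, c, Pi.zero_apply] at a
    rw [z1, c, Pi.zero_apply] at b
    have hk' : (k : ℂ) ≠ 0 := by exact_mod_cast hk
    have a' : expPrimitive k (v : L2Y) y - expPrimitive (-k) (v : L2Y) y = 0 := by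
      have := a.symm
      rw [stream, div_eq_zero_iff] at this
      rcases this with h | h
      · exact h
      · exact absurd h (mul_ne_zero two_ne_zero hk')
    have b' : expPrimitive k (v : L2Y) y + expPrimitive (-k) (v : L2Y) y = 0 := by
      have := b.symm
      rw [streamDeriv, div_eq_zero_iff] at this
      exact this.resolve_right two_ne_zero
    linear_combination (a' + b') / 2
  have hzero : ∀ y ∈ Ioo (-1 : ℝ) 1, expPrimitive k (v : L2Y) y = 0 :=
    Measure.eqOn_open_of_ae_eq (f := expPrimitive k (v : L2Y)) (g := fun _ => 0) hae isOpen_Ioo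
      (hcont.mono Ioo_subset_Icc_self) continuousOn_const
  have hI := integrable_expC_mul (integrable_coe (v : L2Y)) (-k)
  have hd := hI.ae_hasDerivAt_integral
  refine Subtype.ext (Lp.ext ?_)
  have hd' : ∀ᵐ y ∂muY, y ∈ uIcc (-1 : ℝ) 1 → ∀ c ∈ uIcc (-1 : ℝ) 1,
      HasDerivAt (fun x => ∫ s in c..x, expC (-k) s * (v : L2Y) s) (expC (-k) y * (v : L2Y) y) y :=
    ae_restrict_of_ae hd
  filter_upwards [hd', ae_restrict_mem measurableSet_Ioo,
    Lp.coeFn_zero ℂ 2 muY] with y hy hym hc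
  have hder := hy (by rw [uIcc_of_le (by norm_num)]; exact Ioo_subset_Icc_self hym) (-1) left_mem_uIcc
  have heq : (fun x => ∫ s in (-1 : ℝ)..x, expC (-k) s * (v : L2Y) s) =ᶠ[nhds y] fun _ => 0 := by
    filter_upwards [isOpen_Ioo.mem_nhds hym] with x hx
    exact (mul_eq_zero.1 (hzero x hx)).resolve_left (expC_ne_zero _ _)
  have h0 := (hder.congr_of_eventuallyEq heq.symm).unique (hasDerivAt_const y (0 : ℂ))
  rw [(mul_eq_zero.1 h0).resolve_left (expC_ne_zero _ _)]
  exact hc.symm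

/-- The transport term is dominated by the dissipation. -/
theorem transport_le (hk : k ≠ 0) {ν : ℝ} (hU₁ : ∀ᵐ y ∂muY, |U₁ y| ≤ 2 * (ν * (k : ℝ) ^ 2))
    (hν : 0 < ν) (v : consistentSpace k) :
    (inner ℂ (velocityL hk v) (transportL hk U U₁ v)).re ≤ 3 / 4 * ν * ‖v‖ ^ 2 := by
  have h := streamL_energy_le hk v
  have e : (inner ℂ (velocityL hk v) (transportL hk U U₁ v)).re
      = ((Complex.I * k) * inner ℂ (streamDerivL hk v) (mulOp U₁ (streamL hk v))).re := by
    have i1 := im_inner_mulOp U (streamDerivL hk v)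
    have i2 := im_inner_mulOp U (streamL hk v)
    rw [velocityL_apply, transportL_apply, inner_toLp_pair]
    simp only [inner_smul_left, inner_smul_right, inner_sub_right, map_intCast]
    simp [i1, i2]
  have b : ((Complex.I * k) * inner ℂ (streamDerivL hk v) (mulOp U₁ (streamL hk v))).re
      ≤ |(k : ℝ)| * (‖streamDerivL hk v‖ * (2 * (ν * (k : ℝ) ^ 2) * ‖streamL hk v‖)) := by
    refine (Complex.re_le_norm _).trans ?_
    rw [norm_mul, norm_mul, Complex.norm_I, one_mul, Complex.norm_intCast]
    gcongr
    exact (norm_inner_le_norm _ _).trans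
      (mul_le_mul_of_nonneg_left (norm_mulOp_apply_le hU₁ _) (norm_nonneg _))
  rw [e]
  refine b.trans ?_
  have hk4 : (k : ℝ) ^ 4 = |(k : ℝ)| ^ 4 := by rw [← abs_pow, abs_of_nonneg (by positivity)]
  rw [hk4, ← sq_abs (k : ℝ)] at h
  rw [← sq_abs (k : ℝ)]
  generalize |(k : ℝ)| = a at *
  generalize ‖streamDerivL hk v‖ = p at *
  generalize ‖streamL hk v‖ = q at *
  have h2 : 2 * (a * p) * (a ^ 2 * q) ≤ 3 / 4 * (2 * a ^ 2 * p ^ 2 + a ^ 4 * q ^ 2) := by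
    nlinarith [sq_nonneg (2 * (a * p) - (4 / 3) * (a ^ 2 * q)), sq_nonneg (a ^ 2 * q),
      sq_nonneg (a * p), sq_nonneg (3 * (a * p) - 2 * (a ^ 2 * q))]
  calc a * (p * (2 * (ν * a ^ 2) * q)) = ν * (2 * (a * p) * (a ^ 2 * q)) := by ring
    _ ≤ ν * (3 / 4 * ‖v‖ ^ 2) :=
      mul_le_mul_of_nonneg_left (h2.trans (by linarith)) hν.le
    _ = _ := by ring

/-- The drift is skew-adjoint up to terms of lower order. -/
theorem drift_skew_le (hk : k ≠ 0) (hU : IsPrimitiveOn (-1) 1 U U₁)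
    (hU₁ : IsPrimitiveOn (-1) 1 U₁ U₂) {m B : ℝ} (hm : ∀ᵐ y ∂muY, |U₁ y| ≤ 2 * m) (hm1 : 1 ≤ 2 * m)
    (hB : ‖U₂‖ ≤ B) (v : consistentSpace k) :
    -(inner ℂ v (driftL hk U U₁ U₂ v)).re ≤ (4 + 2 * B) * m * ‖v‖ ^ 2 := by
  have hB0 : 0 ≤ B := (norm_nonneg _).trans hB
  have h := streamL_energy_le hk v
  have hk2 := one_le_sq_of_ne_zero hk
  set f := (2 : ℂ) • mulOp U₁ (streamDerivL hk v) + mulOp U₂ (streamL hk v) with hf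
  have e : (inner ℂ v (driftL hk U U₁ U₂ v)).re = ((Complex.I * k) * inner ℂ (v : L2Y) f).re := by
    have e1 : inner ℂ v (driftL hk U U₁ U₂ v) = inner ℂ (v : L2Y) (dragL hk U U₁ U₂ v) := by
      rw [← coe_driftL hk hU hU₁]; rfl
    have e2 : dragL hk U U₁ U₂ v = (Complex.I * k) • (mulOp U (v : L2Y) + f) := by
      rw [hf, ← add_assoc]; rfl
    have i1 := im_inner_mulOp U (v : L2Y)
    rw [e1, e2, inner_smul_right, inner_add_right]
    simp [i1]
  have n1 : ‖mulOp U₁ (streamDerivL hk v)‖ ≤ 2 * m * ‖streamDerivL hk v‖ := norm_mulOp_apply_le hm _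
  have n2 : ‖mulOp U₂ (streamL hk v)‖ ≤ B * ‖streamL hk v‖ :=
    norm_mulOp_apply_le (Filter.Eventually.of_forall fun y => (U₂.norm_coe_le_norm y).trans hB) _
  have n3 : ‖f‖ ≤ 2 * (2 * m * ‖streamDerivL hk v‖) + B * ‖streamL hk v‖ := by
    refine (norm_add_le _ _).trans (add_le_add ?_ n2)
    rw [norm_smul, Complex.norm_ofNat]
    gcongr
  have a1 : |(k : ℝ)| * ‖streamDerivL hk v‖ ≤ ‖v‖ := by
    refine abs_le_of_sq_le_sq' ?_ (norm_nonneg _) |>.2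
    rw [mul_pow, sq_abs]
    nlinarith [mul_nonneg (sq_nonneg (k : ℝ)) (sq_nonneg ‖streamDerivL hk v‖),
      mul_nonneg (pow_nonneg (sq_nonneg (k : ℝ)) 2) (sq_nonneg ‖streamL hk v‖)]
  have a2 : |(k : ℝ)| * ‖streamL hk v‖ ≤ ‖v‖ := by
    refine abs_le_of_sq_le_sq' ?_ (norm_nonneg _) |>.2
    rw [mul_pow, sq_abs]
    have : (k : ℝ) ^ 2 * ‖streamL hk v‖ ^ 2 ≤ (k : ℝ) ^ 2 * ((k : ℝ) ^ 2 * ‖streamL hk v‖ ^ 2) :=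
      mul_le_mul_of_nonneg_left (le_mul_of_one_le_left (sq_nonneg _) hk2) (sq_nonneg _)
    nlinarith [mul_nonneg (sq_nonneg (k : ℝ)) (sq_nonneg ‖streamDerivL hk v‖)]
  rw [e]
  calc -((Complex.I * k) * inner ℂ (v : L2Y) f).re ≤ ‖(Complex.I * k) * inner ℂ (v : L2Y) f‖ :=
        (neg_le_abs _).trans (Complex.abs_re_le_norm _)
    _ ≤ |(k : ℝ)| * (‖v‖ * ‖f‖) := by
        rw [norm_mul, norm_mul, Complex.norm_I, one_mul, Complex.norm_intCast]
        gcongr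
        exact norm_inner_le_norm _ _
    _ ≤ |(k : ℝ)| * (‖v‖ * (2 * (2 * m * ‖streamDerivL hk v‖) + B * ‖streamL hk v‖)) := by gcongr
    _ = ‖v‖ * (4 * m * (|(k : ℝ)| * ‖streamDerivL hk v‖) + B * (|(k : ℝ)| * ‖streamL hk v‖)) := by
        ring
    _ ≤ ‖v‖ * (4 * m * ‖v‖ + B * ‖v‖) := by
        have : 0 ≤ m := by linarith
        gcongr
    _ ≤ _ := by
        have := mul_le_mul_of_nonneg_left hm1 (mul_nonneg hB0 (sq_nonneg ‖v‖))
        nlinarith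

/-- Up to a term of order zero, the transport operator is `-M X`. -/
theorem transport_error_le (hk : k ≠ 0) (hU : IsPrimitiveOn (-1) 1 U U₁)
    (hU₁ : IsPrimitiveOn (-1) 1 U₁ U₂) {ν : ℝ} (hν : 0 < ν)
    (hm : ∀ᵐ y ∂muY, |U₁ y| ≤ 2 * (ν * (k : ℝ) ^ 2)) (v : consistentSpace k) :
    ‖transportL hk U U₁ v + velocityL hk (driftL hk U U₁ U₂ v)‖ ^ 2
      ≤ 16 * ν * (ν * (k : ℝ) ^ 2) * ‖v‖ ^ 2 := by
  have h := streamL_energy_le hk v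
  have e : transportL hk U U₁ v + velocityL hk (driftL hk U U₁ U₂ v)
      = WithLp.toLp 2 ((2 * (Complex.I * k)) • mulOp U₁ (streamL hk v), 0) := by
    rw [transportL_apply, velocityL_apply, streamL_driftL hk hU hU₁, streamDerivL_driftL hk hU hU₁,
      ← WithLp.toLp_add, Prod.mk_add_mk]
    congr 2
    · module
    · module
  have n1 := norm_mulOp_apply_le hm (streamL hk v)
  rw [e, norm_sq_toLp_pair, norm_zero, norm_smul, norm_mul, norm_mul, Complex.norm_I,
    Complex.norm_intCast, Complex.norm_ofNat]
  calc (2 * (1 * |(k : ℝ)|) * ‖mulOp U₁ (streamL hk v)‖) ^ 2 + 0 ^ 2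
      ≤ (2 * (1 * |(k : ℝ)|) * (2 * (ν * (k : ℝ) ^ 2) * ‖streamL hk v‖)) ^ 2 + 0 ^ 2 := by gcongr
    _ = 16 * ν * (ν * (k : ℝ) ^ 2) * ((k : ℝ) ^ 4 * ‖streamL hk v‖ ^ 2) := by
        have := sq_abs (k : ℝ)
        linear_combination 16 * ν ^ 2 * k ^ 4 * ‖streamL hk v‖ ^ 2 * this
    _ ≤ _ := by
        gcongr
        nlinarith [mul_nonneg (sq_nonneg (k : ℝ)) (sq_nonneg ‖streamDerivL hk v‖)]

end Transport

/-! ### Functions of time with values in `L^2(-1, 1)` -/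

section Curry

open Filter

theorem countable_index_of_orthonormal {ι E : Type*} [NormedAddCommGroup E] [InnerProductSpace ℂ E]
    [SecondCountableTopology E] {b : ι → E} (hb : Orthonormal ℂ b) : Countable ι := by
  have hsep : ∀ i j, i ≠ j → 1 ≤ dist (b i) (b j) := by
    intro i j hij
    rw [dist_eq_norm]
    have h1 : ‖b i - b j‖ ^ 2 = 2 := by
      have h := norm_sub_sq (𝕜 := ℂ) (b i) (b j)
      rw [hb.2 hij, hb.1 i, hb.1 j] at h
      rw [h]; norm_num
    nlinarith [norm_nonneg (b i - b j)]
  have hinj : Function.Injective b := hb.linearIndependent.injective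
  have hd : DiscreteTopology (range b) := by
    refine DiscreteTopology.of_forall_le_dist one_pos ?_
    rintro ⟨_, i, rfl⟩ ⟨_, j, rfl⟩ hij
    exact hsep i j fun h => hij (by rw [h])
  have hc : Countable (range b) := TopologicalSpace.separableSpace_iff_countable.1 inferInstance
  exact ((Equiv.ofInjective b hinj).countable_iff).2 hc

/-- Weakly measurable functions into a separable Hilbert space are strongly measurable. -/
theorem aestronglyMeasurable_of_inner {α E : Type*} [MeasurableSpace α] {μ : Measure α}
    [NormedAddCommGroup E] [InnerProductSpace ℂ E] [CompleteSpace E] [SecondCountableTopology E]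
    {c : α → E} (h : ∀ x, AEStronglyMeasurable (fun t => inner ℂ x (c t)) μ) :
    AEStronglyMeasurable c μ := by
  obtain ⟨w, b, -⟩ := exists_hilbertBasis ℂ E
  have : Countable w := countable_index_of_orthonormal b.orthonormal
  refine aestronglyMeasurable_of_tendsto_ae (u := atTop)
    (f := fun (s : Finset w) t => ∑ i ∈ s, b.repr (c t) i • b i) (fun s => ?_)
    (Eventually.of_forall fun t => b.hasSum_repr (c t))
  refine Finset.aestronglyMeasurable_fun_sum s fun i _ => ?_
  simp only [HilbertBasis.repr_apply_apply]
  exact (h (b i)).smul_const (b i)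

instance : SecondCountableTopology L2Y := by
  have : Fact ((2 : ENNReal) ≠ ⊤) := ⟨by norm_num⟩
  have : IsSeparable muY := by unfold muY; infer_instance
  exact Lp.SecondCountableTopology

open Classical in
/-- The section `G t` as an element of `L^2(-1, 1)`, or zero if it is not square integrable. -/
def curryL2 (G : ℝ → ℝ → ℂ) (t : ℝ) : L2Y := if h : MemLp (G t) 2 muY then h.toLp else 0

variable {G : ℝ → ℝ → ℂ}

theorem coeFn_curryL2 {t : ℝ} (h : MemLp (G t) 2 muY) : curryL2 G t =ᵐ[muY] G t := by
  rw [curryL2, dif_pos h]; exact h.coeFn_toLp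

theorem norm_sq_curryL2 {t : ℝ} (h : MemLp (G t) 2 muY) :
    ‖curryL2 G t‖ ^ 2 = ∫ y, ‖G t y‖ ^ 2 ∂muY := by
  rw [curryL2, dif_pos h, norm_sq_toLp]

theorem ae_memLp_section {μ : Measure ℝ} [SFinite μ]
    (h : MemLp (fun p : ℝ × ℝ => G p.1 p.2) 2 (μ.prod muY)) : ∀ᵐ t ∂μ, MemLp (G t) 2 muY := by
  have h1 := (memLp_two_iff_integrable_sq_norm h.aestronglyMeasurable).1 h
  filter_upwards [h.aestronglyMeasurable.prodMk_left, h1.prod_right_ae] with t ht ht'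
  exact (memLp_two_iff_integrable_sq_norm ht).2 ht'

theorem memLp_curryL2 {μ : Measure ℝ} [SFinite μ]
    (h : MemLp (fun p : ℝ × ℝ => G p.1 p.2) 2 (μ.prod muY)) : MemLp (curryL2 G) 2 μ := by
  have hae := ae_memLp_section h
  have hm : AEStronglyMeasurable (curryL2 G) μ := by
    refine aestronglyMeasurable_of_inner fun x => ?_
    have h1 : AEStronglyMeasurable (fun t => ∫ y, (starRingEnd ℂ) (x y) * G t y ∂muY) μ :=
      AEStronglyMeasurable.integral_prod_right'
        (f := fun p : ℝ × ℝ => (starRingEnd ℂ) (x p.2) * G p.1 p.2)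
        ((Complex.continuous_conj.comp_aestronglyMeasurable
          (Lp.aestronglyMeasurable x).comp_snd).mul h.aestronglyMeasurable)
    refine h1.congr ?_
    filter_upwards [hae] with t ht
    rw [L2.inner_def]
    refine integral_congr_ae ?_
    filter_upwards [coeFn_curryL2 ht] with y hy
    rw [hy, RCLike.inner_apply, mul_comm]
  refine (memLp_two_iff_integrable_sq_norm hm).2 ?_
  have h1 := (memLp_two_iff_integrable_sq_norm h.aestronglyMeasurable).1 h
  refine h1.integral_prod_left.congr ?_
  filter_upwards [hae] with t ht
  exact (norm_sq_curryL2 ht).symm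

theorem iUnion_Ioo_natCast : ⋃ n : ℕ, Ioo (0 : ℝ) n = Ioi 0 := by
  ext t
  simp only [mem_iUnion, mem_Ioo, mem_Ioi]
  constructor
  · rintro ⟨_, h, _⟩; exact h
  · intro h
    obtain ⟨n, hn⟩ := exists_nat_gt t
    exact ⟨n, h, hn⟩

theorem ae_muT_of_forall {p : ℝ → Prop}
    (h : ∀ T : ℝ, ∀ᵐ t ∂volume.restrict (Ioo 0 T), p t) : ∀ᵐ t ∂muT, p t := by
  rw [muT, ← iUnion_Ioo_natCast]
  exact (ae_restrict_iUnion_iff _ _).2 fun n => h n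

theorem lintegral_muT_le {f : ℝ → ENNReal} {b : ENNReal}
    (h : ∀ T : ℝ, 0 ≤ T → ∫⁻ t in Ioo 0 T, f t ≤ b) : ∫⁻ t, f t ∂muT ≤ b := by
  rw [muT, ← iUnion_Ioo_natCast, setLIntegral_iUnion_of_directed]
  · exact iSup_le fun n => h n (Nat.cast_nonneg n)
  · exact Monotone.directed_le fun m n hmn =>
      Ioo_subset_Ioo_right (by exact_mod_cast hmn)

theorem normSqY_eq_ofReal {g : ℝ → ℂ} (h : MemLp g 2 muY) :
    normSqY g = ENNReal.ofReal (∫ y, ‖g y‖ ^ 2 ∂muY) := by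
  rw [ofReal_integral_eq_lintegral_ofReal (h.integrable_norm_pow (by norm_num))
    (Eventually.of_forall fun y => by positivity), normSqY]
  refine lintegral_congr fun y => ?_
  rw [ENNReal.ofReal_pow (norm_nonneg _), ofReal_norm]

theorem normSqY_mono {f g : ℝ → ℂ} (h : ∀ᵐ y ∂muY, ‖f y‖ ≤ ‖g y‖) : normSqY f ≤ normSqY g := by
  refine lintegral_mono_ae ?_
  filter_upwards [h] with y hy
  exact pow_le_pow_left₀ zero_le (enorm_le_iff_norm_le.2 hy) 2

theorem normSqY_const_mul (c : ℂ) (g : ℝ → ℂ) :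
    normSqY (fun y => c * g y) = ENNReal.ofReal (‖c‖ ^ 2) * normSqY g := by
  rw [normSqY, normSqY, ← lintegral_const_mul' _ _ ENNReal.ofReal_ne_top]
  refine lintegral_congr fun y => ?_
  rw [enorm_mul, mul_pow, ENNReal.ofReal_pow (norm_nonneg _), ofReal_norm]

end Curry

/-! ### The weak formulation as an evolution equation -/

section Equation

open BoundedContinuousFunction

variable {k : ℤ} {U U₁ U₂ : ℝ →ᵇ ℝ}

theorem inner_eq_integral {f g : ℝ → ℂ} {x y : L2Y} (hx : x =ᵐ[muY] f) (hy : y =ᵐ[muY] g) :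
    inner ℂ x y = ∫ z, (starRingEnd ℂ) (f z) * g z ∂muY := by
  rw [L2.inner_def]
  refine integral_congr_ae ?_
  filter_upwards [hx, hy] with z h1 h2
  rw [h1, h2, RCLike.inner_apply, mul_comm]

/-- The quadratic form `-⟨Δ_k⁻¹ φ, v⟩` is the inner product of the velocities. -/
theorem inner_velocityL (hk : k ≠ 0) (φ v : consistentSpace k) :
    inner ℂ (velocityL hk φ) (velocityL hk v) = -inner ℂ (streamL hk φ) (v : L2Y) := by
  have hφ := sobolevTwoZero_of_mem hk φ
  have h := integral_mul_conj_eq (isPrimitiveOn_streamDeriv hk (integrable_coe (v : L2Y)))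
    (isPrimitiveOn_stream hk (integrable_coe (φ : L2Y))) hφ.left_zero hφ.right_zero
  have e : ((k : ℂ) ^ 2 • streamL hk v + (v : L2Y) : L2Y)
      =ᵐ[muY] fun y => (k : ℂ) ^ 2 * stream k (v : L2Y) y + (v : L2Y) y := by
    filter_upwards [Lp.coeFn_add ((k : ℂ) ^ 2 • streamL hk v) (v : L2Y),
      Lp.coeFn_smul ((k : ℂ) ^ 2) (streamL hk v), coeFn_streamL hk v] with y h1 h2 h3
    rw [h1, Pi.add_apply, h2, Pi.smul_apply, h3, smul_eq_mul]
  rw [← inner_eq_integral (coeFn_streamL hk φ) e,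
    ← inner_eq_integral (coeFn_streamDerivL hk φ) (coeFn_streamDerivL hk v), inner_add_right,
    inner_smul_right] at h
  rw [velocityL_apply, velocityL_apply, inner_toLp_pair, inner_smul_left, inner_smul_right,
    map_intCast]
  linear_combination h

/-- The identity `(U ψ' - U' ψ)' = U ψ'' - U'' ψ`, tested against the stream function of `φ`. -/
theorem inner_transport (hk : k ≠ 0) (hU : IsPrimitiveOn (-1) 1 U U₁)
    (hU₁ : IsPrimitiveOn (-1) 1 U₁ U₂) (φ v : consistentSpace k) :
    inner ℂ (streamL hk φ) (mulOp U (v : L2Y) + (k : ℂ) ^ 2 • mulOp U (streamL hk v)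
        - mulOp U₂ (streamL hk v))
      = -inner ℂ (streamDerivL hk φ) (mulOp U (streamDerivL hk v) - mulOp U₁ (streamL hk v)) := by
  have hφ := sobolevTwoZero_of_mem hk φ
  have h0 := isPrimitiveOn_stream hk (integrable_coe (v : L2Y))
  have h1 := isPrimitiveOn_streamDeriv hk (integrable_coe (v : L2Y))
  have h := integral_mul_conj_eq ((hU.real_mul h1).add ((hU₁.real_mul h0).const_mul (-1)))
    (isPrimitiveOn_stream hk (integrable_coe (φ : L2Y))) hφ.left_zero hφ.right_zero
  rw [inner_eq_integral (coeFn_streamL hk φ)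
    (g := fun y => (U₁ y : ℂ) * streamDeriv k (v : L2Y) y
      + (U y : ℂ) * ((k : ℂ) ^ 2 * stream k (v : L2Y) y + (v : L2Y) y)
      + -1 * ((U₂ y : ℂ) * stream k (v : L2Y) y + (U₁ y : ℂ) * streamDeriv k (v : L2Y) y)),
    h, inner_eq_integral (coeFn_streamDerivL hk φ)
    (g := fun y => (U y : ℂ) * streamDeriv k (v : L2Y) y
      + -1 * ((U₁ y : ℂ) * stream k (v : L2Y) y))]
  · filter_upwards [Lp.coeFn_sub (mulOp U (streamDerivL hk v)) (mulOp U₁ (streamL hk v)),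
      coeFn_mulOp U (streamDerivL hk v), coeFn_mulOp U₁ (streamL hk v),
      coeFn_streamL hk v, coeFn_streamDerivL hk v] with y a1 a2 a3 a4 a5
    rw [a1, Pi.sub_apply, a2, a3, a4, a5]
    ring
  · filter_upwards [Lp.coeFn_sub (mulOp U (v : L2Y) + (k : ℂ) ^ 2 • mulOp U (streamL hk v))
      (mulOp U₂ (streamL hk v)),
      Lp.coeFn_add (mulOp U (v : L2Y)) ((k : ℂ) ^ 2 • mulOp U (streamL hk v)),
      Lp.coeFn_smul ((k : ℂ) ^ 2) (mulOp U (streamL hk v)), coeFn_mulOp U (v : L2Y),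
      coeFn_mulOp U (streamL hk v), coeFn_mulOp U₂ (streamL hk v),
      coeFn_streamL hk v] with y a1 a2 a3 a4 a5 a6 a7
    rw [a1, Pi.sub_apply, a2, Pi.add_apply, a3, Pi.smul_apply, a4, a5, a6, a7, smul_eq_mul]
    ring

/-- The element of `H^2_0` against which the equation is tested: the conjugate of the stream function
of `φ`. -/
def testFamily (k : ℤ) (φ : ℝ → ℂ) (j : ℕ) (y : ℝ) : ℂ := (starRingEnd ℂ) (streamFamily k φ j y)

theorem sobolevTwoZero_testFamily (hk : k ≠ 0) (φ : consistentSpace k) :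
    SobolevTwoZero (testFamily k (φ : L2Y)) := by
  have h := sobolevTwoZero_of_mem hk φ
  refine ⟨⟨fun j hj y hy => ?_, ?_⟩, ?_, ?_, ?_, ?_⟩
  · interval_cases j
    · exact (h.isPrimitiveOn_zero.clm_comp (Complex.conjCLE : ℂ →L[ℝ] ℂ)).eq_add y hy
    · exact (h.isPrimitiveOn_one.clm_comp (Complex.conjCLE : ℂ →L[ℝ] ℂ)).eq_add y hy
  · exact h.sobolev.memLp.star
  · simp [testFamily, h.left_zero]
  · simp [testFamily, h.right_zero]
  · simp [testFamily, h.left_deriv_zero]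
  · simp [testFamily, h.right_deriv_zero]

theorem integral_mul_testFamily (hk : k ≠ 0) (φ v : consistentSpace k) {w : ℝ → ℂ}
    (hw : (v : L2Y) =ᵐ[muY] w) :
    ∫ y, w y * testFamily k (φ : L2Y) 0 y ∂muY
      = -inner ℂ (velocityL hk φ) (velocityL hk v) := by
  rw [inner_velocityL, neg_neg, inner_eq_integral (coeFn_streamL hk φ) hw]
  exact integral_congr_ae (Filter.Eventually.of_forall fun y => mul_comm _ _)

/-- The weak formulation at a fixed time, in terms of the velocity. -/
theorem integral_weak_eq (hk : k ≠ 0) (hU : IsPrimitiveOn (-1) 1 U U₁)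
    (hU₁ : IsPrimitiveOn (-1) 1 U₁ U₂) (ν : ℝ) (φ v : consistentSpace k) (G₁ G₂ : L2Y)
    {V V₂ : ℝ → ℝ} {w ψ g₁ g₂ : ℝ → ℂ} (hV : ∀ᵐ y ∂muY, V y = U y) (hV₂ : ∀ᵐ y ∂muY, V₂ y = U₂ y)
    (hw : (v : L2Y) =ᵐ[muY] w) (hψ : streamL hk v =ᵐ[muY] ψ) (h₁ : G₁ =ᵐ[muY] g₁)
    (h₂ : G₂ =ᵐ[muY] g₂) :
    ∫ y, ((-(Complex.I * k * (V y : ℂ) * w y) + Complex.I * k * (V₂ y : ℂ) * ψ y)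
            * testFamily k (φ : L2Y) 0 y
          + (ν : ℂ) * w y * (testFamily k (φ : L2Y) 2 y - (k : ℂ) ^ 2 * testFamily k (φ : L2Y) 0 y)
          + Complex.I * k * g₁ y * testFamily k (φ : L2Y) 0 y
          - g₂ y * testFamily k (φ : L2Y) 1 y) ∂muY
      = -(inner ℂ (velocityL hk φ)
          (transportL hk U U₁ v + WithLp.toLp 2 (G₂, (-Complex.I) • G₁)) - ν * inner ℂ φ v) := by
  set A : L2Y := (Complex.I * k) • (mulOp U₂ (streamL hk v) - mulOp U (v : L2Y) + G₁) with hA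
  have key : ∫ y, ((-(Complex.I * k * (V y : ℂ) * w y) + Complex.I * k * (V₂ y : ℂ) * ψ y)
            * testFamily k (φ : L2Y) 0 y
          + (ν : ℂ) * w y * (testFamily k (φ : L2Y) 2 y - (k : ℂ) ^ 2 * testFamily k (φ : L2Y) 0 y)
          + Complex.I * k * g₁ y * testFamily k (φ : L2Y) 0 y
          - g₂ y * testFamily k (φ : L2Y) 1 y) ∂muY
      = inner ℂ (streamL hk φ) A + ν * inner ℂ (φ : L2Y) (v : L2Y)
        - inner ℂ (streamDerivL hk φ) G₂ := by
    rw [L2.inner_def, L2.inner_def, L2.inner_def, ← integral_const_mul,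
      ← integral_add (L2.integrable_inner _ _) ((L2.integrable_inner _ _).const_mul _),
      ← integral_sub ((L2.integrable_inner _ _).add ((L2.integrable_inner _ _).const_mul _))
        (L2.integrable_inner _ _)]
    refine integral_congr_ae ?_
    filter_upwards [hV, hV₂, hw, hψ, h₁, h₂, coeFn_streamL hk φ, coeFn_streamDerivL hk φ,
      Lp.coeFn_smul (Complex.I * (k : ℂ)) (mulOp U₂ (streamL hk v) - mulOp U (v : L2Y) + G₁),
      Lp.coeFn_add (mulOp U₂ (streamL hk v) - mulOp U (v : L2Y)) G₁,
      Lp.coeFn_sub (mulOp U₂ (streamL hk v)) (mulOp U (v : L2Y)),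
      coeFn_mulOp U₂ (streamL hk v), coeFn_mulOp U (v : L2Y)]
      with y a1 a2 a3 a4 a5 a6 a7 a8 a9 a10 a11 a12 a13
    have b : testFamily k (φ : L2Y) 2 y - (k : ℂ) ^ 2 * testFamily k (φ : L2Y) 0 y
        = (starRingEnd ℂ) ((φ : L2Y) y) := by
      rw [← streamFamily_laplace (k := k) (φ : L2Y) y]
      simp [testFamily]
    rw [b, hA, a9, Pi.smul_apply, a10, Pi.add_apply, a11, Pi.sub_apply, a12, a13, a7, a8, a1, a2, a3,
      a4, a5, a6]
    simp only [RCLike.inner_apply, smul_eq_mul, testFamily, streamFamily]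
    ring
  have ht := inner_transport hk hU hU₁ φ v
  have e : inner ℂ φ v = inner ℂ (φ : L2Y) (v : L2Y) := rfl
  rw [key, e, hA, velocityL_apply, inner_add_right, transportL_apply, inner_toLp_pair,
    inner_toLp_pair]
  simp only [inner_smul_left, inner_smul_right, inner_add_right, inner_sub_right, map_intCast] at ht ⊢
  linear_combination (-(Complex.I * k)) * ht

end Equation

/-! ### The background flow in the high-frequency regime -/

section Flow

open BoundedContinuousFunction

/-- The coordinate `y`, extended by constants outside `[-1, 1]` so as to be bounded. -/
def coordB : ℝ →ᵇ ℝ :=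
  .ofNormedAddCommGroup (fun y => max (-1) (min y 1)) (by fun_prop) 1 fun y =>
    abs_le.2 ⟨le_max_left _ _, max_le (by norm_num) (min_le_right _ _)⟩

theorem coordB_apply {y : ℝ} (hy : y ∈ Icc (-1 : ℝ) 1) : coordB y = y := by
  simp [coordB, min_eq_left hy.2, max_eq_right hy.1]

variable {B ν : ℝ} {Uin : ℝ → ℝ} {S₀ S₁ S₂ : ℝ → ℝ →ᵇ ℝ}

theorem IsHeatProfile.deriv_eq (h : IsHeatProfile B ν Uin S₀ S₁ S₂) {t : ℝ} (ht : 0 ≤ t) :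
    deriv (heatShear ν Uin t) = fun y => 1 + S₁ t y := by
  funext y
  rw [show heatShear ν Uin t = fun y => y + S₀ t y from funext (h.eq t ht)]
  exact ((hasDerivAt_id y).add (h.hasDerivAt_zero t y)).deriv

theorem IsHeatProfile.deriv_deriv_eq (h : IsHeatProfile B ν Uin S₀ S₁ S₂) {t : ℝ} (ht : 0 ≤ t)
    (y : ℝ) : deriv (deriv (heatShear ν Uin t)) y = S₂ t y := by
  rw [h.deriv_eq ht]
  exact ((h.hasDerivAt_one t y).const_add 1).deriv

theorem IsHeatProfile.isPrimitiveOn_zero (h : IsHeatProfile B ν Uin S₀ S₁ S₂) (t : ℝ) :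
    IsPrimitiveOn (-1) 1 (coordB + S₀ t : ℝ →ᵇ ℝ) (const ℝ 1 + S₁ t : ℝ →ᵇ ℝ) := by
  have h1 : IsPrimitiveOn (-1) 1 (fun y => y + S₀ t y) (fun y => 1 + S₁ t y) :=
    .of_hasDerivAt (fun y => (hasDerivAt_id y).add (h.hasDerivAt_zero t y)) (by fun_prop)
  exact h1.congr (by norm_num) (fun y hy => by simp [coordB_apply hy]) fun y _ => by simp

theorem IsHeatProfile.isPrimitiveOn_one (h : IsHeatProfile B ν Uin S₀ S₁ S₂) (t : ℝ) :
    IsPrimitiveOn (-1) 1 (const ℝ 1 + S₁ t : ℝ →ᵇ ℝ) (S₂ t) :=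
  .of_hasDerivAt (fun y => (h.hasDerivAt_one t y).const_add 1) (S₂ t).continuous

theorem HighFrequency.ae_le {k : ℤ} (hf : HighFrequency ν k (heatShear ν Uin)) (hν : 0 < ν)
    (h : IsHeatProfile B ν Uin S₀ S₁ S₂) :
    ∀ᵐ t ∂muT, ∀ᵐ y ∂muY, |(const ℝ 1 + S₁ t : ℝ →ᵇ ℝ) y| ≤ 2 * (ν * (k : ℝ) ^ 2) := by
  have hm : 0 ≤ ν * (k : ℝ) ^ 2 := by positivity
  have h1 : eLpNorm (fun p : ℝ × ℝ => deriv (heatShear ν Uin p.1) p.2) ⊤ (muT.prod muY)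
      ≤ ENNReal.ofReal (2 * (ν * (k : ℝ) ^ 2)) := by
    rw [HighFrequency, sq_abs] at hf
    calc _ = 2 * (2⁻¹ * eLpNorm (fun p : ℝ × ℝ => deriv (heatShear ν Uin p.1) p.2) ⊤
          (muT.prod muY)) := by
          rw [← mul_assoc, ENNReal.mul_inv_cancel (by norm_num) (by norm_num), one_mul]
      _ ≤ 2 * ENNReal.ofReal (ν * (k : ℝ) ^ 2) := by gcongr
      _ = _ := by rw [ENNReal.ofReal_mul zero_le_two]; simp
  have h2 : ∀ᵐ p ∂muT.prod muY, ‖deriv (heatShear ν Uin p.1) p.2‖ₑ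
      ≤ ENNReal.ofReal (2 * (ν * (k : ℝ) ^ 2)) := by
    rw [eLpNorm_exponent_top] at h1
    filter_upwards [ae_le_eLpNormEssSup (μ := muT.prod muY)
      (f := fun p : ℝ × ℝ => deriv (heatShear ν Uin p.1) p.2)] with p hp using hp.trans h1
  have : SFinite muY := by unfold muY; infer_instance
  filter_upwards [Measure.ae_ae_of_ae_prod h2, ae_restrict_mem measurableSet_Ioi] with t ht ht0
  filter_upwards [ht] with y hy
  rw [h.deriv_eq (le_of_lt ht0), ← ofReal_norm,
    ENNReal.ofReal_le_ofReal_iff (by positivity)] at hy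
  simpa using hy

/-- Since `U(±1) = ±1`, the slope of `U` exceeds `1` somewhere. -/
theorem HighFrequency.one_le {k : ℤ} (hf : HighFrequency ν k (heatShear ν Uin)) (hν : 0 < ν)
    (h : IsHeatProfile B ν Uin S₀ S₁ S₂) : 1 ≤ 2 * (ν * (k : ℝ) ^ 2) := by
  have hne : muT ≠ 0 := by
    intro h0
    have : muT (Ioi 0) = 0 := by rw [h0]; rfl
    rw [muT, Measure.restrict_apply_self] at this
    simp at this
  have : (ae muT).NeBot := ae_neBot.2 hne
  obtain ⟨t, ht⟩ := (hf.ae_le hν h).exists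
  have h1 := (h.isPrimitiveOn_zero t).eq_add 1 ⟨by norm_num, le_rfl⟩
  have h2 : ‖∫ y in (-1 : ℝ)..1, (const ℝ 1 + S₁ t : ℝ →ᵇ ℝ) y‖
      ≤ 2 * (ν * (k : ℝ) ^ 2) * |1 - (-1)| := by
    refine intervalIntegral.norm_integral_le_of_norm_le_const_ae ?_
    rw [uIoc_of_le (by norm_num)]
    refine (ae_restrict_iff' measurableSet_Ioc).1 ?_
    rw [← restrict_Ioo_eq_restrict_Ioc]
    exact ht
  have c1 : coordB 1 = 1 := coordB_apply ⟨by norm_num, le_rfl⟩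
  have c2 : coordB (-1) = -1 := coordB_apply ⟨le_rfl, by norm_num⟩
  simp only [BoundedContinuousFunction.coe_add, Pi.add_apply, h.left_zero, h.right_zero, c1, c2] at h1 h2
  rw [show (∫ y in (-1 : ℝ)..1, ((const ℝ 1 : ℝ →ᵇ ℝ) y + S₁ t y)) = 2 by linarith] at h2
  norm_num at h2
  linarith

end Flow

/-! ### Solutions of the linearized problem -/

section Solution

open BoundedContinuousFunction

/-- The vorticity at time `t`, as an element of the space of consistent functions. -/
def vorticityL2 (k : ℤ) (ω : ℝ → ℝ → ℂ) (t : ℝ) : consistentSpace k :=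
  (consistentSpace k).orthogonalProjectionOnto (curryL2 ω t)

/-- The force `(f₂, -i f₁)`: its pairing with `(φ', k φ)` is that of `i k f₁ + ∂_y f₂` with `-φ`. -/
def forceL2 (f₁ f₂ : ℝ → ℝ → ℂ) (t : ℝ) : VelocityY :=
  WithLp.toLp 2 (curryL2 f₂ t, (-Complex.I) • curryL2 f₁ t)

variable {k : ℤ}

theorem coeFn_vorticityL2 {ω : ℝ → ℝ → ℂ} {t : ℝ} (h : MemLp (ω t) 2 muY)
    (hc : Consistent k (ω t)) : (vorticityL2 k ω t : L2Y) =ᵐ[muY] ω t := by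
  have h1 : (vorticityL2 k ω t : L2Y) = curryL2 ω t :=
    (consistentSpace k).starProjection_eq_self_iff.2
      (mem_consistentSpace.2 (hc.congr (coeFn_curryL2 h).symm))
  rw [h1]
  exact coeFn_curryL2 h

theorem norm_sq_vorticityL2 {ω : ℝ → ℝ → ℂ} {t : ℝ} (h : MemLp (ω t) 2 muY)
    (hc : Consistent k (ω t)) : ‖vorticityL2 k ω t‖ ^ 2 = ∫ y, ‖ω t y‖ ^ 2 ∂muY := by
  rw [← Submodule.norm_coe, norm_sq_L2Y]
  refine integral_congr_ae ?_
  filter_upwards [coeFn_vorticityL2 h hc] with y hy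
  rw [hy]

theorem norm_sq_forceL2 (f₁ f₂ : ℝ → ℝ → ℂ) (t : ℝ) :
    ‖forceL2 f₁ f₂ t‖ ^ 2 = ‖curryL2 f₁ t‖ ^ 2 + ‖curryL2 f₂ t‖ ^ 2 := by
  rw [forceL2, norm_sq_toLp_pair, norm_smul, norm_neg, Complex.norm_I, one_mul, add_comm]

theorem memLp_vorticityL2 {μ : Measure ℝ} [SFinite μ] {ω : ℝ → ℝ → ℂ}
    (h : MemLp (fun p : ℝ × ℝ => ω p.1 p.2) 2 (μ.prod muY)) : MemLp (vorticityL2 k ω) 2 μ :=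
  ContinuousLinearMap.comp_memLp' _ (memLp_curryL2 h)

theorem memLp_forceL2 {μ : Measure ℝ} [SFinite μ] {f₁ f₂ : ℝ → ℝ → ℂ}
    (h₁ : MemLp (fun p : ℝ × ℝ => f₁ p.1 p.2) 2 (μ.prod muY))
    (h₂ : MemLp (fun p : ℝ × ℝ => f₂ p.1 p.2) 2 (μ.prod muY)) : MemLp (forceL2 f₁ f₂) 2 μ := by
  have h2 := ContinuousLinearMap.comp_memLp' (pairL (ContinuousLinearMap.id ℂ L2Y) 0)
    (memLp_curryL2 h₂)
  have h1 := ContinuousLinearMap.comp_memLp'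
    (pairL 0 ((-Complex.I) • ContinuousLinearMap.id ℂ L2Y)) (memLp_curryL2 h₁)
  refine (h2.add h1).ae_eq (Filter.Eventually.of_forall fun t => ?_)
  simp [forceL2, pairL_apply, ← WithLp.toLp_add]

variable {B ν : ℝ} {Uin : ℝ → ℝ} {S₀ S₁ S₂ : ℝ → ℝ →ᵇ ℝ} {f₁ f₂ : ℝ → ℝ → ℂ} {ωin : ℝ → ℂ}
  {ω ψ : ℝ → ℝ → ℂ}

theorem IsSolution.ae_memLp (hs : IsSolution ν k (heatShear ν Uin) f₁ f₂ ωin ω ψ) :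
    ∀ᵐ t ∂muT, MemLp (ω t) 2 muY :=
  ae_muT_of_forall fun T => ae_memLp_section (hs.vorticity_memLp T)

/-- Each test function has its own null set of times; `IsSolution.dissipativeEvolution` removes them
by testing with a countable dense family. -/
theorem IsSolution.equation_inner (hs : IsSolution ν k (heatShear ν Uin) f₁ f₂ ωin ω ψ)
    (hk : k ≠ 0) (h : IsHeatProfile B ν Uin S₀ S₁ S₂) (hωin : MemLp ωin 2 muY)
    (hf₁ : ∀ T : ℝ, MemLp (fun p : ℝ × ℝ => f₁ p.1 p.2) 2 ((volume.restrict (Ioo 0 T)).prod muY))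
    (hf₂ : ∀ T : ℝ, MemLp (fun p : ℝ × ℝ => f₂ p.1 p.2) 2 ((volume.restrict (Ioo 0 T)).prod muY))
    (φ : consistentSpace k) :
    ∀ᵐ t ∂muT, inner ℂ φ (gram (velocityL hk) (vorticityL2 k ω t))
      = inner ℂ φ (gram (velocityL hk) (vorticityL2 k (fun _ => ωin) 0)
        + ∫ s in (0 : ℝ)..t, evolutionRhs (velocityL hk)
          (fun s => transportL hk (coordB + S₀ s) (const ℝ 1 + S₁ s)) ν (vorticityL2 k ω)
          (forceL2 f₁ f₂) s) := by
  have hrhs : ∀ᵐ s ∂muT, (∫ y,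
        ((-(Complex.I * k * (heatShear ν Uin s y : ℂ) * ω s y)
            + Complex.I * k * ((deriv (deriv (heatShear ν Uin s)) y : ℝ) : ℂ) * ψ s y)
              * testFamily k (φ : L2Y) 0 y
          + (ν : ℂ) * ω s y
            * (testFamily k (φ : L2Y) 2 y - (k : ℂ) ^ 2 * testFamily k (φ : L2Y) 0 y)
          + Complex.I * k * f₁ s y * testFamily k (φ : L2Y) 0 y
          - f₂ s y * testFamily k (φ : L2Y) 1 y) ∂muY)
      = -inner ℂ φ (evolutionRhs (velocityL hk)
          (fun s => transportL hk (coordB + S₀ s) (const ℝ 1 + S₁ s)) ν (vorticityL2 k ω)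
          (forceL2 f₁ f₂) s) := by
    filter_upwards [hs.ae_memLp, hs.consistent, hs.stream,
      ae_muT_of_forall fun T => ae_memLp_section (hf₁ T),
      ae_muT_of_forall fun T => ae_memLp_section (hf₂ T), ae_restrict_mem measurableSet_Ioi]
      with s m1 m2 m3 m4 m5 s0
    have hw := coeFn_vorticityL2 m1 m2
    obtain ⟨Ψ, rfl', hΨ, hΨ2⟩ := m3
    have hψ : streamL hk (vorticityL2 k ω s) =ᵐ[muY] ψ s := by
      filter_upwards [coeFn_streamL hk (vorticityL2 k ω s), ae_muY_mem] with y h1 hy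
      rw [h1, (stream_congr hw hy).1, ← (hΨ.eq_stream hk hΨ2 hy).1, rfl']
    rw [integral_weak_eq hk (h.isPrimitiveOn_zero s) (h.isPrimitiveOn_one s) ν φ
      (vorticityL2 k ω s) (curryL2 f₁ s) (curryL2 f₂ s) ?_ ?_ hw hψ (coeFn_curryL2 m4)
      (coeFn_curryL2 m5)]
    · rw [evolutionRhs, inner_sub_right, ContinuousLinearMap.adjoint_inner_right, inner_smul_right,
        forceL2]
    · filter_upwards [ae_muY_mem] with y hy
      rw [h.eq s (le_of_lt s0)]
      simp [coordB_apply hy]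
    · exact Filter.Eventually.of_forall fun y => h.deriv_deriv_eq (le_of_lt s0) y
  filter_upwards [hs.equation _ (sobolevTwoZero_testFamily hk φ), hs.ae_memLp, hs.consistent,
    ae_restrict_mem measurableSet_Ioi] with t ht m1 m2 t0
  have t0' : 0 ≤ t := le_of_lt t0
  rw [integral_mul_testFamily hk φ (vorticityL2 k ω t) (coeFn_vorticityL2 m1 m2),
    integral_mul_testFamily hk φ (vorticityL2 k (fun _ => ωin) 0)
      (coeFn_vorticityL2 (ω := fun _ => ωin) hωin hs.consistent_init),
    intervalIntegral.integral_of_le t0', integral_Ioc_eq_integral_Ioo,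
    integral_congr_ae (ae_restrict_Ioo_of_ae_muT hrhs), integral_neg,
    ← integral_Ioc_eq_integral_Ioo, ← intervalIntegral.integral_of_le t0'] at ht
  have hN : Continuous fun s => transportL hk (coordB + S₀ s) (const ℝ 1 + S₁ s) :=
    continuous_transportL hk (continuous_const.add h.continuous_zero)
      (continuous_const.add h.continuous_one)
  have hint := ((innerSL ℂ φ).restrictScalars ℝ).intervalIntegral_comp_comm
    (intervalIntegrable_evolutionRhs (M := velocityL hk) (ν := ν) t0' hN
      (memLp_vorticityL2 (k := k) (hs.vorticity_memLp t)) (memLp_forceL2 (hf₁ t) (hf₂ t)))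
  simp only [ContinuousLinearMap.coe_restrictScalars', innerSL_apply_apply] at hint
  rw [inner_add_right, inner_gram_right, inner_gram_right, ← hint]
  linear_combination -ht

/-- A weak solution is an evolution dissipated at the rate `ν k²`, with `M` the velocity operator. -/
theorem IsSolution.dissipativeEvolution (hs : IsSolution ν k (heatShear ν Uin) f₁ f₂ ωin ω ψ)
    (hν : 0 < ν) (hk : k ≠ 0) (hf : HighFrequency ν k (heatShear ν Uin))
    (h : IsHeatProfile B ν Uin S₀ S₁ S₂) (hωin : MemLp ωin 2 muY)
    (hf₁ : ∀ T : ℝ, MemLp (fun p : ℝ × ℝ => f₁ p.1 p.2) 2 ((volume.restrict (Ioo 0 T)).prod muY))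
    (hf₂ : ∀ T : ℝ, MemLp (fun p : ℝ × ℝ => f₂ p.1 p.2) 2
      ((volume.restrict (Ioo 0 T)).prod muY)) :
    DissipativeEvolution (velocityL hk)
      (fun s => driftL hk (coordB + S₀ s) (const ℝ 1 + S₁ s) (S₂ s))
      (fun s => transportL hk (coordB + S₀ s) (const ℝ 1 + S₁ s)) ν (((k : ℝ) ^ 2)⁻¹) (4 + 2 * B) 16
      (vorticityL2 k (fun _ => ωin) 0) (vorticityL2 k ω) (forceL2 f₁ f₂) := by
  have c0 : Continuous fun s => coordB + S₀ s := continuous_const.add h.continuous_zero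
  have c1 : Continuous fun s => const ℝ 1 + S₁ s := continuous_const.add h.continuous_one
  have hk2 := one_le_sq_of_ne_zero hk
  have hm := hf.ae_le hν h
  have hm1 := hf.one_le hν h
  refine ⟨hν, by positivity, velocityL_injective hk, norm_sq_velocityL_le hk,
    continuous_driftL hk c0 c1 h.continuous_two, continuous_transportL hk c0 c1, ?_, ?_, ?_,
    fun T => memLp_vorticityL2 (hs.vorticity_memLp T), fun T => memLp_forceL2 (hf₁ T) (hf₂ T), ?_⟩
  · filter_upwards [hm] with s hs v using transport_le hk hs hν v
  · filter_upwards [hm] with s hs v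
    rw [div_inv_eq_mul]
    exact drift_skew_le hk (h.isPrimitiveOn_zero s) (h.isPrimitiveOn_one s) hs hm1
      (h.norm_two_le s) v
  · filter_upwards [hm] with s hs v
    rw [div_inv_eq_mul]
    exact transport_error_le hk (h.isPrimitiveOn_zero s) (h.isPrimitiveOn_one s) hν hs v
  · have hall := ae_all_iff.2 fun n => hs.equation_inner hk h hωin hf₁ hf₂
      (TopologicalSpace.denseSeq (consistentSpace k) n)
    filter_upwards [hall] with t ht
    refine ext_inner_left ℂ fun φ => ?_
    exact congrFun ((TopologicalSpace.denseRange_denseSeq (consistentSpace k)).equalizer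
      (continuous_id.inner continuous_const) (continuous_id.inner continuous_const) (funext ht)) φ

end Solution

/-! ### Bounds for the norms of the statement -/

section Norms

theorem DissipativeEvolution.exp_mul_integral_le {V W : Type*} [NormedAddCommGroup V]
    [InnerProductSpace ℂ V] [CompleteSpace V] [NormedAddCommGroup W] [InnerProductSpace ℂ W]
    [CompleteSpace W] {M : V →L[ℂ] W} {X : ℝ → V →L[ℂ] V} {N : ℝ → V →L[ℂ] W}
    {ν κ C₁ C₂ : ℝ} {u₀ : V} {u : ℝ → V} {F : ℝ → W}
    (h : DissipativeEvolution M X N ν κ C₁ C₂ u₀ u F) {σ : ℝ} (hσ0 : 0 ≤ σ)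
    (hσ : σ * κ ≤ ν / 16) {T : ℝ} (hT : 0 ≤ T) :
    ν / κ * ∫ s in Ioo 0 T, Real.exp (2 * σ * s) * ‖u s‖ ^ 2 ≤
      32 * (‖u₀‖ ^ 2 + ν⁻¹ * ∫ s in Ioo 0 T, Real.exp (2 * σ * s) * ‖F s‖ ^ 2) := by
  have hν := h.ν_pos
  have hκ := h.κ_pos
  have h1 := mul_le_mul_of_nonneg_left (h.integral_le hσ0 hσ hT) (by positivity : 0 ≤ 4 / κ)
  calc _ = 4 / κ * (ν / 4 * ∫ s in Ioo 0 T, Real.exp (2 * σ * s) * ‖u s‖ ^ 2) := by field_simp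
    _ ≤ _ := h1
    _ = 4 * ‖u₀‖ ^ 2 + 32 * (ν⁻¹ * ∫ s in Ioo 0 T, Real.exp (2 * σ * s) * ‖F s‖ ^ 2) := by
        field_simp; ring
    _ ≤ _ := by nlinarith [sq_nonneg ‖u₀‖]

theorem DissipativeEvolution.exp_mul_norm_sq_le {V W : Type*} [NormedAddCommGroup V]
    [InnerProductSpace ℂ V] [CompleteSpace V] [NormedAddCommGroup W] [InnerProductSpace ℂ W]
    [CompleteSpace W] {M : V →L[ℂ] W} {X : ℝ → V →L[ℂ] V} {N : ℝ → V →L[ℂ] W}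
    {ν κ C₁ C₂ : ℝ} {u₀ : V} {u : ℝ → V} {F : ℝ → W}
    (h : DissipativeEvolution M X N ν κ C₁ C₂ u₀ u F) {σ : ℝ} (hσ0 : 0 ≤ σ)
    (hσ : σ * κ ≤ ν / 16) (hC₁ : 0 ≤ C₁) (hC₂ : 0 ≤ C₂) :
    ∀ᵐ t ∂muT, Real.exp (2 * σ * t) * ‖u t‖ ^ 2 ≤ (32 * (1 + 2 * C₁ + 2 * C₂) + 2) *
      (‖u₀‖ ^ 2 + ν⁻¹ * ∫ s in Ioo 0 t, Real.exp (2 * σ * s) * ‖F s‖ ^ 2) := by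
  have hν := h.ν_pos
  have hκ := h.κ_pos
  have hσ' : 2 * σ ≤ 1 * (ν / κ) := by
    rw [one_mul, le_div_iff₀ hκ]; linarith
  filter_upwards [h.norm_sq_le hσ0 hC₁, ae_restrict_mem measurableSet_Ioi] with t ht t0
  have h1 := h.exp_mul_integral_le hσ0 hσ (le_of_lt t0)
  have hI : 0 ≤ ∫ s in Ioo 0 t, Real.exp (2 * σ * s) * ‖u s‖ ^ 2 :=
    integral_nonneg fun s => by positivity
  have hJ : 0 ≤ ν⁻¹ * ∫ s in Ioo 0 t, Real.exp (2 * σ * s) * ‖F s‖ ^ 2 :=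
    mul_nonneg (by positivity) (integral_nonneg fun s => by positivity)
  generalize (∫ s in Ioo 0 t, Real.exp (2 * σ * s) * ‖u s‖ ^ 2) = I at *
  have e : 2 / ν * ∫ s in Ioo 0 t, Real.exp (2 * σ * s) * ‖F s‖ ^ 2
      = 2 * (ν⁻¹ * ∫ s in Ioo 0 t, Real.exp (2 * σ * s) * ‖F s‖ ^ 2) := by ring
  rw [e] at ht
  generalize ν⁻¹ * (∫ s in Ioo 0 t, Real.exp (2 * σ * s) * ‖F s‖ ^ 2) = J at *
  refine ht.trans ?_
  calc _ ≤ ‖u₀‖ ^ 2 + ((1 * (ν / κ) + 2 * C₁ * (ν / κ) + 2 * C₂ * (ν / κ)) * I + 2 * J) := by gcongr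
    _ = ‖u₀‖ ^ 2 + ((1 + 2 * C₁ + 2 * C₂) * (ν / κ * I) + 2 * J) := by ring
    _ ≤ ‖u₀‖ ^ 2 + ((1 + 2 * C₁ + 2 * C₂) * (32 * (‖u₀‖ ^ 2 + J)) + 2 * J) := by gcongr
    _ ≤ _ := by nlinarith [sq_nonneg ‖u₀‖]

variable {ν : ℝ} {k : ℤ}

/-- `(ν k²)^p ≤ 2 ν k²` for `0 ≤ p ≤ 1`. -/
theorem rpow_mul_abs_rpow_le (hν : 0 < ν) (h : 1 ≤ 2 * (ν * (k : ℝ) ^ 2)) {p : ℝ} (hp : 0 ≤ p)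
    (hp1 : p ≤ 1) : ν ^ p * |(k : ℝ)| ^ (2 * p) ≤ 2 * (ν * (k : ℝ) ^ 2) := by
  have e : |(k : ℝ)| ^ (2 * p) = ((k : ℝ) ^ 2) ^ p := by
    rw [Real.rpow_mul (abs_nonneg _), Real.rpow_two, sq_abs]
  rw [e, ← Real.mul_rpow hν.le (sq_nonneg _)]
  calc (ν * (k : ℝ) ^ 2) ^ p ≤ (2 * (ν * (k : ℝ) ^ 2)) ^ p := by
        refine Real.rpow_le_rpow (by positivity) ?_ hp
        nlinarith [mul_nonneg hν.le (sq_nonneg (k : ℝ))]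
    _ ≤ _ := Real.rpow_le_self_of_one_le h hp1

theorem rpow_le_of_highFrequency (hν : 0 < ν) (hk : k ≠ 0) (h : 1 ≤ 2 * (ν * (k : ℝ) ^ 2)) :
    ν ^ (1 / 3 : ℝ) ≤ 2 * (ν * (k : ℝ) ^ 2) := by
  refine le_trans ?_ (rpow_mul_abs_rpow_le hν h (p := 1 / 3) (by norm_num) (by norm_num))
  refine le_mul_of_one_le_right (by positivity) (Real.one_le_rpow ?_ (by norm_num))
  exact_mod_cast Int.one_le_abs hk

/-- Where no solution of the Dirichlet problem exists, `dirichletInv` is zero and the bound is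
trivial; so existence of the solution is not needed. -/
theorem normSqY_dirichletInv_le {w : ℝ → ℂ} (hw : MemLp w 2 muY) :
    ENNReal.ofReal (|(k : ℝ)| ^ 2) * (normSqY (fun y => Complex.I * k * dirichletInv k w y)
      + normSqY (deriv (dirichletInv k w))) ≤ normSqY w := by
  by_cases h : ∃ φ, IsDirichletSolution k w φ
  · obtain ⟨Φ, h0, hS, hl, hr, hΔ⟩ : IsDirichletSolution k w (dirichletInv k w) := by
      rw [dirichletInv, dif_pos h]; exact h.choose_spec
    have hp : IsPrimitiveOn (-1) 1 (Φ 0) (Φ 1) := hS.isPrimitiveOn (by norm_num)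
    have hc0 := hp.continuousOn
    have hc1 := (hS.isPrimitiveOn (j := 1) (by norm_num)).continuousOn
    have m0 := memLp_of_continuousOn hc0
    have m1 := memLp_of_continuousOn hc1
    have hd : deriv (Φ 0) =ᵐ[muY] Φ 1 := by
      filter_upwards [ae_restrict_mem measurableSet_Ioo] with y hy
      have hi : IntervalIntegrable (Φ 1) volume (-1) y :=
        hp.integrable.mono_set (by
          rw [uIcc_of_le hy.1.le, uIcc_of_le (by norm_num)]; exact Icc_subset_Icc_right hy.2.le)
      have hn : Icc (-1 : ℝ) 1 ∈ nhds y := Icc_mem_nhds hy.1 hy.2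
      have h1 := (intervalIntegral.integral_hasDerivAt_right hi
        ((hc1.mono Ioo_subset_Icc_self).stronglyMeasurableAtFilter isOpen_Ioo y hy)
        (hc1.continuousAt hn)).const_add (Φ 0 (-1))
      refine (h1.congr_of_eventuallyEq ?_).deriv
      filter_upwards [hn] with z hz using hp.eq_add z hz
    have e1 : normSqY (deriv (Φ 0)) = normSqY (Φ 1) := by
      refine lintegral_congr_ae ?_
      filter_upwards [hd] with y hy
      rw [hy]
    rw [← h0, normSqY_const_mul, e1, normSqY_eq_ofReal m0, normSqY_eq_ofReal m1,
      normSqY_eq_ofReal hw, ← ENNReal.ofReal_mul (by positivity), ← ENNReal.ofReal_add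
        (mul_nonneg (by positivity) (integral_nonneg fun y => by positivity))
        (integral_nonneg fun y => by positivity), ← ENNReal.ofReal_mul (by positivity)]
    refine ENNReal.ofReal_le_ofReal ?_
    have hE := stream_energy_le hS hl hr hΔ
    rw [norm_mul, Complex.norm_I, one_mul, Complex.norm_intCast, sq_abs]
    have : 0 ≤ (k : ℝ) ^ 2 * ∫ y, ‖Φ 1 y‖ ^ 2 ∂muY :=
      mul_nonneg (sq_nonneg _) (integral_nonneg fun y => by positivity)
    nlinarith
  · rw [dirichletInv, dif_neg h]
    have e : deriv (0 : ℝ → ℂ) = 0 := by funext y; simp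
    rw [e]
    simp [normSqY]

/-- In the high-frequency regime `ν k² ≥ 1/2` the norm of `𝒵` is controlled by the one of `L^2`. -/
theorem normSqZ_le (hν : 0 < ν) (h : 1 ≤ 2 * (ν * (k : ℝ) ^ 2)) {w : ℝ → ℂ} (hw : MemLp w 2 muY) :
    normSqZ ν k w ≤ ENNReal.ofReal (6 * (ν * (k : ℝ) ^ 2)) * normSqY w := by
  have e3 := rpow_mul_abs_rpow_le hν h (p := 1 / 3) (by norm_num) (by norm_num)
  have e2 := rpow_mul_abs_rpow_le hν h (p := 1 / 2) (by norm_num) (by norm_num)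
  rw [show (2 : ℝ) * (1 / 3) = 2 / 3 by norm_num] at e3
  rw [show (2 : ℝ) * (1 / 2) = 1 by norm_num, Real.rpow_one] at e2
  have a1 : normSqY (fun y => (Real.sqrt (rho ν k y) : ℂ) * w y) ≤ normSqY w := by
    refine normSqY_mono (Filter.Eventually.of_forall fun y => ?_)
    rw [norm_mul, Complex.norm_real, Real.norm_of_nonneg (Real.sqrt_nonneg _)]
    exact mul_le_of_le_one_left (norm_nonneg _) (Real.sqrt_le_one.2 (min_le_right _ _))
  have a2 := normSqY_dirichletInv_le (k := k) hw
  calc normSqZ ν k w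
      ≤ ENNReal.ofReal (2 * (ν * (k : ℝ) ^ 2)) * normSqY w
        + ENNReal.ofReal (2 * (ν * (k : ℝ) ^ 2)) * normSqY w
        + ENNReal.ofReal (2 * (ν * (k : ℝ) ^ 2)) * normSqY w := by
        refine add_le_add (add_le_add (mul_le_mul' (ENNReal.ofReal_le_ofReal e3) a1) ?_)
          (mul_le_mul' (ENNReal.ofReal_le_ofReal e2) le_rfl)
        exact a2.trans (le_mul_of_one_le_left zero_le (ENNReal.one_le_ofReal.2 h))
    _ = _ := by
        have : 0 ≤ 2 * (ν * (k : ℝ) ^ 2) := by positivity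
        rw [← add_mul, ← add_mul, ← ENNReal.ofReal_add this this,
          ← ENNReal.ofReal_add (by positivity) this]
        congr 2; ring

theorem norm_timeWeight_sq (ζ t : ℝ) :
    ‖timeWeight ζ ν t‖ ^ 2 = Real.exp (2 * (ζ * ν ^ (1 / 3 : ℝ)) * t) := by
  rw [timeWeight, Complex.norm_real, Real.norm_of_nonneg (Real.exp_pos _).le, ← Real.exp_nat_mul]
  congr 1; push_cast; ring

theorem normSqY_timeWeight_mul {ζ t : ℝ} {g : ℝ → ℂ} (hg : MemLp g 2 muY) :
    normSqY (fun y => timeWeight ζ ν t * g y)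
      = ENNReal.ofReal (Real.exp (2 * (ζ * ν ^ (1 / 3 : ℝ)) * t) * ∫ y, ‖g y‖ ^ 2 ∂muY) := by
  rw [normSqY_const_mul, norm_timeWeight_sq, normSqY_eq_ofReal hg,
    ← ENNReal.ofReal_mul (Real.exp_pos _).le]

theorem ofReal_integral_le_normSqTY {ζ T : ℝ} {f : ℝ → ℝ → ℂ}
    (hf : MemLp (fun p : ℝ × ℝ => f p.1 p.2) 2 ((volume.restrict (Ioo 0 T)).prod muY)) :
    ENNReal.ofReal (∫ s in Ioo 0 T, Real.exp (2 * (ζ * ν ^ (1 / 3 : ℝ)) * s) * ‖curryL2 f s‖ ^ 2)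
      ≤ normSqTY (fun t y => timeWeight ζ ν t * f t y) := by
  rw [ofReal_integral_eq_lintegral_ofReal
    (integrable_exp_mul ((memLp_curryL2 hf).integrable_norm_pow (by norm_num)))
    (Filter.Eventually.of_forall fun s => by positivity)]
  refine le_trans (le_of_eq (lintegral_congr_ae ?_))
    (lintegral_mono' (Measure.restrict_mono Ioo_subset_Ioi_self le_rfl) le_rfl)
  filter_upwards [ae_memLp_section hf] with s hs
  rw [normSqY_timeWeight_mul hs, norm_sq_curryL2 hs]

/-- Up to a finite time the data of the abstract evolution are bounded by the data of the problem. -/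
theorem ofReal_data_le (hν : 0 < ν) {ζ T : ℝ} {f₁ f₂ : ℝ → ℝ → ℂ} {ωin : ℝ → ℂ}
    (hωin : MemLp ωin 2 muY) (hc : Consistent k ωin)
    (hf₁ : MemLp (fun p : ℝ × ℝ => f₁ p.1 p.2) 2 ((volume.restrict (Ioo 0 T)).prod muY))
    (hf₂ : MemLp (fun p : ℝ × ℝ => f₂ p.1 p.2) 2 ((volume.restrict (Ioo 0 T)).prod muY)) :
    ENNReal.ofReal (‖vorticityL2 k (fun _ => ωin) 0‖ ^ 2 + ν⁻¹ * ∫ s in Ioo 0 T,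
        Real.exp (2 * (ζ * ν ^ (1 / 3 : ℝ)) * s) * ‖forceL2 f₁ f₂ s‖ ^ 2)
      ≤ ENNReal.ofReal ν⁻¹ * (normSqTY (fun t y => timeWeight ζ ν t * f₁ t y)
          + normSqTY (fun t y => timeWeight ζ ν t * f₂ t y)) + normSqY ωin := by
  have hi : ∀ {f : ℝ → ℝ → ℂ},
      MemLp (fun p : ℝ × ℝ => f p.1 p.2) 2 ((volume.restrict (Ioo 0 T)).prod muY) →
      Integrable (fun s => Real.exp (2 * (ζ * ν ^ (1 / 3 : ℝ)) * s) * ‖curryL2 f s‖ ^ 2)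
        (volume.restrict (Ioo 0 T)) := fun hf =>
    integrable_exp_mul ((memLp_curryL2 hf).integrable_norm_pow (by norm_num))
  have hn : ∀ f : ℝ → ℝ → ℂ, 0 ≤ ∫ s in Ioo 0 T,
      Real.exp (2 * (ζ * ν ^ (1 / 3 : ℝ)) * s) * ‖curryL2 f s‖ ^ 2 :=
    fun f => integral_nonneg fun s => by positivity
  simp only [norm_sq_forceL2, mul_add]
  rw [integral_add (hi hf₁) (hi hf₂), add_comm (‖vorticityL2 k (fun _ => ωin) 0‖ ^ 2),
    ENNReal.ofReal_add (by have := hn f₁; have := hn f₂; positivity) (by positivity)]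
  refine add_le_add ?_ (le_of_eq ?_)
  · rw [← mul_add, ENNReal.ofReal_mul (by positivity), ENNReal.ofReal_add (hn f₁) (hn f₂)]
    exact mul_le_mul' le_rfl
      (add_le_add (ofReal_integral_le_normSqTY hf₁) (ofReal_integral_le_normSqTY hf₂))
  · rw [norm_sq_vorticityL2 (ω := fun _ => ωin) hωin hc, normSqY_eq_ofReal hωin]

variable {B : ℝ} {Uin : ℝ → ℝ} {S₀ S₁ S₂ : ℝ → BoundedContinuousFunction ℝ ℝ}
  {f₁ f₂ : ℝ → ℝ → ℂ} {ωin : ℝ → ℂ} {ω ψ : ℝ → ℝ → ℂ}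

/-- The estimate for a given background flow, the constant depending on a bound for `∂_y^2 U`. -/
theorem IsSolution.estimate (hs : IsSolution ν k (heatShear ν Uin) f₁ f₂ ωin ω ψ)
    (hν : 0 < ν) (hk : k ≠ 0) (hf : HighFrequency ν k (heatShear ν Uin)) (hB : 0 ≤ B)
    (h : IsHeatProfile B ν Uin S₀ S₁ S₂) (hωin : MemLp ωin 2 muY)
    (hf₁ : ∀ T : ℝ, MemLp (fun p : ℝ × ℝ => f₁ p.1 p.2) 2 ((volume.restrict (Ioo 0 T)).prod muY))
    (hf₂ : ∀ T : ℝ, MemLp (fun p : ℝ × ℝ => f₂ p.1 p.2) 2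
      ((volume.restrict (Ioo 0 T)).prod muY)) :
    normSqSupTY (fun t y => timeWeight (1 / 32) ν t * (Real.sqrt (1 - |y|) : ℂ) * ω t y)
        + normSqTZ ν k (fun t y => timeWeight (1 / 32) ν t * ω t y)
      ≤ ENNReal.ofReal (7 * (32 * (1 + 2 * (4 + 2 * B) + 2 * 16) + 2)) *
        (ENNReal.ofReal ν⁻¹ * (normSqTY (fun t y => timeWeight (1 / 32) ν t * f₁ t y)
          + normSqTY (fun t y => timeWeight (1 / 32) ν t * f₂ t y)) + normSqY ωin) := by
  have hD := hs.dissipativeEvolution hν hk hf h hωin hf₁ hf₂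
  have hm1 := hf.one_le hν h
  have hk2 := one_le_sq_of_ne_zero hk
  have hσ0 : 0 ≤ 1 / 32 * ν ^ (1 / 3 : ℝ) := by positivity
  have hσ : 1 / 32 * ν ^ (1 / 3 : ℝ) * ((k : ℝ) ^ 2)⁻¹ ≤ ν / 16 := by
    rw [← div_eq_mul_inv, div_le_iff₀ (by positivity)]
    linarith [rpow_le_of_highFrequency hν hk hm1]
  have hdata := fun T => ofReal_data_le hν (ζ := 1 / 32) hωin hs.consistent_init (hf₁ T) (hf₂ T)
  set R := ENNReal.ofReal ν⁻¹ * (normSqTY (fun t y => timeWeight (1 / 32) ν t * f₁ t y)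
          + normSqTY (fun t y => timeWeight (1 / 32) ν t * f₂ t y)) + normSqY ωin
  set C₀ := 32 * (1 + 2 * (4 + 2 * B) + 2 * 16) + 2 with hC₀
  have hC0 : 0 ≤ C₀ := by positivity
  have hω : ∀ᵐ t ∂muT, normSqY (fun y => timeWeight (1 / 32) ν t * ω t y)
      = ENNReal.ofReal (Real.exp (2 * (1 / 32 * ν ^ (1 / 3 : ℝ)) * t) * ‖vorticityL2 k ω t‖ ^ 2) := by
    filter_upwards [hs.ae_memLp, hs.consistent] with t m1 m2
    rw [normSqY_timeWeight_mul m1, norm_sq_vorticityL2 m1 m2]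
  have hsup : normSqSupTY (fun t y => timeWeight (1 / 32) ν t * (Real.sqrt (1 - |y|) : ℂ) * ω t y)
      ≤ ENNReal.ofReal C₀ * R := by
    refine essSup_le_of_ae_le _ ?_
    filter_upwards [hω, hD.exp_mul_norm_sq_le hσ0 hσ (by positivity) (by norm_num)] with t h1 h2
    calc normSqY (fun y => timeWeight (1 / 32) ν t * (Real.sqrt (1 - |y|) : ℂ) * ω t y)
        ≤ normSqY (fun y => timeWeight (1 / 32) ν t * ω t y) := by
          refine normSqY_mono (Filter.Eventually.of_forall fun y => ?_)
          rw [norm_mul, norm_mul, norm_mul, Complex.norm_real,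
            Real.norm_of_nonneg (Real.sqrt_nonneg _)]
          refine mul_le_mul_of_nonneg_right (mul_le_of_le_one_right (norm_nonneg _)
            (Real.sqrt_le_one.2 ?_)) (norm_nonneg _)
          linarith [abs_nonneg y]
      _ ≤ _ := by
          rw [h1]
          refine (ENNReal.ofReal_le_ofReal h2).trans ?_
          rw [ENNReal.ofReal_mul hC0]
          exact mul_le_mul' le_rfl (hdata t)
  have hZ : normSqTZ ν k (fun t y => timeWeight (1 / 32) ν t * ω t y)
      ≤ ENNReal.ofReal (6 * C₀) * R := by
    refine lintegral_muT_le fun T hT => ?_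
    have hI := hD.exp_mul_integral_le hσ0 hσ hT
    rw [div_inv_eq_mul] at hI
    have hi : Integrable (fun t => Real.exp (2 * (1 / 32 * ν ^ (1 / 3 : ℝ)) * t)
        * ‖vorticityL2 k ω t‖ ^ 2) (volume.restrict (Ioo 0 T)) :=
      integrable_exp_mul ((hD.u_memLp T).integrable_norm_pow (by norm_num))
    have hdata0 : 0 ≤ ‖vorticityL2 k (fun _ => ωin) 0‖ ^ 2 + ν⁻¹ * ∫ s in Ioo 0 T,
        Real.exp (2 * (1 / 32 * ν ^ (1 / 3 : ℝ)) * s) * ‖forceL2 f₁ f₂ s‖ ^ 2 :=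
      add_nonneg (sq_nonneg _)
        (mul_nonneg (by positivity) (integral_nonneg fun s => by positivity))
    calc ∫⁻ t in Ioo 0 T, normSqZ ν k (fun y => timeWeight (1 / 32) ν t * ω t y)
        ≤ ∫⁻ t in Ioo 0 T, ENNReal.ofReal (6 * (ν * (k : ℝ) ^ 2))
            * ENNReal.ofReal (Real.exp (2 * (1 / 32 * ν ^ (1 / 3 : ℝ)) * t)
              * ‖vorticityL2 k ω t‖ ^ 2) := by
          refine lintegral_mono_ae ?_
          filter_upwards [ae_restrict_Ioo_of_ae_muT hω, ae_restrict_Ioo_of_ae_muT hs.ae_memLp]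
            with t h1 h2
          rw [← h1]
          exact normSqZ_le hν hm1 (h2.const_mul _)
      _ = ENNReal.ofReal (6 * (ν * (k : ℝ) ^ 2 * ∫ t in Ioo 0 T,
            Real.exp (2 * (1 / 32 * ν ^ (1 / 3 : ℝ)) * t) * ‖vorticityL2 k ω t‖ ^ 2)) := by
          rw [lintegral_const_mul' _ _ ENNReal.ofReal_ne_top,
            ← ofReal_integral_eq_lintegral_ofReal hi
              (Filter.Eventually.of_forall fun s => by positivity),
            ← ENNReal.ofReal_mul (by positivity), mul_assoc 6]
      _ ≤ ENNReal.ofReal (6 * C₀ * (‖vorticityL2 k (fun _ => ωin) 0‖ ^ 2 + ν⁻¹ * ∫ s in Ioo 0 T,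
            Real.exp (2 * (1 / 32 * ν ^ (1 / 3 : ℝ)) * s) * ‖forceL2 f₁ f₂ s‖ ^ 2)) := by
          refine ENNReal.ofReal_le_ofReal ?_
          rw [mul_assoc 6 C₀]
          refine mul_le_mul_of_nonneg_left (hI.trans ?_) (by norm_num)
          exact mul_le_mul_of_nonneg_right (by rw [hC₀]; linarith) hdata0
      _ ≤ _ := by
          rw [ENNReal.ofReal_mul (by positivity)]
          exact mul_le_mul' le_rfl (hdata T)
  refine (add_le_add hsup hZ).trans (le_of_eq ?_)
  rw [← add_mul, ← ENNReal.ofReal_add hC0 (by positivity)]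
  congr 2; ring

end Norms

end NearCouette

end

theorem mainTheorem8 :
    ∃ ζ : ℝ, 0 < ζ ∧ ∀ K : ℝ, 0 < K → ∃ C : ℝ, 0 < C ∧
      ∀ (ν : ℝ) (k : ℤ) (Uin : ℝ → ℝ) (f₁ f₂ : ℝ → ℝ → ℂ) (ωin : ℝ → ℂ) (ω ψ : ℝ → ℝ → ℂ),
        0 < ν → k ≠ 0 →
        NearCouette.AdmissibleShear K Uin →
        NearCouette.HighFrequency ν k (NearCouette.heatShear ν Uin) →
        MemLp ωin 2 NearCouette.muY →
        (∀ T : ℝ, MemLp (fun p : ℝ × ℝ => f₁ p.1 p.2) 2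
          ((volume.restrict (Ioo 0 T)).prod NearCouette.muY)) →
        (∀ T : ℝ, MemLp (fun p : ℝ × ℝ => f₂ p.1 p.2) 2
          ((volume.restrict (Ioo 0 T)).prod NearCouette.muY)) →
        NearCouette.IsSolution ν k (NearCouette.heatShear ν Uin) f₁ f₂ ωin ω ψ →
        NearCouette.normSqSupTY (fun t y =>
            NearCouette.timeWeight ζ ν t * (Real.sqrt (1 - |y|) : ℂ) * ω t y)
          + NearCouette.normSqTZ ν k (fun t y => NearCouette.timeWeight ζ ν t * ω t y)
          ≤ ENNReal.ofReal C *
            (ENNReal.ofReal ν⁻¹ *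
                (NearCouette.normSqTY (fun t y => NearCouette.timeWeight ζ ν t * f₁ t y)
                  + NearCouette.normSqTY (fun t y => NearCouette.timeWeight ζ ν t * f₂ t y))
              + NearCouette.normSqY ωin) := by
  refine ⟨1 / 32, by norm_num, fun K _ => ?_⟩
  obtain ⟨B, hB, hprofile⟩ := NearCouette.exists_isHeatProfile K
  refine ⟨7 * (32 * (1 + 2 * (4 + 2 * B) + 2 * 16) + 2), by positivity, ?_⟩
  intro ν k Uin f₁ f₂ ωin ω ψ hν hk hU hf hωin hf₁ hf₂ hs
  obtain ⟨S₀, S₁, S₂, h⟩ := hprofile ν Uin hν hU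
  exact hs.estimate hν hk hf hB h hωin hf₁ hf₂
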